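/- Fix a thermal conduction index $\nu>1$. Let $\xi:\mathbb R\to(0,1)$ be the solution of $\frac{d\xi}{dy}=\xi^{\nu+1}(1-\xi)$, $\xi(0)=\frac{\nu+1}{\nu+2}$; fix $y_0\in\mathbb R$ and put $\xi_0=\xi(y_0)$, $\xi_*(y)=\xi_0$ for $y\le y_0$, $\xi_*(y)=\xi(y)$ for $y>y_0$. For positive physical parameters $\rho_a,V_a,L_0,g,k$ let $Z(\rho)=\frac{\rho_a^{\nu+1}}{(\nu+1)\rho^{\nu+1}}$, and linearize the system $$\partial_t\rho+\mathrm{div}(\rho\vec u)=0,\quad \partial_t(\rho\vec u)+\mathrm{div}(\rho\vec u\otimes\vec u+p\,\mathrm{Id})=-\rho g\,\vec e_x,\quad \mathrm{div}(\vec u-L_0V_a\nabla Z(\rho))=V_a\tfrac{1-\xi_0}{\xi_0}\,\delta_{x-y_0L_0}$$ around its stationary solution $\rho_*(x)=\rho_a\xi_*(x/L_0)$, $\vec u_*=(-V_a/\xi_*(x/L_0),0)$ (the source is not perturbed). A complex number $\sigma$ with $\mathrm{Re}\,\sigma\ge 0$ is called a linear growth rate if the linearized system has a nontrivial solution proportional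 to $e^{ikz+\sigma t}$ for which the perturbations of $\rho u$, $\rho u^2+p$, $\rho uv$, $Z(\rho)$ and $u-L_0V_a\partial_xZ(\rho)$ are bounded and tend to $0$ as $x\to\pm\infty$. Put $\varepsilon=kL_0$, $Fr=\frac{V_a^2}{gL_0}$, $\alpha=\sqrt{\varepsilon/Fr}$, $\beta=\sqrt{\varepsilon Fr}$, and write $\sigma=\gamma\sqrt{gk}$. Fix $\beta>0$ and let $$\gamma_*=\sqrt{\frac{1-\xi_0}{1+\xi_0}}-\frac{\beta}{\xi_0}.$$ In the scaled unknowns $X=\left(\frac{\delta(\rho u)}{\rho_aV_a},\frac{\delta(\rho u^2+p)}{\rho_aV_a^2},\frac{-i\,\delta(\rho uv)}{\rho_aV_a^2},-\delta Z,\frac{\delta(u-L_0V_a\partial_xZ)}{V_a}\right)$, $y=x/L_0$, the normal mode equations are $\frac{dX}{dy}+M_0(\xi_*(y))X=0$ with $$M_0(s)=\begin{pmatrix}0&0&\alpha\beta s&\alpha\gamma s^{\nu+2}&0\\ \alpha\gamma&0&-\alpha\beta&\frac{\alpha}{\beta}s^{\nu+2}&0\\ \frac{2\alpha\beta}{s}&\alpha\beta&-\alpha\gamma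 s&\alpha\beta s^{\nu}&0\\ \frac1s&0&0&s^\nu&-1\\ 0&0&\alpha\beta&-\alpha^2\beta^2&0\end{pmatrix}.$$ The eigenvalues of $-M_0(s)$ are $\alpha\gamma s$, $\pm\alpha\beta$ and $\lambda_\pm(s)=-\frac{s^\nu}{2}\pm\sqrt{\frac{s^{2\nu}}4+\alpha\gamma s^{\nu+1}+\alpha^2\beta^2}$ (root of positive real part). The corresponding eigenvectors are $E_0(s)=(\beta s,-2\beta,-\gamma s,0,\beta)$, $E_{a,+}(s)=(-\beta s,\beta+\gamma s,\beta,0,-\beta)$, $E_{a,-}(s)=(-\beta s,\beta-\gamma s,-\beta,0,-\beta)$ and $F_\pm(s)=(0,0,0,1,0)+\alpha R+\frac{\alpha^2}{\lambda_\pm-\alpha\gamma s}T+\frac{\alpha^3s^2}{(\lambda_\pm-\alpha\gamma s)^2}E_0(s)$, where $R=(\gamma s^2,\frac{s^2}{\beta},\beta,0,0)$ and $T=(s(\gamma^2s^2-\beta^2),\ \beta^2-\gamma^2s^2+\frac{\gamma s^3}{\beta},\ -s^2,0,0)$. Let $w_+(y)\in\Lambda^2(\mathbb C^5)$ be the solution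 of the induced system on $\Lambda^2(\mathbb C^5)$ such that $\frac{e^{(\alpha\beta-\lambda_-(1))y}}{(1-\xi(y))e^y}\,w_+(y)\to\frac1{\alpha\beta}F_-(1)\wedge E_{a,-}(1)$ as $y\to+\infty$, and define the Evans function (normalized at $y_0$) by $$Ev(\alpha,\beta,\gamma,\xi_0)=\frac{\xi_0}{1-\xi_0}\,\alpha\beta\; w_+(y_0)\wedge E_0(\xi_0)\wedge E_{a,+}(\xi_0)\wedge F_+(\xi_0).$$ Then: 1. For every $\gamma\in\mathbb C$ with $\mathrm{Re}\,\gamma\ge0$ and $\gamma\xi_0\ne\beta$, $w_+$ exists and is unique for all sufficiently small $\alpha>0$, and $$\lim_{\alpha\to0^+}Ev(\alpha,\beta,\gamma,\xi_0)=\beta(\beta-\gamma\xi_0)^2\frac{\xi_0^\nu}{\beta^2-\gamma^2\xi_0^2}\left[\xi_0^2(1-\xi_0)-(1+\xi_0)(\beta+\gamma\xi_0)^2\right].$$ 2. For all $M$ and $\epsilon>0$ there is $\alpha_0>0$ such that, for all parameters with this value of $\beta$ and with $\alpha<\alpha_0$, every $\gamma$ with $|\gamma|\le M$ for which $\gamma\sqrt{gk}$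 is a linear growth rate satisfies $|\gamma-\gamma_*|<\epsilon$. (In particular there is none when $\gamma_*<0$ and $\alpha$ is small.) 3. If $\gamma_*>0$, then for all $M>\gamma_*$ and $\epsilon>0$ there is $\alpha_0>0$ such that, for all parameters with this value of $\beta$ and with $\alpha<\alpha_0$, there is exactly one $\gamma$ with $|\gamma|\le M$ for which $\gamma\sqrt{gk}$ is a linear growth rate; it is real and $|\gamma-\gamma_*|<\epsilon$. So the growth rate tends to $\gamma_*$ as $\alpha\to0$. 4. For all parameters with this value of $\beta$, $\gamma_*\sqrt{gk}=\sqrt{gk\,\frac{\rho_a-\rho_0}{\rho_a+\rho_0}}-k\frac{V_a}{\xi_0}$, where $\rho_0=\rho_a\xi_0$ is the density and $V_a/\xi_0$ the speed of the flow in $x\le y_0L_0$. -/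

import Mathlib

open Filter Topology

noncomputable section

namespace KullAnisimov

/-! ### The stationary density profile -/

/-- The dimensionless density profile `ξ`: the solution on the whole line of
`dξ/dy = ξ^(ν+1) (1 - ξ)`, `ξ(0) = (ν+1)/(ν+2)`. -/
structure IsDensityProfile (ν : ℝ) (ξ : ℝ → ℝ) : Prop where
  ode : ∀ y, HasDerivAt ξ (ξ y ^ (ν + 1) * (1 - ξ y)) y
  init : ξ 0 = (ν + 1) / (ν + 2)

/-- The simplified profile: constant, equal to `ξ(y₀)`, for `y ≤ y₀`, and equal to `ξ` for
`y > y₀`. -/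
def modelProfile (ξ : ℝ → ℝ) (y₀ y : ℝ) : ℝ := if y ≤ y₀ then ξ y₀ else ξ y

/-! ### Physical parameters -/

/-- The physical parameters: reference density, velocity at `+∞`, characteristic length,
gravity, transverse wave number. -/
structure Params where
  rhoA : ℝ
  Va : ℝ
  L0 : ℝ
  g : ℝ
  k : ℝ
  rhoA_pos : 0 < rhoA
  Va_pos : 0 < Va
  L0_pos : 0 < L0
  g_pos : 0 < g
  k_pos : 0 < k

namespace Params

/-- `ε = k L₀`. -/
def eps (P : Params) : ℝ := P.k * P.L0

/-- The Froude number `Fr = V_a² / (g L₀)`. -/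
def Fr (P : Params) : ℝ := P.Va ^ 2 / (P.g * P.L0)

/-- `α = √(ε / Fr)`. -/
def alpha (P : Params) : ℝ := Real.sqrt (P.eps / P.Fr)

/-- `β = √(ε Fr)`. -/
def beta (P : Params) : ℝ := Real.sqrt (P.eps * P.Fr)

end Params

/-- `Z(ρ) = ρ_a^(ν+1) / ((ν+1) ρ^(ν+1))`. -/
def Zfun (P : Params) (ν ρ : ℝ) : ℝ := P.rhoA ^ (ν + 1) / ((ν + 1) * ρ ^ (ν + 1))

/-- The stationary density `ρ_*(x) = ρ_a ξ_*(x / L₀)` of the model. -/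
def rhoStar (P : Params) (ξ : ℝ → ℝ) (y₀ x : ℝ) : ℝ := P.rhoA * modelProfile ξ y₀ (x / P.L0)

/-- The stationary velocity `u_*(x) = - V_a / ξ_*(x / L₀)` of the model, so that
`ρ_* u_* = - ρ_a V_a`. -/
def uStar (P : Params) (ξ : ℝ → ℝ) (y₀ x : ℝ) : ℝ := -P.Va / modelProfile ξ y₀ (x / P.L0)

/-! ### Normal modes of the linearized system

The nonlinear system is
`∂ₜρ + div(ρ u) = 0`, `∂ₜ(ρ u) + div(ρ u ⊗ u + p Id) = - ρ g e_x`,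
`div(u - L₀ V_a ∇Z(ρ)) = V_a (1 - ξ₀)/ξ₀ δ_{x = y₀ L₀}`.
It is linearized at `(ρ_*, (u_*, 0), p_*)`, and the perturbation of `(ρ, (u, v), p)` is
`(r(x), (u(x), v(x)), p(x)) e^{ikz + σt}`. The source term is a fixed measure which is not
perturbed: it contributes nothing to the linearized equations, which therefore say that the five
perturbed quantities under `d/dx` are differentiable across `x = y₀ L₀` as well (all the right
hand sides below are continuous functions of these five quantities and of `x`). -/

/-- Perturbation of the mass flux `ρ u`. -/
def massFlux (P : Params) (ξ : ℝ → ℝ) (y₀ : ℝ) (r u : ℝ → ℂ) (x : ℝ) : ℂ :=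
  rhoStar P ξ y₀ x * u x + uStar P ξ y₀ x * r x

/-- Perturbation of `ρ u² + p`. -/
def momentumFlux (P : Params) (ξ : ℝ → ℝ) (y₀ : ℝ) (r u p : ℝ → ℂ) (x : ℝ) : ℂ :=
  (uStar P ξ y₀ x : ℂ) ^ 2 * r x + 2 * rhoStar P ξ y₀ x * uStar P ξ y₀ x * u x + p x

/-- Perturbation of `ρ u v`. -/
def shearFlux (P : Params) (ξ : ℝ → ℝ) (y₀ : ℝ) (v : ℝ → ℂ) (x : ℝ) : ℂ :=
  rhoStar P ξ y₀ x * uStar P ξ y₀ x * v x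

/-- Perturbation of `Z(ρ)`. -/
def zPert (P : Params) (ν : ℝ) (ξ : ℝ → ℝ) (y₀ : ℝ) (r : ℝ → ℂ) (x : ℝ) : ℂ :=
  (deriv (Zfun P ν) (rhoStar P ξ y₀ x) : ℝ) * r x

/-- Perturbation of `u - L₀ V_a ∂ₓ Z(ρ)`. -/
def thermalFlux (P : Params) (ν : ℝ) (ξ : ℝ → ℝ) (y₀ : ℝ) (r u : ℝ → ℂ) (x : ℝ) : ℂ :=
  u x - P.L0 * P.Va * deriv (zPert P ν ξ y₀ r) x

/-- The normal mode equations, for the wave number `P.k` and the rate `σ`. -/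
structure IsNormalMode (P : Params) (ν : ℝ) (ξ : ℝ → ℝ) (y₀ : ℝ) (σ : ℂ)
    (r u v p : ℝ → ℂ) : Prop where
  mass : ∀ x, HasDerivAt (massFlux P ξ y₀ r u)
    (-(σ * r x + Complex.I * P.k * (rhoStar P ξ y₀ x * v x))) x
  momentum_x : ∀ x, HasDerivAt (momentumFlux P ξ y₀ r u p)
    (-(σ * massFlux P ξ y₀ r u x + Complex.I * P.k * shearFlux P ξ y₀ v x) - P.g * r x) x
  momentum_z : ∀ x, HasDerivAt (shearFlux P ξ y₀ v)
    (-(σ * (rhoStar P ξ y₀ x * v x) + Complex.I * P.k * p x)) x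
  z_diff : Differentiable ℝ (zPert P ν ξ y₀ r)
  energy : ∀ x, HasDerivAt (thermalFlux P ν ξ y₀ r u)
    (-(Complex.I * P.k *
      (v x - P.L0 * P.Va * (Complex.I * P.k * zPert P ν ξ y₀ r x)))) x

/-- `U → 0` along the filter `l`, where `U` consists of the perturbations of
`ρu, ρu² + p, ρuv, Z(ρ), u - L₀ V_a ∂ₓ Z(ρ)`. -/
structure ModeTendsToZero (P : Params) (ν : ℝ) (ξ : ℝ → ℝ) (y₀ : ℝ)
    (r u v p : ℝ → ℂ) (l : Filter ℝ) : Prop where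
  mass : Tendsto (massFlux P ξ y₀ r u) l (𝓝 0)
  momentum : Tendsto (momentumFlux P ξ y₀ r u p) l (𝓝 0)
  shear : Tendsto (shearFlux P ξ y₀ v) l (𝓝 0)
  z : Tendsto (zPert P ν ξ y₀ r) l (𝓝 0)
  thermal : Tendsto (thermalFlux P ν ξ y₀ r u) l (𝓝 0)

/-- `σ` is a linear growth rate: `Re σ ≥ 0`, and there is a nontrivial normal mode which is bounded
and tends to `0` at `±∞` (it is continuous, so that boundedness follows from the limits). -/
def IsLinearGrowthRate (P : Params) (ν : ℝ) (ξ : ℝ → ℝ) (y₀ : ℝ) (σ : ℂ) : Prop :=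
  0 ≤ σ.re ∧ ∃ r u v p : ℝ → ℂ,
    IsNormalMode P ν ξ y₀ σ r u v p ∧ ¬ (r = 0 ∧ u = 0 ∧ v = 0 ∧ p = 0) ∧
    ModeTendsToZero P ν ξ y₀ r u v p atBot ∧ ModeTendsToZero P ν ξ y₀ r u v p atTop

/-- The dimensionless growth rates `γ = σ / √(gk)`. -/
def IsReducedGrowthRate (P : Params) (ν : ℝ) (ξ : ℝ → ℝ) (y₀ : ℝ) (γ : ℂ) : Prop :=
  IsLinearGrowthRate P ν ξ y₀ (γ * Real.sqrt (P.g * P.k))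

/-! ### The Evans function

In the scaled unknowns
`X = (δ(ρu)/(ρ_a V_a), δ(ρu²+p)/(ρ_a V_a²), -i δ(ρuv)/(ρ_a V_a²), - δZ, δ(u - L₀V_a∂ₓZ)/V_a)`
and `y = x / L₀` the normal mode equations are `dX/dy + M₀(ξ_*(y)) X = 0`. -/

/-- The matrix `M₀(ξ, α, β, γ)`; the first argument `s` is the value of the profile. -/
def M0 (ν s α β : ℝ) (γ : ℂ) : Matrix (Fin 5) (Fin 5) ℂ :=
  let sν : ℂ := ((s ^ ν : ℝ) : ℂ)
  !![0, 0, α * β * s, α * γ * sν * s ^ 2, 0;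
     α * γ, 0, -(α * β), α / β * sν * s ^ 2, 0;
     2 * α * β / s, α * β, -(α * γ * s), α * β * sν, 0;
     1 / s, 0, 0, sν, -1;
     0, 0, α * β, -(α ^ 2 * β ^ 2), 0]

/-- The square root (of nonnegative real part) in the thermal eigenvalues. -/
def thermalRoot (ν s α β : ℝ) (γ : ℂ) : ℂ :=
  (((s ^ (2 * ν) / 4 : ℝ) : ℂ) + α * γ * ((s ^ (ν + 1) : ℝ) : ℂ) + α ^ 2 * β ^ 2) ^ (1 / 2 : ℂ)

/-- The eigenvalue `λ₊` of `-M₀`. -/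
def lambdaPlus (ν s α β : ℝ) (γ : ℂ) : ℂ := -((s ^ ν : ℝ) : ℂ) / 2 + thermalRoot ν s α β γ

/-- The eigenvalue `λ₋` of `-M₀`. -/
def lambdaMinus (ν s α β : ℝ) (γ : ℂ) : ℂ := -((s ^ ν : ℝ) : ℂ) / 2 - thermalRoot ν s α β γ

/-- Eigenvector of `-M₀` for the eigenvalue `α γ ξ`. -/
def E0 (s β : ℝ) (γ : ℂ) : Fin 5 → ℂ := ![β * s, -(2 * β), -(γ * s), 0, β]

/-- Eigenvector of `-M₀` for the eigenvalue `α β`. -/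
def EaPlus (s β : ℝ) (γ : ℂ) : Fin 5 → ℂ := ![-(β * s), β + γ * s, β, 0, -β]

/-- Eigenvector of `-M₀` for the eigenvalue `-α β`. -/
def EaMinus (s β : ℝ) (γ : ℂ) : Fin 5 → ℂ := ![-(β * s), β - γ * s, -β, 0, -β]

/-- The vector `R̃⁰`. -/
def R0 (s β : ℝ) (γ : ℂ) : Fin 5 → ℂ := ![γ * s ^ 2, s ^ 2 / β, β, 0, 0]

/-- The vector `T̃⁰`. -/
def T0 (s β : ℝ) (γ : ℂ) : Fin 5 → ℂ :=
  ![s * (γ ^ 2 * s ^ 2 - β ^ 2), β ^ 2 - γ ^ 2 * s ^ 2 + γ * s ^ 3 / β, -(s : ℂ) ^ 2, 0, 0]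

/-- Eigenvector of `-M₀` for the thermal eigenvalue `lam = λ₊` or `λ₋`. -/
def Fvec (s α β : ℝ) (γ lam : ℂ) : Fin 5 → ℂ :=
  ![0, 0, 0, 1, 0] + (α : ℂ) • R0 s β γ
    + ((α : ℂ) ^ 2 / (lam - α * γ * s)) • T0 s β γ
    + ((α : ℂ) ^ 3 * s ^ 2 / (lam - α * γ * s) ^ 2) • E0 s β γ

/-- The wedge product `a ∧ b` of two vectors as an antisymmetric matrix. -/
def wedge (a b : Fin 5 → ℂ) : Matrix (Fin 5) (Fin 5) ℂ :=
  Matrix.of fun i j => a i * b j - a j * b i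

/-- The coefficient of `w ∧ a ∧ b ∧ c` on `i₁ ∧ i₂ ∧ i₃ ∧ i₄ ∧ i₅`, for a bivector `w` given by an
antisymmetric matrix. -/
def wedgeTop (w : Matrix (Fin 5) (Fin 5) ℂ) (a b c : Fin 5 → ℂ) : ℂ :=
  (1 / 2) * ∑ i, ∑ j,
    w i j * (Matrix.of ![Pi.single i (1 : ℂ), Pi.single j (1 : ℂ), a, b, c]).det

/-- The fastest decaying bivector `w₊⁽²⁾` at `+∞`: it solves the system induced on bivectors by
`dX/dy + M₀(ξ_*(y)) X = 0`, and `w(y) e^{(αβ - λ₋(1)) y}` is equivalent to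
`(1 - ξ(y)) e^y / (αβ) • F₋(1) ∧ E_{a,-}(1)` at `+∞` (where `(1 - ξ(y)) e^y` tends to a positive
constant). -/
structure IsWPlus (ν : ℝ) (ξ : ℝ → ℝ) (y₀ α β : ℝ) (γ : ℂ)
    (w : ℝ → Matrix (Fin 5) (Fin 5) ℂ) : Prop where
  antisymm : ∀ y, (w y).transpose = -w y
  ode : ∀ y i j, HasDerivAt (fun t => w t i j)
    (-(M0 ν (modelProfile ξ y₀ y) α β γ * w y
        + w y * (M0 ν (modelProfile ξ y₀ y) α β γ).transpose) i j) y
  limit : ∀ i j, Tendsto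
    (fun y : ℝ => Complex.exp ((α * β - lambdaMinus ν 1 α β γ) * y)
      / ((1 - ξ y) * Real.exp y) * w y i j) atTop
    (𝓝 ((α * β : ℂ)⁻¹ * wedge (Fvec 1 α β γ (lambdaMinus ν 1 α β γ)) (EaMinus 1 β γ) i j))

open Classical in
/-- The bivector `w₊⁽²⁾` (and `0` if there is none). -/
def wPlus (ν : ℝ) (ξ : ℝ → ℝ) (y₀ α β : ℝ) (γ : ℂ) : ℝ → Matrix (Fin 5) (Fin 5) ℂ :=
  if h : ∃ w, IsWPlus ν ξ y₀ α β γ w then h.choose else 0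

/-- The Evans function of the model: `αβ w₊⁽²⁾ ∧ w₋⁽³⁾` at the point `y = y₀`, where
`w₋⁽³⁾(y) = e^{(αγξ₀ + αβ + λ₊(ξ₀)) (y - y₀)} E₀(ξ₀) ∧ E_{a,+}(ξ₀) ∧ F₊(ξ₀)` for `y ≤ y₀`, times the
factor `ξ₀ / (1 - ξ₀)`, which cancels the value at `y₀` of the normalization
`w₊⁽²⁾ ∼ (1 - ξ) / ξ`. -/
def evans (ν : ℝ) (ξ : ℝ → ℝ) (y₀ α β : ℝ) (γ : ℂ) : ℂ :=
  α * β * (ξ y₀ / (1 - ξ y₀)) *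
    wedgeTop (wPlus ν ξ y₀ α β γ y₀) (E0 (ξ y₀) β γ) (EaPlus (ξ y₀) β γ)
      (Fvec (ξ y₀) α β γ (lambdaPlus ν (ξ y₀) α β γ))

end KullAnisimov

end

open KullAnisimov

/-!
In the limit `α → 0` with `β` fixed, the only row of `M₀` that survives is the thermal one, and the
thermal unknown then obeys a scalar equation damped at the rate `s ^ ν`, driven by the other four
unknowns, which become constant. After the factor `e^{-αβ y}` (slow mode) or `fastFactor` (fast
mode) has been taken out, the equation for the correction to the asymptotic eigenvector is a fixed
point problem for bounded functions whose `α = 0` part squares to zero. It is therefore a regular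
perturbation problem (`exists_perturbed_fixedPoint`, `IsModelProfile.exists_weighted_solution`), and
its solutions are holomorphic in `γ` and converge as `α → 0⁺`, locally uniformly in `γ`. This yields
a fast mode `φ`, asymptotic to a multiple of `e^{λ₋(1) y} F₋(1)`, and a slow mode `ψ`, asymptotic to
a combination of `e^{-αβ y} E_{a,-}(1)` and the fast mode.

At a frozen density, `leftForms` brings the system to triangular form. These linear forms do not
degenerate at `γ ξ₀ = β`, where the eigenvectors do, so that no value of `γ` in the closed right
half plane is exceptional. They show that every mode which tends to `0` at `+∞` is a combination of
`φ` and `ψ` (`IsModelProfile.exists_isDecayingBasis`), and that a mode which tends to `0` at `-∞` is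
annihilated at `y₀` by two of the forms, the one for `λ₋` and the one for `-αβ`. Growth rates are
thus zeros of a `2 × 2` determinant `matching`, holomorphic in `γ`; conversely a zero with
`Re γ > 0` is a growth rate (`IsDecayingBasis.eventually_hasGrowingMode`).

The determinant converges to `matchingLimit`, which vanishes in the closed right half plane only
where `β + γ ξ₀ = ξ₀ √((1 - ξ₀) / (1 + ξ₀))`, that is at `γ = γ_*`, and there the zero is simple.
Compactness of the half disc localizes the growth rates near `γ_*`, and the persistence of a simple
zero (`eventually_exists_unique_zero`) gives exactly one when `γ_* > 0`. It is real because the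
complex conjugate of a growth rate is a growth rate. The passage between the physical and the scaled
unknowns is `isReducedGrowthRate_iff`.

For the Evans function, `w₊` is a normalized `φ ∧ ψ` (`IsDecayingBasis.eventually_isWPlus`). It is
unique because `λ₋(1) - αβ` has the least real part among the sums of two rates at `+∞`, so that a
difference of two candidates, which is `o` of that rate, vanishes
(`IsModelProfile.bivector_eq_zero`). The Evans function is a `5 × 5` determinant in which the `E₀`
component of `F₊` drops out, and the limit is computed with `tendsto_coef_T0` and `det_limit`.
-/

namespace KullAnisimov

open BoundedContinuousFunction Asymptotics

/-! ### The density profile -/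

theorem eq_mul_exp_of_hasDerivAt {u c : ℝ → ℝ} (hc : Continuous c)
    (hu : ∀ y, HasDerivAt u (c y * u y) y) (y : ℝ) :
    u y = u 0 * Real.exp (∫ t in (0 : ℝ)..y, c t) := by
  have hC : ∀ y, HasDerivAt (fun y => ∫ t in (0 : ℝ)..y, c t) (c y) y := fun y =>
    hc.integral_hasStrictDerivAt 0 y |>.hasDerivAt
  have h : ∀ y, HasDerivAt (fun y => u y * Real.exp (-∫ t in (0 : ℝ)..y, c t)) 0 y := by
    intro y
    have := (hu y).mul ((hC y).neg.exp)
    refine HasDerivAt.congr_deriv this ?_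
    ring
  have h2 := is_const_of_deriv_eq_zero (fun y => (h y).differentiableAt) (fun y => (h y).deriv) y 0
  simp only [intervalIntegral.integral_same, neg_zero, Real.exp_zero, mul_one] at h2
  rw [← h2, mul_assoc, ← Real.exp_add]
  simp

namespace IsDensityProfile

variable {ν : ℝ} {ξ : ℝ → ℝ}

theorem continuous (h : IsDensityProfile ν ξ) : Continuous ξ :=
  continuous_iff_continuousAt.2 fun y => (h.ode y).continuousAt

theorem lt_one (h : IsDensityProfile ν ξ) (hν : 1 < ν) (y : ℝ) : ξ y < 1 := by
  have hc : Continuous fun y => -(ξ y ^ (ν + 1)) :=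
    (h.continuous.rpow_const fun _ => Or.inr (by linarith)).neg
  have := eq_mul_exp_of_hasDerivAt (u := fun y => 1 - ξ y) hc
    (fun y => by
      have := (h.ode y).const_sub 1
      refine HasDerivAt.congr_deriv this ?_
      ring) y
  have h0 : 0 < 1 - ξ 0 := by
    rw [h.init, sub_pos, div_lt_one (by linarith)]
    linarith
  have : 0 < 1 - ξ y := by
    rw [this]
    positivity
  linarith

theorem pos (h : IsDensityProfile ν ξ) (hν : 1 < ν) (y : ℝ) : 0 < ξ y := by
  have hc : Continuous fun y => ξ y ^ ν * (1 - ξ y) :=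
    (h.continuous.rpow_const fun _ => Or.inr (by linarith)).mul (continuous_const.sub h.continuous)
  have := eq_mul_exp_of_hasDerivAt (u := ξ) hc
    (fun y => by
      have := h.ode y
      refine HasDerivAt.congr_deriv this ?_
      by_cases hy : ξ y = 0
      · simp [hy, Real.zero_rpow (show ν + 1 ≠ 0 by linarith)]
      · rw [Real.rpow_add_one hy]
        ring) y
  have h0 : 0 < ξ 0 := by
    rw [h.init]
    apply div_pos <;> linarith
  rw [this]
  positivity

theorem monotone (h : IsDensityProfile ν ξ) (hν : 1 < ν) : Monotone ξ :=
  monotone_of_hasDerivAt_nonneg h.ode fun y => by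
    have := h.pos hν y
    have := h.lt_one hν y
    have : 0 < 1 - ξ y := by linarith
    simp only [Pi.zero_apply]
    positivity

end IsDensityProfile

/-- The features of the simplified profile `s` used in the analysis: it is continuous, equal to
`ξ₀` on `(-∞, y₀]`, takes its values in `[ξ₀, 1)`, and tends to `1` at `+∞` with the exponential
rate `2θ`, where `2θ` is also a lower bound of the thermal decay rate `s ^ ν`. -/
structure IsModelProfile (ν y₀ ξ₀ θ : ℝ) (s : ℝ → ℝ) : Prop where
  one_lt_nu : 1 < ν
  theta_pos : 0 < θ
  xi_pos : 0 < ξ₀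
  continuous : Continuous s
  eq_left : ∀ y ≤ y₀, s y = ξ₀
  ge : ∀ y, ξ₀ ≤ s y
  lt_one : ∀ y, s y < 1
  decay : ∀ y, 1 - s y ≤ Real.exp (2 * θ * (y₀ - y))
  theta_le : 2 * θ ≤ ξ₀ ^ ν

theorem modelProfile_eq_of_ge (ξ : ℝ → ℝ) {y₀ y : ℝ} (h : y₀ ≤ y) :
    modelProfile ξ y₀ y = ξ y := by
  unfold modelProfile
  split_ifs with h'
  · rw [le_antisymm h h']
  · rfl

theorem IsDensityProfile.isModelProfile {ν : ℝ} {ξ : ℝ → ℝ} (h : IsDensityProfile ν ξ)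
    (hν : 1 < ν) (y₀ : ℝ) :
    IsModelProfile ν y₀ (ξ y₀) (ξ y₀ ^ (ν + 1) / 2) (modelProfile ξ y₀) := by
  have hp := h.pos hν y₀
  have hl := h.lt_one hν
  refine ⟨hν, by positivity, hp, ?_, ?_, ?_, ?_, ?_, ?_⟩
  · exact Continuous.if_le continuous_const h.continuous continuous_id continuous_const
      (by rintro x rfl; rfl)
  · intro y hy
    simp [modelProfile, hy]
  · intro y
    unfold modelProfile
    split_ifs with hy
    · exact le_rfl
    · exact h.monotone hν (le_of_not_ge hy)
  · intro y
    unfold modelProfile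
    split_ifs <;> exact hl _
  · intro y
    rcases le_total y y₀ with hy | hy
    · have : modelProfile ξ y₀ y = ξ y₀ := by simp [modelProfile, hy]
      rw [this]
      have : 1 ≤ Real.exp (2 * (ξ y₀ ^ (ν + 1) / 2) * (y₀ - y)) := by
        apply Real.one_le_exp
        have : 0 ≤ y₀ - y := by linarith
        positivity
      linarith
    · rw [modelProfile_eq_of_ge ξ hy]
      set a := ξ y₀ ^ (ν + 1) with ha
      have hmono : AntitoneOn (fun y => (1 - ξ y) * Real.exp (a * (y - y₀))) (Set.Ici y₀) := by
        have hd : ∀ y, HasDerivAt (fun y => (1 - ξ y) * Real.exp (a * (y - y₀)))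
            (-(ξ y ^ (ν + 1) * (1 - ξ y)) * Real.exp (a * (y - y₀))
              + (1 - ξ y) * (Real.exp (a * (y - y₀)) * (a * 1))) y := fun y =>
          ((h.ode y).const_sub 1).mul ((((hasDerivAt_id y).sub_const y₀).const_mul a).exp)
        apply antitoneOn_of_deriv_nonpos (convex_Ici _)
          (fun y _ => (hd y).continuousAt.continuousWithinAt)
          (fun y _ => (hd y).differentiableAt.differentiableWithinAt)
        intro y hy
        rw [interior_Ici] at hy
        rw [(hd y).deriv]
        have h1 : a ≤ ξ y ^ (ν + 1) :=
          Real.rpow_le_rpow hp.le (h.monotone hν (le_of_lt hy)) (by linarith)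
        have h2 : 0 < (1 - ξ y) * Real.exp (a * (y - y₀)) :=
          mul_pos (by linarith [hl y]) (Real.exp_pos _)
        nlinarith
      have h1 := hmono (Set.mem_Ici.2 le_rfl) (Set.mem_Ici.2 hy) hy
      simp only [sub_self, mul_zero, Real.exp_zero, mul_one] at h1
      have h2 : Real.exp (2 * (a / 2) * (y₀ - y)) = (Real.exp (a * (y - y₀)))⁻¹ := by
        rw [← Real.exp_neg]
        congr 1
        ring
      rw [h2, ← one_div, le_div_iff₀ (Real.exp_pos _)]
      linarith
  · have : ξ y₀ ^ (ν + 1) ≤ ξ y₀ ^ ν :=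
      Real.rpow_le_rpow_of_exponent_ge hp (hl y₀).le (by linarith)
    linarith

/-! ### Scalar linear equations -/

/-- The variation of constants formula for `u' = μ u + f` as an estimate. -/
theorem norm_exp_mul_sub_le {u f : ℝ → ℂ} {μ : ℂ} {K δ a b : ℝ} (hab : a ≤ b)
    (hδ : δ ≠ μ.re)
    (hu : ∀ t ∈ Set.Icc a b, HasDerivAt u (μ * u t + f t) t)
    (hf : ∀ t ∈ Set.Icc a b, ‖f t‖ ≤ K * Real.exp (δ * t)) :
    ‖Complex.exp (-μ * b) * u b - Complex.exp (-μ * a) * u a‖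
      ≤ K * (Real.exp ((δ - μ.re) * b) - Real.exp ((δ - μ.re) * a)) / (δ - μ.re) := by
  have hδ' : δ - μ.re ≠ 0 := sub_ne_zero.2 hδ
  have hE : ∀ t : ℝ, HasDerivAt (fun t : ℝ => Complex.exp (-μ * t))
      (Complex.exp (-μ * t) * (-μ)) t := by
    intro t
    have := ((hasDerivAt_id (t : ℂ)).const_mul (-μ)).cexp.comp_ofReal
    simpa using this
  have hd : ∀ t ∈ Set.Icc a b, HasDerivAt
      (fun t : ℝ => Complex.exp (-μ * t) * u t - Complex.exp (-μ * a) * u a)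
      (Complex.exp (-μ * t) * f t) t := by
    intro t ht
    have := ((hE t).mul (hu t ht)).sub_const (Complex.exp (-μ * a) * u a)
    refine HasDerivAt.congr_deriv this ?_
    ring
  have hB : ∀ t : ℝ, HasDerivAt
      (fun t => K * (Real.exp ((δ - μ.re) * t) - Real.exp ((δ - μ.re) * a)) / (δ - μ.re))
      (K * Real.exp ((δ - μ.re) * t)) t := by
    intro t
    have := (((((hasDerivAt_id t).const_mul (δ - μ.re)).exp).sub_const
      (Real.exp ((δ - μ.re) * a))).const_mul K).div_const (δ - μ.re)
    refine HasDerivAt.congr_deriv this ?_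
    field_simp
    simp
  have := image_norm_le_of_norm_deriv_right_le_deriv_boundary
    (f := fun t : ℝ => Complex.exp (-μ * t) * u t - Complex.exp (-μ * a) * u a)
    (fun t ht => (hd t ht).continuousAt.continuousWithinAt)
    (fun t ht => (hd t (Set.Ico_subset_Icc_self ht)).hasDerivWithinAt)
    (by simp) hB
    (fun t ht => by
      rw [norm_mul, Complex.norm_exp]
      have h1 := hf t (Set.Ico_subset_Icc_self ht)
      have h2 : (-μ * (t : ℂ)).re = -μ.re * t := by simp
      rw [h2]
      calc _ ≤ Real.exp (-μ.re * t) * (K * Real.exp (δ * t)) := by gcongr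
        _ = K * (Real.exp (-μ.re * t) * Real.exp (δ * t)) := by ring
        _ = _ := by rw [← Real.exp_add]; ring_nf)
  exact this (Set.right_mem_Icc.2 hab)

theorem norm_exp_neg_mul (μ : ℂ) (t : ℝ) :
    ‖Complex.exp (-μ * t)‖ = Real.exp (-(μ.re * t)) := by
  rw [Complex.norm_exp]
  simp

/-- A solution of `u' = μ u + f` which tends to `0` at `+∞` decays as fast as `f` when
`Re μ ≥ 0`. -/
theorem norm_le_of_tendsto_zero {u f : ℝ → ℂ} {μ : ℂ} {K θ y₁ : ℝ} (hθ : 0 < θ) (hμ : 0 ≤ μ.re)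
    (hu : ∀ t, y₁ ≤ t → HasDerivAt u (μ * u t + f t) t)
    (hf : ∀ t, y₁ ≤ t → ‖f t‖ ≤ K * Real.exp (-θ * t))
    (h0 : Tendsto u atTop (𝓝 0)) (t : ℝ) (ht : y₁ ≤ t) :
    ‖u t‖ ≤ K / θ * Real.exp (-θ * t) := by
  have hK : 0 ≤ K := by
    have := (norm_nonneg _).trans (hf t ht)
    exact nonneg_of_mul_nonneg_left this (Real.exp_pos _)
  have hne : -θ ≠ μ.re := by linarith
  have h1 : ∀ᶠ T : ℝ in atTop, ‖Complex.exp (-μ * T) * u T - Complex.exp (-μ * t) * u t‖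
      ≤ K * Real.exp ((-θ - μ.re) * t) / θ := by
    filter_upwards [eventually_ge_atTop t] with T hT
    refine (norm_exp_mul_sub_le (K := K) (δ := -θ) hT hne (fun s hs => hu s (ht.trans hs.1))
      (fun s hs => hf s (ht.trans hs.1))).trans ?_
    rw [← neg_div_neg_eq, ← mul_neg, neg_sub, neg_sub, sub_neg_eq_add]
    have : 0 < Real.exp ((-θ - μ.re) * T) := Real.exp_pos _
    gcongr <;> linarith
  have h2 : Tendsto (fun T : ℝ => Complex.exp (-μ * T) * u T) atTop (𝓝 0) := by
    rw [tendsto_zero_iff_norm_tendsto_zero] at h0 ⊢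
    refine squeeze_zero' (.of_forall fun _ => norm_nonneg _) ?_ h0
    filter_upwards [eventually_ge_atTop 0] with T hT
    rw [norm_mul, norm_exp_neg_mul]
    have : Real.exp (-(μ.re * T)) ≤ 1 := by
      apply Real.exp_le_one_iff.2
      have := mul_nonneg hμ hT
      linarith
    nlinarith [norm_nonneg (u T)]
  have h3 := le_of_tendsto (h2.sub_const (Complex.exp (-μ * t) * u t)).norm h1
  rw [zero_sub, norm_neg, norm_mul, norm_exp_neg_mul] at h3
  have h4 : Real.exp ((-θ - μ.re) * t) = Real.exp (-(μ.re * t)) * Real.exp (-θ * t) := by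
    rw [← Real.exp_add]
    ring_nf
  rw [h4] at h3
  refine le_of_mul_le_mul_left (h3.trans_eq ?_) (Real.exp_pos (-(μ.re * t)))
  ring

/-- Forward estimate for the stable equation `u' = μ u + f`, `Re μ < -θ`. -/
theorem norm_le_of_re_lt {u f : ℝ → ℂ} {μ : ℂ} {K θ y₁ : ℝ} (hμ : μ.re < -θ)
    (hu : ∀ t, y₁ ≤ t → HasDerivAt u (μ * u t + f t) t)
    (hf : ∀ t, y₁ ≤ t → ‖f t‖ ≤ K * Real.exp (-θ * t)) (t : ℝ) (ht : y₁ ≤ t) :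
    ‖u t‖ ≤ (Real.exp (θ * y₁) * ‖u y₁‖ + K / (-θ - μ.re)) * Real.exp (-θ * t) := by
  have hK : 0 ≤ K := by
    have := (norm_nonneg _).trans (hf t ht)
    exact nonneg_of_mul_nonneg_left this (Real.exp_pos _)
  have hr : 0 < -θ - μ.re := by linarith
  have h1 := norm_exp_mul_sub_le (K := K) (δ := -θ) ht hμ.ne' (fun s hs => hu s hs.1)
      (fun s hs => hf s hs.1)
  have h2 : ‖Complex.exp (-μ * t) * u t‖ ≤ ‖Complex.exp (-μ * y₁) * u y₁‖
      + K * Real.exp ((-θ - μ.re) * t) / (-θ - μ.re) := by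
    have := norm_le_norm_add_norm_sub' (Complex.exp (-μ * t) * u t) (Complex.exp (-μ * y₁) * u y₁)
    refine this.trans (by
      gcongr
      refine h1.trans ?_
      have : 0 < Real.exp ((-θ - μ.re) * y₁) := Real.exp_pos _
      gcongr
      linarith)
  rw [norm_mul, norm_mul, norm_exp_neg_mul, norm_exp_neg_mul] at h2
  have h4 : Real.exp ((-θ - μ.re) * t) = Real.exp (-(μ.re * t)) * Real.exp (-θ * t) := by
    rw [← Real.exp_add]
    ring_nf
  have h5 : Real.exp (-(μ.re * y₁)) ≤
      Real.exp (-(μ.re * t)) * (Real.exp (θ * y₁) * Real.exp (-θ * t)) := by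
    rw [← Real.exp_add, ← Real.exp_add]
    apply Real.exp_le_exp.2
    nlinarith
  rw [h4] at h2
  refine le_of_mul_le_mul_left (h2.trans ?_) (Real.exp_pos (-(μ.re * t)))
  calc _ ≤ Real.exp (-(μ.re * t)) * (Real.exp (θ * y₁) * Real.exp (-θ * t)) * ‖u y₁‖
        + K * (Real.exp (-(μ.re * t)) * Real.exp (-θ * t)) / (-θ - μ.re) := by gcongr
    _ = _ := by ring

/-- A solution of `u' = μ u + f` behaves like a solution of the homogeneous equation when `f`
decays faster than these solutions. -/
theorem exists_norm_sub_exp_le {u f : ℝ → ℂ} {μ : ℂ} {K θ y₁ : ℝ} (hμ : -θ < μ.re)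
    (hu : ∀ t, y₁ ≤ t → HasDerivAt u (μ * u t + f t) t)
    (hf : ∀ t, y₁ ≤ t → ‖f t‖ ≤ K * Real.exp (-θ * t)) :
    ∃ c : ℂ, ∀ t, y₁ ≤ t →
      ‖u t - c * Complex.exp (μ * t)‖ ≤ K / (θ + μ.re) * Real.exp (-θ * t) := by
  have hK : 0 ≤ K := by
    have := (norm_nonneg _).trans (hf y₁ le_rfl)
    exact nonneg_of_mul_nonneg_left this (Real.exp_pos _)
  have hr : 0 < θ + μ.re := by linarith
  set w : ℝ → ℂ := fun T => Complex.exp (-μ * T) * u T with hw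
  have h1 : ∀ t T, y₁ ≤ t → t ≤ T →
      ‖w T - w t‖ ≤ K / (θ + μ.re) * Real.exp (-((θ + μ.re) * t)) := by
    intro t T ht hT
    refine (norm_exp_mul_sub_le (K := K) (δ := -θ) hT hμ.ne (fun s hs => hu s (ht.trans hs.1))
      (fun s hs => hf s (ht.trans hs.1))).trans ?_
    rw [← neg_div_neg_eq, ← mul_neg, neg_sub, neg_sub, sub_neg_eq_add, div_mul_eq_mul_div]
    have : 0 < Real.exp ((-θ - μ.re) * T) := Real.exp_pos _
    have h : Real.exp ((-θ - μ.re) * t) = Real.exp (-((θ + μ.re) * t)) := by ring_nf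
    rw [h, add_comm μ.re θ]
    gcongr
    linarith
  have hlim : Tendsto (fun t : ℝ => K / (θ + μ.re) * Real.exp (-((θ + μ.re) * t))) atTop (𝓝 0) := by
    have : Tendsto (fun t : ℝ => (θ + μ.re) * t) atTop atTop := tendsto_id.const_mul_atTop hr
    simpa using (Real.tendsto_exp_neg_atTop_nhds_zero.comp this).const_mul (K / (θ + μ.re))
  have hc : CauchySeq w := by
    rw [Metric.cauchySeq_iff']
    intro ε hε
    obtain ⟨N, hN⟩ := ((hlim.eventually (gt_mem_nhds hε)).and (eventually_ge_atTop y₁)).exists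
    exact ⟨N, fun n hn => by
      rw [dist_eq_norm]
      exact (h1 N n hN.2 hn).trans_lt hN.1⟩
  obtain ⟨c, hc⟩ := cauchySeq_tendsto_of_complete hc
  refine ⟨c, fun t ht => ?_⟩
  have h2 := le_of_tendsto (hc.sub_const (w t)).norm
    ((eventually_ge_atTop t).mono fun T hT => h1 t T ht hT)
  have h3 : u t - c * Complex.exp (μ * t) = -(Complex.exp (μ * t) * (c - w t)) := by
    have : Complex.exp (μ * t) * Complex.exp (-μ * t) = 1 := by
      rw [← Complex.exp_add]
      simp
    simp only [hw]
    linear_combination (-u t) * this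
  rw [h3, norm_neg, norm_mul]
  have h4 : ‖Complex.exp (μ * t)‖ = Real.exp (μ.re * t) := by
    rw [Complex.norm_exp]
    simp
  have h5 : Real.exp (-θ * t) = Real.exp (μ.re * t) * Real.exp (-((θ + μ.re) * t)) := by
    rw [← Real.exp_add]
    ring_nf
  rw [h4, h5]
  calc _ ≤ Real.exp (μ.re * t) * (K / (θ + μ.re) * Real.exp (-((θ + μ.re) * t))) := by gcongr
    _ = _ := by ring

/-- Backward estimate for the equation `u' = μ u + f` with `Re μ > δ`. -/
theorem norm_le_of_lt_re {u f : ℝ → ℂ} {μ : ℂ} {K δ y₁ : ℝ} (hμ : δ < μ.re)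
    (hu : ∀ t, t ≤ y₁ → HasDerivAt u (μ * u t + f t) t)
    (hf : ∀ t, t ≤ y₁ → ‖f t‖ ≤ K * Real.exp (δ * t)) (t : ℝ) (ht : t ≤ y₁) :
    ‖u t‖ ≤ (Real.exp (-δ * y₁) * ‖u y₁‖ + K / (μ.re - δ)) * Real.exp (δ * t) := by
  have h := norm_le_of_re_lt (u := fun t => u (-t)) (f := fun t => -f (-t)) (μ := -μ) (K := K)
    (θ := δ) (y₁ := -y₁) (by simpa using hμ)
    (fun t ht => by
      have := (hu (-t) (by linarith)).scomp t (hasDerivAt_neg t)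
      refine HasDerivAt.congr_deriv this ?_
      simp)
    (fun t ht => by
      rw [norm_neg]
      exact (hf (-t) (by linarith)).trans_eq (by ring_nf))
    (-t) (by linarith)
  simp only [neg_neg, Complex.neg_re, mul_neg] at h
  refine h.trans_eq ?_
  ring_nf

/-! ### Bounded solutions on the line -/

/-- The increments of a function with `‖P'‖ ≤ C e^{-A}`, where `A' ≥ θ`. -/
theorem norm_sub_le_of_deriv_le_exp {P G : ℝ → ℂ} {A a : ℝ → ℝ} {θ C : ℝ} (hθ : 0 < θ)
    (ha : ∀ t, θ ≤ a t) (hA : ∀ t, HasDerivAt A (a t) t) (hP : ∀ t, HasDerivAt P (G t) t)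
    (hG : ∀ t, ‖G t‖ ≤ C * Real.exp (-A t)) {t T : ℝ} (hT : t ≤ T) :
    ‖P T - P t‖ ≤ C / θ * Real.exp (-A t) := by
  have hC : 0 ≤ C := nonneg_of_mul_nonneg_left ((norm_nonneg _).trans (hG t)) (Real.exp_pos _)
  have hB : ∀ τ, HasDerivAt (fun τ => C / θ * (Real.exp (-A t) - Real.exp (-A τ)))
      (C / θ * (Real.exp (-A τ) * a τ)) τ := by
    intro τ
    have := (((hA τ).neg.exp).const_sub (Real.exp (-A t))).const_mul (C / θ)
    refine this.congr_deriv ?_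
    simp only [Pi.neg_apply]
    ring
  have := image_norm_le_of_norm_deriv_right_le_deriv_boundary (a := t) (b := T)
    (f := fun τ => P τ - P t)
    (fun τ _ => ((hP τ).sub_const (P t)).continuousAt.continuousWithinAt)
    (fun τ _ => ((hP τ).sub_const (P t)).hasDerivWithinAt)
    (by simp) hB
    (fun τ _ => by
      refine (hG τ).trans ?_
      have h1 : 1 ≤ a τ / θ := (one_le_div hθ).2 (ha τ)
      calc C * Real.exp (-A τ) = C * Real.exp (-A τ) * 1 := by ring
        _ ≤ C * Real.exp (-A τ) * (a τ / θ) := by gcongr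
        _ = _ := by ring)
    (Set.right_mem_Icc.2 hT)
  refine this.trans ?_
  have : 0 < Real.exp (-A T) := Real.exp_pos _
  gcongr
  linarith

/-- A bounded solution of an unstable equation `u' = a u + F`, where `a ≥ θ > 0`, is bounded by its
source. In particular it is unique. -/
theorem norm_le_of_bounded_solution {u F : ℝ → ℂ} {a : ℝ → ℝ} {θ C D : ℝ} (hθ : 0 < θ)
    (hac : Continuous a) (ha : ∀ t, θ ≤ a t)
    (hu : ∀ t, HasDerivAt u (a t * u t + F t) t) (hF : ∀ t, ‖F t‖ ≤ C) (hD : ∀ t, ‖u t‖ ≤ D)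
    (t : ℝ) : ‖u t‖ ≤ C / θ := by
  set A : ℝ → ℝ := fun T => ∫ τ in t..T, a τ with hAdef
  have hA : ∀ T, HasDerivAt A (a T) T := fun T => hac.integral_hasStrictDerivAt t T |>.hasDerivAt
  have hP : ∀ T, HasDerivAt (fun T => ((Real.exp (-A T) : ℝ) : ℂ) * u T)
      (((Real.exp (-A T) : ℝ) : ℂ) * F T) T := by
    intro T
    have := ((hA T).neg.exp).ofReal_comp.mul (hu T)
    refine this.congr_deriv ?_
    simp only [Pi.neg_apply]
    push_cast
    ring
  have hnorm : ∀ T, ‖((Real.exp (-A T) : ℝ) : ℂ)‖ = Real.exp (-A T) := fun T => by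
    rw [Complex.norm_real, Real.norm_of_nonneg (Real.exp_pos _).le]
  have h1 : ∀ T, t ≤ T → _ := fun T hT => norm_sub_le_of_deriv_le_exp (C := C) hθ ha hA hP
    (fun T => by
      rw [norm_mul, hnorm, mul_comm]
      gcongr
      exact hF T) hT
  have hAt : A t = 0 := by simp [hAdef]
  have hAge : ∀ T, t ≤ T → θ * (T - t) ≤ A T := by
    intro T hT
    have := intervalIntegral.integral_mono_on (μ := MeasureTheory.volume) hT
      intervalIntegrable_const (hac.intervalIntegrable t T) (fun x _ => ha x) (f := fun _ => θ)
    simpa [mul_comm] using this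
  have h2 : Tendsto (fun T => ((Real.exp (-A T) : ℝ) : ℂ) * u T) atTop (𝓝 0) := by
    have h3 : Tendsto (fun T => Real.exp (-(θ * (T - t))) * D) atTop (𝓝 0) := by
      have : Tendsto (fun T : ℝ => θ * (T - t)) atTop atTop :=
        (tendsto_atTop_add_const_right _ (-t) tendsto_id).const_mul_atTop hθ
      simpa using (Real.tendsto_exp_neg_atTop_nhds_zero.comp this).mul_const D
    refine squeeze_zero_norm' ?_ h3
    filter_upwards [eventually_ge_atTop t] with T hT
    rw [norm_mul, hnorm]
    have := hAge T hT
    have := hD T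
    gcongr
  have h4 := le_of_tendsto (h2.sub_const (((Real.exp (-A t) : ℝ) : ℂ) * u t)).norm
    ((eventually_ge_atTop t).mono h1)
  simpa [hAt] using h4

/-- The bounded solution is `u t = -∫_t^∞ e^{-∫_t^τ a} F τ dτ`. -/
theorem exists_bounded_solution {a : ℝ → ℝ} {θ : ℝ} (hθ : 0 < θ)
    (hac : Continuous a) (ha : ∀ t, θ ≤ a t) (F : ℝ →ᵇ ℂ) :
    ∃ u : ℝ →ᵇ ℂ, ∀ t, HasDerivAt u (a t * u t + F t) t := by
  set A : ℝ → ℝ := fun T => ∫ τ in (0 : ℝ)..T, a τ with hAdef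
  have hA : ∀ T, HasDerivAt A (a T) T := fun T => hac.integral_hasStrictDerivAt 0 T |>.hasDerivAt
  have hAc : Continuous A := continuous_iff_continuousAt.2 fun T => (hA T).continuousAt
  set G : ℝ → ℂ := fun T => ((Real.exp (-A T) : ℝ) : ℂ) * F T with hGdef
  have hGc : Continuous G :=
    (Complex.continuous_ofReal.comp (Real.continuous_exp.comp hAc.neg)).mul F.continuous
  set P : ℝ → ℂ := fun T => ∫ τ in (0 : ℝ)..T, G τ with hPdef
  have hP : ∀ T, HasDerivAt P (G T) T := fun T => hGc.integral_hasStrictDerivAt 0 T |>.hasDerivAt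
  have hnorm : ∀ T, ‖((Real.exp (-A T) : ℝ) : ℂ)‖ = Real.exp (-A T) := fun T => by
    rw [Complex.norm_real, Real.norm_of_nonneg (Real.exp_pos _).le]
  have hAge : ∀ T, 0 ≤ T → θ * T ≤ A T := by
    intro T hT
    have := intervalIntegral.integral_mono_on (μ := MeasureTheory.volume) hT
      intervalIntegrable_const (hac.intervalIntegrable 0 T) (fun x _ => ha x) (f := fun _ => θ)
    simpa [mul_comm] using this
  have h1 : ∀ t T, t ≤ T → ‖P T - P t‖ ≤ ‖F‖ / θ * Real.exp (-A t) := fun t T hT =>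
    norm_sub_le_of_deriv_le_exp hθ ha hA hP (fun T => by
      rw [norm_mul, hnorm, mul_comm]
      gcongr
      exact F.norm_coe_le_norm T) hT
  have hlim : Tendsto (fun t => ‖F‖ / θ * Real.exp (-A t)) atTop (𝓝 0) := by
    have : Tendsto A atTop atTop := tendsto_atTop_mono' _
      ((eventually_ge_atTop 0).mono hAge) (tendsto_id.const_mul_atTop hθ)
    simpa using (Real.tendsto_exp_neg_atTop_nhds_zero.comp this).const_mul (‖F‖ / θ)
  have hc : CauchySeq P := by
    rw [Metric.cauchySeq_iff']
    intro ε hε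
    obtain ⟨N, hN⟩ := (hlim.eventually (gt_mem_nhds hε)).exists
    exact ⟨N, fun n hn => by
      rw [dist_eq_norm]
      exact (h1 N n hn).trans_lt hN⟩
  obtain ⟨I, hI⟩ := cauchySeq_tendsto_of_complete hc
  have h2 : ∀ t, ‖I - P t‖ ≤ ‖F‖ / θ * Real.exp (-A t) := fun t =>
    le_of_tendsto (hI.sub_const (P t)).norm ((eventually_ge_atTop t).mono fun T hT => h1 t T hT)
  have hu : ∀ t, HasDerivAt (fun t => ((Real.exp (A t) : ℝ) : ℂ) * (P t - I))
      (a t * (((Real.exp (A t) : ℝ) : ℂ) * (P t - I)) + F t) t := by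
    intro t
    have := ((hA t).exp).ofReal_comp.mul ((hP t).sub_const I)
    refine this.congr_deriv ?_
    have h : ((Real.exp (A t) : ℝ) : ℂ) * ((Real.exp (-A t) : ℝ) : ℂ) = 1 := by
      rw [← Complex.ofReal_mul, ← Real.exp_add]
      simp
    simp only [hGdef]
    push_cast at h ⊢
    linear_combination (F t) * h
  refine ⟨BoundedContinuousFunction.ofNormedAddCommGroup _
    (continuous_iff_continuousAt.2 fun t => (hu t).continuousAt) (‖F‖ / θ) fun t => ?_, hu⟩
  rw [norm_mul, ← norm_neg (P t - I), neg_sub, Complex.norm_real,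
    Real.norm_of_nonneg (Real.exp_pos _).le]
  calc _ ≤ Real.exp (A t) * (‖F‖ / θ * Real.exp (-A t)) := by
        gcongr
        exact h2 t
    _ = (Real.exp (A t) * Real.exp (-A t)) * (‖F‖ / θ) := by ring
    _ = _ := by
        rw [← Real.exp_add]
        simp

/-- The bounded solution of `u' = a u + F` on the line depends linearly and continuously on the
bounded function `F`, when `a` is bounded below by a positive constant. -/
theorem exists_unstable_solution_operator {a : ℝ → ℝ} {θ : ℝ} (hθ : 0 < θ)
    (hac : Continuous a) (ha : ∀ t, θ ≤ a t) :
    ∃ V : (ℝ →ᵇ ℂ) →L[ℂ] (ℝ →ᵇ ℂ), ∀ F t, HasDerivAt (V F) (a t * V F t + F t) t := by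
  choose S hS using exists_bounded_solution hθ hac ha
  have huniq : ∀ (F u : ℝ →ᵇ ℂ), (∀ t, HasDerivAt u (a t * u t + F t) t) → u = S F := by
    intro F u hu
    ext t
    have := norm_le_of_bounded_solution (u := fun t => u t - S F t) (F := fun _ => 0) (C := 0) hθ
      hac ha (fun t => ((hu t).sub (hS F t)).congr_deriv (by ring)) (by simp)
      (fun t => (u - S F).norm_coe_le_norm t) t
    simpa [sub_eq_zero] using this
  let L : (ℝ →ᵇ ℂ) →ₗ[ℂ] (ℝ →ᵇ ℂ) :=
    { toFun := S
      map_add' := fun F G => (huniq _ (S F + S G) fun t =>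
        ((hS F t).add (hS G t)).congr_deriv (by simp; ring)).symm
      map_smul' := fun c F => (huniq _ (c • S F) fun t =>
        ((hS F t).const_smul c).congr_deriv (by simp; ring)).symm }
  refine ⟨L.mkContinuous (1 / θ) fun F => ?_, fun F t => hS F t⟩
  rw [BoundedContinuousFunction.norm_le (by positivity)]
  intro t
  have := norm_le_of_bounded_solution hθ hac ha (hS F) (fun t => F.norm_coe_le_norm t)
    (fun t => (S F).norm_coe_le_norm t) t
  refine this.trans_eq ?_
  ring

/-- The analogue of `exists_unstable_solution_operator` for a coefficient bounded above by a
negative constant, obtained from it by reversing the line. -/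
theorem exists_stable_solution_operator {a : ℝ → ℝ} {θ : ℝ} (hθ : 0 < θ)
    (hac : Continuous a) (ha : ∀ t, a t ≤ -θ) :
    ∃ V : (ℝ →ᵇ ℂ) →L[ℂ] (ℝ →ᵇ ℂ), ∀ F t, HasDerivAt (V F) (a t * V F t + F t) t := by
  obtain ⟨V, hV⟩ := exists_unstable_solution_operator (a := fun t => -a (-t)) hθ
    (hac.comp continuous_neg).neg (fun t => by linarith [ha (-t)])
  let ρ : C(ℝ, ℝ) := ⟨fun t => -t, continuous_neg⟩
  let Q : (ℝ →ᵇ ℂ) →L[ℂ] (ℝ →ᵇ ℂ) := LinearMap.mkContinuous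
    { toFun := fun F => F.compContinuous ρ
      map_add' := fun F G => rfl
      map_smul' := fun c F => rfl } 1 fun F => by
        rw [BoundedContinuousFunction.norm_le (by positivity)]
        intro t
        rw [one_mul]
        exact F.norm_coe_le_norm (-t)
  refine ⟨-(Q.comp (V.comp Q)), fun F t => ?_⟩
  have := ((hV (Q F) (-t)).scomp t (hasDerivAt_neg t)).neg
  refine this.congr_deriv ?_
  have h1 : (-(Q.comp (V.comp Q))) F t = -(V (Q F) (-t)) := rfl
  have h2 : Q F (-t) = F t := by
    change F (- -t) = F t
    rw [neg_neg]
  rw [h1, h2]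
  simp
  ring

/-! ### Systems with bounded coefficients -/

/-- The operator `X ↦ V (K X)` on bounded functions with values in `ℂ⁵`, where `K` is a matrix of
bounded functions, and the `i`-th component of `V` is the operator `V i`. -/
noncomputable def kernelOp (V : Fin 5 → (ℝ →ᵇ ℂ) →L[ℂ] (ℝ →ᵇ ℂ)) (K : Fin 5 → Fin 5 → (ℝ →ᵇ ℂ)) :
    (Fin 5 → (ℝ →ᵇ ℂ)) →L[ℂ] (Fin 5 → (ℝ →ᵇ ℂ)) :=
  ContinuousLinearMap.pi fun i => (V i).comp
    (∑ j, (ContinuousLinearMap.mul ℂ (ℝ →ᵇ ℂ) (K i j)).comp (ContinuousLinearMap.proj j))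

theorem kernelOp_apply (V : Fin 5 → (ℝ →ᵇ ℂ) →L[ℂ] (ℝ →ᵇ ℂ)) (K : Fin 5 → Fin 5 → (ℝ →ᵇ ℂ))
    (X : Fin 5 → (ℝ →ᵇ ℂ)) (i : Fin 5) : kernelOp V K X i = V i (∑ j, K i j * X j) := by
  simp [kernelOp]

/-- If `K` has only one nonzero row, with a zero on the diagonal, then the kernel operator squares
to zero. -/
theorem kernelOp_mul_self (V : Fin 5 → (ℝ →ᵇ ℂ) →L[ℂ] (ℝ →ᵇ ℂ)) (K : Fin 5 → Fin 5 → (ℝ →ᵇ ℂ))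
    (k : Fin 5) (hK : ∀ i j, i ≠ k → K i j = 0) (hkk : K k k = 0) :
    kernelOp V K * kernelOp V K = 0 := by
  have h0 : ∀ X i, i ≠ k → kernelOp V K X i = 0 := fun X i hi => by
    simp [kernelOp_apply, hK i _ hi]
  ext1 X
  funext i
  by_cases hi : i = k
  · subst hi
    change kernelOp V K (kernelOp V K X) i = 0
    rw [kernelOp_apply]
    have : ∑ j, K i j * kernelOp V K X j = 0 := by
      apply Finset.sum_eq_zero
      intro j _
      by_cases hj : j = i
      · rw [hj, hkk, zero_mul]
      · rw [h0 X j hj, mul_zero]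
    rw [this, map_zero]
  · exact h0 _ i hi

/-- The fixed point of an affine map `X ↦ T X + J` gives a solution of a differential system. -/
theorem hasDerivAt_of_eq_kernelOp {V : Fin 5 → (ℝ →ᵇ ℂ) →L[ℂ] (ℝ →ᵇ ℂ)} {a : Fin 5 → ℝ → ℝ}
    (hV : ∀ i F t, HasDerivAt (V i F) (a i t * V i F t + F t) t)
    {K : Fin 5 → Fin 5 → (ℝ →ᵇ ℂ)} {f X : Fin 5 → (ℝ →ᵇ ℂ)}
    (hX : X = kernelOp V K X + fun i => V i (f i)) (i : Fin 5) (t : ℝ) :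
    HasDerivAt (X i) (a i t * X i t + (∑ j, K i j t * X j t + f i t)) t := by
  have h : X i = V i (∑ j, K i j * X j + f i) := by
    conv_lhs => rw [hX]
    rw [Pi.add_apply, kernelOp_apply, map_add]
  have := hV i (∑ j, K i j * X j + f i) t
  rw [← h] at this
  simpa using this

theorem kernelOp_add (V : Fin 5 → (ℝ →ᵇ ℂ) →L[ℂ] (ℝ →ᵇ ℂ)) (K L : Fin 5 → Fin 5 → (ℝ →ᵇ ℂ)) :
    kernelOp V (K + L) = kernelOp V K + kernelOp V L := by
  ext1 X
  funext i
  simp [kernelOp_apply, add_mul, Finset.sum_add_distrib]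

theorem kernelOp_smul (V : Fin 5 → (ℝ →ᵇ ℂ) →L[ℂ] (ℝ →ᵇ ℂ)) (c : ℂ)
    (K : Fin 5 → Fin 5 → (ℝ →ᵇ ℂ)) : kernelOp V (c • K) = c • kernelOp V K := by
  ext1 X
  funext i
  simp [kernelOp_apply, ← Finset.smul_sum]

theorem kernelOp_sum (V : Fin 5 → (ℝ →ᵇ ℂ) →L[ℂ] (ℝ →ᵇ ℂ)) {ι : Type*} (S : Finset ι) (c : ι → ℂ)
    (K : ι → Fin 5 → Fin 5 → (ℝ →ᵇ ℂ)) :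
    kernelOp V (∑ l ∈ S, c l • K l) = ∑ l ∈ S, c l • kernelOp V (K l) := by
  classical
  induction S using Finset.induction_on with
  | empty =>
    simp only [Finset.sum_empty]
    ext1 X
    funext i
    simp [kernelOp_apply]
  | insert l S hl ih => rw [Finset.sum_insert hl, Finset.sum_insert hl, kernelOp_add,
      kernelOp_smul, ih]

/-- The filter of the limit `α → 0⁺`, `γ → γ₀`. -/
noncomputable abbrev smallAlpha (γ₀ : ℂ) : Filter (ℝ × ℂ) := 𝓝[>] (0 : ℝ) ×ˢ 𝓝 γ₀

/-- Regular perturbation of an operator `T₀` with `T₀² = 0`: the fixed point problem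
`x = (T₀ + ∑ c_l T_l) x + J`, where the coefficients `c_l` depend on `(α, γ)` and vanish in the
limit `α → 0⁺`, is solvable for small `α`. Its solution is differentiable in `γ` and close to
`(1 + T₀) J`. -/
theorem exists_perturbed_fixedPoint {E : Type*} [NormedAddCommGroup E] [NormedSpace ℂ E]
    [CompleteSpace E] (T₀ : E →L[ℂ] E) (hsq : T₀ * T₀ = 0) {ι : Type*} [Fintype ι]
    (T' : ι → E →L[ℂ] E) (c : ι → ℝ → ℂ → ℂ)
    (hc : ∀ l γ₀, Tendsto (fun p : ℝ × ℂ => c l p.1 p.2) (smallAlpha γ₀) (𝓝 0))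
    (hcd : ∀ l γ₀, ∀ᶠ p in smallAlpha γ₀, DifferentiableAt ℂ (c l p.1) p.2)
    (J : ℝ → ℂ → E)
    (hJd : ∀ γ₀, ∀ᶠ p in smallAlpha γ₀, DifferentiableAt ℂ (J p.1) p.2)
    (hJb : ∀ γ₀, ∃ C, ∀ᶠ p in smallAlpha γ₀, ‖J p.1 p.2‖ ≤ C) :
    ∃ x : ℝ → ℂ → E,
      (∀ γ₀, ∀ᶠ p in smallAlpha γ₀, x p.1 p.2 =
        (T₀ + ∑ l, c l p.1 p.2 • T' l) (x p.1 p.2) + J p.1 p.2) ∧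
      (∀ γ₀, ∀ᶠ p in smallAlpha γ₀, DifferentiableAt ℂ (x p.1) p.2) ∧
      (∀ γ₀, Tendsto (fun p : ℝ × ℂ => x p.1 p.2 - (J p.1 p.2 + T₀ (J p.1 p.2)))
        (smallAlpha γ₀) (𝓝 0)) := by
  have h1' : (1 - T₀) * (1 + T₀) = 1 := by
    rw [mul_add, sub_mul, sub_mul, hsq]
    simp
  have h2' : (1 + T₀) * (1 - T₀) = 1 := by
    rw [mul_sub, add_mul, add_mul, hsq]
    simp
  let u : (E →L[ℂ] E)ˣ := ⟨1 - T₀, 1 + T₀, h1', h2'⟩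
  set T : ℝ → ℂ → (E →L[ℂ] E) := fun α γ => T₀ + ∑ l, c l α γ • T' l with hT
  have hTlim : ∀ γ₀, Tendsto (fun p : ℝ × ℂ => 1 - T p.1 p.2) (smallAlpha γ₀)
      (𝓝 (u : E →L[ℂ] E)) := by
    intro γ₀
    have h1 : Tendsto (fun p : ℝ × ℂ => ∑ l, c l p.1 p.2 • T' l) (smallAlpha γ₀)
        (𝓝 (∑ l : ι, (0 : ℂ) • T' l)) :=
      tendsto_finsetSum _ fun l _ => (hc l γ₀).smul_const _
    have h2 := (h1.const_add T₀).const_sub 1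
    simpa [u] using h2
  have hTd : ∀ γ₀, ∀ᶠ p in smallAlpha γ₀, DifferentiableAt ℂ (T p.1) p.2 := by
    intro γ₀
    filter_upwards [eventually_all.2 fun l => hcd l γ₀] with p hp
    exact (DifferentiableAt.fun_sum fun l _ => (hp l).smul_const _).const_add _
  have hunit : ∀ γ₀, ∀ᶠ p in smallAlpha γ₀, IsUnit (1 - T p.1 p.2) := fun γ₀ =>
    (hTlim γ₀).eventually (Units.nhds u)
  have hinv : ∀ γ₀, Tendsto (fun p : ℝ × ℂ => Ring.inverse (1 - T p.1 p.2)) (smallAlpha γ₀)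
      (𝓝 (1 + T₀)) := by
    intro γ₀
    have := (NormedRing.inverse_continuousAt u).tendsto.comp (hTlim γ₀)
    rw [Ring.inverse_unit] at this
    exact this
  refine ⟨fun α γ => Ring.inverse (1 - T α γ) (J α γ), ?_, ?_, ?_⟩
  · intro γ₀
    filter_upwards [hunit γ₀] with p hp
    have h1 : (1 - T p.1 p.2) (Ring.inverse (1 - T p.1 p.2) (J p.1 p.2)) = J p.1 p.2 := by
      change ((1 - T p.1 p.2) * Ring.inverse (1 - T p.1 p.2)) (J p.1 p.2) = _
      rw [Ring.mul_inverse_cancel _ hp]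
      rfl
    change _ = T p.1 p.2 _ + _
    rw [_root_.sub_apply, sub_eq_iff_eq_add'] at h1
    exact h1
  · intro γ₀
    filter_upwards [hunit γ₀, hTd γ₀, hJd γ₀] with p hp hd hJ
    have h1 : DifferentiableAt ℂ (fun γ => Ring.inverse (1 - T p.1 γ)) p.2 :=
      DifferentiableAt.comp p.2 (f := fun γ => 1 - T p.1 γ)
        (differentiableAt_inverse (𝕜 := ℂ) hp) (hd.const_sub 1)
    exact h1.clm_apply hJ
  · intro γ₀
    obtain ⟨C, hC⟩ := hJb γ₀
    have h1 : Tendsto (fun p : ℝ × ℂ => ‖Ring.inverse (1 - T p.1 p.2) - (1 + T₀)‖ * C)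
        (smallAlpha γ₀) (𝓝 0) := by
      have := ((hinv γ₀).sub_const (1 + T₀)).norm.mul_const C
      simpa using this
    refine squeeze_zero_norm' ?_ h1
    filter_upwards [hC] with p hp
    change ‖_ - (1 + T₀) (J p.1 p.2)‖ ≤ _
    rw [← _root_.sub_apply]
    exact (ContinuousLinearMap.le_opNorm _ _).trans (by gcongr)

/-- The fixed point problem of `exists_perturbed_fixedPoint` for kernel operators, where only the
row `k` of the unperturbed kernel does not vanish. -/
theorem exists_perturbed_solution (V : Fin 5 → (ℝ →ᵇ ℂ) →L[ℂ] (ℝ →ᵇ ℂ))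
    (K₀ : Fin 5 → Fin 5 → (ℝ →ᵇ ℂ)) (k : Fin 5) (hK : ∀ i j, i ≠ k → K₀ i j = 0)
    (hkk : K₀ k k = 0) {ι : Type*} [Fintype ι] (K : ι → Fin 5 → Fin 5 → (ℝ →ᵇ ℂ))
    (c : ι → ℝ → ℂ → ℂ)
    (hc : ∀ l γ₀, Tendsto (fun p : ℝ × ℂ => c l p.1 p.2) (smallAlpha γ₀) (𝓝 0))
    (hcd : ∀ l γ₀, ∀ᶠ p in smallAlpha γ₀, DifferentiableAt ℂ (c l p.1) p.2)
    (f : ℝ → ℂ → Fin 5 → (ℝ →ᵇ ℂ))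
    (hfd : ∀ γ₀, ∀ᶠ p in smallAlpha γ₀, DifferentiableAt ℂ (f p.1) p.2)
    (hfb : ∀ γ₀, ∃ C, ∀ᶠ p in smallAlpha γ₀, ‖f p.1 p.2‖ ≤ C)
    (hfk : ∀ i γ₀, i ≠ k → Tendsto (fun p : ℝ × ℂ => f p.1 p.2 i) (smallAlpha γ₀) (𝓝 0)) :
    ∃ X : ℝ → ℂ → Fin 5 → (ℝ →ᵇ ℂ),
      (∀ γ₀, ∀ᶠ p in smallAlpha γ₀, X p.1 p.2 =
        kernelOp V (K₀ + ∑ l, c l p.1 p.2 • K l) (X p.1 p.2) + fun i => V i (f p.1 p.2 i)) ∧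
      (∀ γ₀, ∀ᶠ p in smallAlpha γ₀, DifferentiableAt ℂ (X p.1) p.2) ∧
      (∀ i γ₀, i ≠ k → Tendsto (fun p : ℝ × ℂ => X p.1 p.2 i) (smallAlpha γ₀) (𝓝 0)) ∧
      (∀ γ₀, ∃ C, ∀ᶠ p in smallAlpha γ₀, ‖X p.1 p.2‖ ≤ C) ∧
      (∀ γ₀, Tendsto (fun p : ℝ × ℂ => f p.1 p.2 k) (smallAlpha γ₀) (𝓝 0) →
        Tendsto (fun p : ℝ × ℂ => X p.1 p.2) (smallAlpha γ₀) (𝓝 0)) := by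
  set T₀ := kernelOp V K₀ with hT₀
  let W : (Fin 5 → (ℝ →ᵇ ℂ)) →L[ℂ] (Fin 5 → (ℝ →ᵇ ℂ)) :=
    ContinuousLinearMap.pi fun i => (V i).comp (ContinuousLinearMap.proj i)
  have hW : ∀ F, W F = fun i => V i (F i) := fun F => rfl
  have hJb : ∀ γ₀, ∃ C, ∀ᶠ p in smallAlpha γ₀, ‖W (f p.1 p.2)‖ ≤ C := by
    intro γ₀
    obtain ⟨C, hC⟩ := hfb γ₀
    refine ⟨‖W‖ * C, hC.mono fun p hp => (W.le_opNorm _).trans ?_⟩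
    gcongr
  obtain ⟨X, hX, hd, hl⟩ := exists_perturbed_fixedPoint T₀ (kernelOp_mul_self V K₀ k hK hkk)
    (fun l => kernelOp V (K l)) c hc hcd (fun α γ => W (f α γ))
    (fun γ₀ => (hfd γ₀).mono fun p hp => (W.differentiableAt).comp p.2 hp) hJb
  refine ⟨X, fun γ₀ => ?_, hd, ?_, ?_, ?_⟩
  · filter_upwards [hX γ₀] with p hp
    rw [kernelOp_add, kernelOp_sum]
    exact hp
  · intro i γ₀ hi
    have h1 := ((continuous_apply i).tendsto _).comp (hl γ₀)
    have h2 := ((V i).continuous.tendsto 0).comp (hfk i γ₀ hi)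
    rw [map_zero] at h2
    have h3 := h1.add h2
    simp only [Pi.zero_apply, add_zero] at h3
    refine h3.congr fun p => ?_
    have h4 : T₀ (W (f p.1 p.2)) i = 0 := by
      rw [hT₀, kernelOp_apply]
      simp [hK i _ hi]
    rw [hW] at h4
    simp [h4, hW]
  · intro γ₀
    obtain ⟨C, hC⟩ := hJb γ₀
    have h2 := (hl γ₀).norm.eventually (gt_mem_nhds (show ‖(0 : Fin 5 → (ℝ →ᵇ ℂ))‖ < 1 by simp))
    refine ⟨1 + (C + ‖T₀‖ * C), ?_⟩
    filter_upwards [hC, h2] with p hp hp2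
    refine (norm_le_norm_sub_add _ (W (f p.1 p.2) + T₀ (W (f p.1 p.2)))).trans ?_
    refine add_le_add hp2.le ((norm_add_le _ _).trans (add_le_add hp ?_))
    exact (ContinuousLinearMap.le_opNorm _ _).trans (by gcongr)
  · intro γ₀ hf
    have h1 : Tendsto (fun p : ℝ × ℂ => f p.1 p.2) (smallAlpha γ₀) (𝓝 0) := by
      rw [tendsto_pi_nhds]
      intro i
      by_cases hi : i = k
      · subst hi
        exact hf
      · exact hfk i γ₀ hi
    have h2 := (W.continuous.tendsto 0).comp h1
    rw [map_zero] at h2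
    have h4 := (T₀.continuous.tendsto 0).comp h2
    rw [map_zero] at h4
    have h3 := (hl γ₀).add (h2.add h4)
    simp only [add_zero] at h3
    refine h3.congr fun p => ?_
    simp

/-! ### The thermal eigenvalues -/

theorem thermalRoot_sq (ν s α β : ℝ) (γ : ℂ) : thermalRoot ν s α β γ ^ 2 =
    ((s ^ (2 * ν) / 4 : ℝ) : ℂ) + α * γ * ((s ^ (ν + 1) : ℝ) : ℂ) + α ^ 2 * β ^ 2 := by
  unfold thermalRoot
  rw [one_div]
  exact Complex.cpow_nat_inv_pow _ two_ne_zero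

theorem thermalRoot_re_nonneg (ν s α β : ℝ) (γ : ℂ) : 0 ≤ (thermalRoot ν s α β γ).re := by
  unfold thermalRoot
  set z : ℂ := ((s ^ (2 * ν) / 4 : ℝ) : ℂ) + α * γ * ((s ^ (ν + 1) : ℝ) : ℂ) + α ^ 2 * β ^ 2
  by_cases hz : z = 0
  · simp [hz]
  rw [Complex.cpow_def_of_ne_zero hz, Complex.exp_re]
  apply mul_nonneg (Real.exp_pos _).le
  have : (Complex.log z * (1 / 2)).im = z.arg / 2 := by
    have h : (1 / 2 : ℂ) = ((1 / 2 : ℝ) : ℂ) := by push_cast; rfl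
    rw [h, mul_comm, Complex.im_ofReal_mul, Complex.log_im]
    ring
  rw [this]
  apply Real.cos_nonneg_of_neg_pi_div_two_le_of_le
  · linarith [Complex.neg_pi_lt_arg z]
  · linarith [Complex.arg_le_pi z]

theorem rpow_two_mul_eq_sq {s : ℝ} (hs : 0 < s) (ν : ℝ) : s ^ (2 * ν) = (s ^ ν) ^ 2 := by
  rw [mul_comm, Real.rpow_mul hs.le]
  norm_cast

/-- The characteristic equation of the thermal eigenvalues. -/
theorem lambdaMinus_sq {s : ℝ} (hs : 0 < s) (ν α β : ℝ) (γ : ℂ) :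
    lambdaMinus ν s α β γ ^ 2 = -((s ^ ν : ℝ) : ℂ) * lambdaMinus ν s α β γ
      + α * γ * (((s ^ ν : ℝ) : ℂ) * s) + α ^ 2 * β ^ 2 := by
  have h := thermalRoot_sq ν s α β γ
  rw [rpow_two_mul_eq_sq hs, Real.rpow_add_one hs.ne'] at h
  unfold lambdaMinus
  push_cast at h ⊢
  linear_combination h

theorem lambdaPlus_eq (ν s α β : ℝ) (γ : ℂ) :
    lambdaPlus ν s α β γ = -((s ^ ν : ℝ) : ℂ) - lambdaMinus ν s α β γ := by
  unfold lambdaPlus lambdaMinus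
  ring

theorem le_thermalRoot_re {ν s α β : ℝ} {γ : ℂ} (hs : 0 < s) (hα : 0 ≤ α) (hγ : 0 ≤ γ.re) :
    s ^ ν / 2 ≤ (thermalRoot ν s α β γ).re := by
  have h := congrArg Complex.re (thermalRoot_sq ν s α β γ)
  have h0 := thermalRoot_re_nonneg ν s α β γ
  rw [rpow_two_mul_eq_sq hs, sq] at h
  have h2 : ((((s ^ ν) ^ 2 / 4 : ℝ) : ℂ) + α * γ * ((s ^ (ν + 1) : ℝ) : ℂ) + α ^ 2 * β ^ 2).re
      = (s ^ ν) ^ 2 / 4 + α * γ.re * s ^ (ν + 1) + α ^ 2 * β ^ 2 := by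
    have : (((s ^ ν) ^ 2 / 4 : ℝ) : ℂ) + α * γ * ((s ^ (ν + 1) : ℝ) : ℂ) + α ^ 2 * β ^ 2
      = (((s ^ ν) ^ 2 / 4 + α ^ 2 * β ^ 2 : ℝ) : ℂ) + ((α * s ^ (ν + 1) : ℝ) : ℂ) * γ := by
      push_cast
      ring
    rw [this, Complex.add_re, Complex.ofReal_re, Complex.re_ofReal_mul]
    ring
  rw [h2, Complex.mul_re] at h
  have h3 : 0 ≤ α * γ.re * s ^ (ν + 1) := by positivity
  apply le_of_sq_le_sq _ h0
  nlinarith [sq_nonneg (α * β), sq_nonneg (thermalRoot ν s α β γ).im]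

theorem lt_thermalRoot_re {ν s α β : ℝ} {γ : ℂ} (hs : 0 < s) (hα : 0 < α) (hβ : 0 < β)
    (hγ : 0 ≤ γ.re) : s ^ ν / 2 < (thermalRoot ν s α β γ).re := by
  refine lt_of_le_of_ne (le_thermalRoot_re hs hα.le hγ) fun h => ?_
  have h1 := congrArg Complex.re (thermalRoot_sq ν s α β γ)
  rw [rpow_two_mul_eq_sq hs, sq] at h1
  have h2 : ((((s ^ ν) ^ 2 / 4 : ℝ) : ℂ) + α * γ * ((s ^ (ν + 1) : ℝ) : ℂ) + α ^ 2 * β ^ 2).re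
      = (s ^ ν) ^ 2 / 4 + α * γ.re * s ^ (ν + 1) + α ^ 2 * β ^ 2 := by
    have : (((s ^ ν) ^ 2 / 4 : ℝ) : ℂ) + α * γ * ((s ^ (ν + 1) : ℝ) : ℂ) + α ^ 2 * β ^ 2
      = (((s ^ ν) ^ 2 / 4 + α ^ 2 * β ^ 2 : ℝ) : ℂ) + ((α * s ^ (ν + 1) : ℝ) : ℂ) * γ := by
      push_cast
      ring
    rw [this, Complex.add_re, Complex.ofReal_re, Complex.re_ofReal_mul]
    ring
  rw [h2, Complex.mul_re, ← h] at h1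
  have h3 : 0 ≤ α * γ.re * s ^ (ν + 1) := by positivity
  have h4 : 0 < α ^ 2 * β ^ 2 := by positivity
  nlinarith [sq_nonneg (thermalRoot ν s α β γ).im]

theorem lambdaPlus_re_pos {ν s α β : ℝ} {γ : ℂ} (hs : 0 < s) (hα : 0 < α) (hβ : 0 < β)
    (hγ : 0 ≤ γ.re) : 0 < (lambdaPlus ν s α β γ).re := by
  have h := lt_thermalRoot_re (ν := ν) hs hα hβ hγ
  have : (lambdaPlus ν s α β γ).re = -(s ^ ν / 2) + (thermalRoot ν s α β γ).re := by
    unfold lambdaPlus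
    have : -((s ^ ν : ℝ) : ℂ) / 2 = ((-(s ^ ν / 2) : ℝ) : ℂ) := by
      push_cast
      ring
    rw [this, Complex.add_re, Complex.ofReal_re]
  linarith

theorem lambdaMinus_re_le {ν s α β : ℝ} {γ : ℂ} (hs : 0 < s) (hα : 0 ≤ α)
    (hγ : 0 ≤ γ.re) : (lambdaMinus ν s α β γ).re ≤ -s ^ ν := by
  have h := le_thermalRoot_re (ν := ν) (β := β) hs hα hγ
  have : (lambdaMinus ν s α β γ).re = -(s ^ ν / 2) - (thermalRoot ν s α β γ).re := by
    unfold lambdaMinus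
    have : -((s ^ ν : ℝ) : ℂ) / 2 = ((-(s ^ ν / 2) : ℝ) : ℂ) := by
      push_cast
      ring
    rw [this, Complex.sub_re, Complex.ofReal_re]
  linarith

theorem smallAlpha_le_nhds (γ₀ : ℂ) : smallAlpha γ₀ ≤ 𝓝 ((0 : ℝ), γ₀) := by
  rw [nhds_prod_eq]
  exact prod_mono_left _ nhdsWithin_le_nhds

theorem tendsto_alpha (γ₀ : ℂ) :
    Tendsto (fun p : ℝ × ℂ => (p.1 : ℂ)) (smallAlpha γ₀) (𝓝 0) := by
  have : ContinuousAt (fun p : ℝ × ℂ => (p.1 : ℂ)) (0, γ₀) := by fun_prop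
  simpa using this.tendsto.mono_left (smallAlpha_le_nhds γ₀)

theorem tendsto_gamma (γ₀ : ℂ) :
    Tendsto (fun p : ℝ × ℂ => p.2) (smallAlpha γ₀) (𝓝 γ₀) := tendsto_snd

theorem eventually_alpha_pos (γ₀ : ℂ) : ∀ᶠ p in smallAlpha γ₀, 0 < p.1 :=
  tendsto_fst.eventually self_mem_nhdsWithin

theorem eventually_alpha_lt (γ₀ : ℂ) {c : ℝ} (hc : 0 < c) : ∀ᶠ p in smallAlpha γ₀, p.1 < c :=
  tendsto_fst.eventually (nhdsWithin_le_nhds (gt_mem_nhds hc))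

theorem tendsto_thermalRadicand (ν s β : ℝ) (γ₀ : ℂ) :
    Tendsto (fun p : ℝ × ℂ => ((s ^ (2 * ν) / 4 : ℝ) : ℂ)
      + p.1 * p.2 * ((s ^ (ν + 1) : ℝ) : ℂ) + (p.1 : ℂ) ^ 2 * (β : ℂ) ^ 2) (smallAlpha γ₀)
      (𝓝 ((s ^ (2 * ν) / 4 : ℝ) : ℂ)) := by
  have := ((((tendsto_alpha γ₀).mul (tendsto_gamma γ₀)).mul_const
    ((s ^ (ν + 1) : ℝ) : ℂ)).const_add ((s ^ (2 * ν) / 4 : ℝ) : ℂ)).add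
    (((tendsto_alpha γ₀).pow 2).mul_const ((β : ℂ) ^ 2))
  simpa using this

theorem tendsto_lambdaMinus {s : ℝ} (hs : 0 < s) (ν β : ℝ) (γ₀ : ℂ) :
    Tendsto (fun p : ℝ × ℂ => lambdaMinus ν s p.1 β p.2) (smallAlpha γ₀)
      (𝓝 (-((s ^ ν : ℝ) : ℂ))) := by
  have hpos : 0 < s ^ (2 * ν) / 4 := by positivity
  have h1 : ContinuousAt (fun z : ℂ => z ^ (1 / 2 : ℂ)) ((s ^ (2 * ν) / 4 : ℝ) : ℂ) :=
    continuousAt_id.cpow continuousAt_const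
      (by simpa using Complex.ofReal_mem_slitPlane.2 hpos)
  have h2 := (h1.tendsto.comp (tendsto_thermalRadicand ν s β γ₀)).const_sub (-((s ^ ν : ℝ) : ℂ) / 2)
  have h3 : ((s ^ (2 * ν) / 4 : ℝ) : ℂ) ^ (1 / 2 : ℂ) = ((s ^ ν / 2 : ℝ) : ℂ) := by
    have h : (1 / 2 : ℂ) = ((1 / 2 : ℝ) : ℂ) := by push_cast; rfl
    rw [h, ← Complex.ofReal_cpow hpos.le, ← Real.sqrt_eq_rpow, rpow_two_mul_eq_sq hs]
    have h' : (s ^ ν) ^ 2 / 4 = (s ^ ν / 2) ^ 2 := by ring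
    rw [h', Real.sqrt_sq (by positivity)]
  rw [h3] at h2
  have h4 : -((s ^ ν : ℝ) : ℂ) / 2 - ((s ^ ν / 2 : ℝ) : ℂ) = -((s ^ ν : ℝ) : ℂ) := by
    push_cast
    ring
  rw [h4] at h2
  exact h2

theorem eventually_differentiableAt_lambdaMinus {s : ℝ} (hs : 0 < s) (ν β : ℝ) (γ₀ : ℂ) :
    ∀ᶠ p in smallAlpha γ₀, DifferentiableAt ℂ (fun γ => lambdaMinus ν s p.1 β γ) p.2 := by
  have hpos : 0 < s ^ (2 * ν) / 4 := by positivity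
  have h := (tendsto_thermalRadicand ν s β γ₀).eventually
    (Complex.isOpen_slitPlane.mem_nhds (Complex.ofReal_mem_slitPlane.2 hpos))
  filter_upwards [h] with p hp
  unfold lambdaMinus thermalRoot
  have hd : DifferentiableAt ℂ (fun γ : ℂ => ((s ^ (2 * ν) / 4 : ℝ) : ℂ)
      + p.1 * γ * ((s ^ (ν + 1) : ℝ) : ℂ) + (p.1 : ℂ) ^ 2 * (β : ℂ) ^ 2) p.2 := by fun_prop
  exact (hd.cpow (differentiableAt_const _) hp).const_sub _

/-! ### The coefficients of the system as functions of the profile -/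

/-- The coefficients of `1`, `α`, `αγ`, `α²` in the matrix `M₀`. Only the row of the thermal
unknown does not vanish for `α = 0`. -/
noncomputable def coefM (ν β : ℝ) (l : Fin 4) (s : ℝ) : Matrix (Fin 5) (Fin 5) ℝ :=
  match l with
  | 0 => !![0, 0, 0, 0, 0; 0, 0, 0, 0, 0; 0, 0, 0, 0, 0; 1 / s, 0, 0, s ^ ν, -1; 0, 0, 0, 0, 0]
  | 1 => !![0, 0, β * s, 0, 0; 0, 0, -β, s ^ ν * s ^ 2 / β, 0; 2 * β / s, β, 0, β * s ^ ν, 0;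
      0, 0, 0, 0, 0; 0, 0, β, 0, 0]
  | 2 => !![0, 0, 0, s ^ ν * s ^ 2, 0; 1, 0, 0, 0, 0; 0, 0, -s, 0, 0; 0, 0, 0, 0, 0; 0, 0, 0, 0, 0]
  | 3 => !![0, 0, 0, 0, 0; 0, 0, 0, 0, 0; 0, 0, 0, 0, 0; 0, 0, 0, 0, 0; 0, 0, 0, -β ^ 2, 0]

/-- The scalar factors of the matrices `coefM`, except the first one, which is `1`. -/
noncomputable def coefScalar (l : Fin 3) (α : ℝ) (γ : ℂ) : ℂ :=
  match l with
  | 0 => α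
  | 1 => α * γ
  | 2 => α ^ 2

theorem M0_apply_eq (ν s α β : ℝ) (γ : ℂ) (i j : Fin 5) :
    M0 ν s α β γ i j = (coefM ν β 0 s i j : ℂ)
      + ∑ l : Fin 3, coefScalar l α γ * (coefM ν β l.succ s i j : ℂ) := by
  have h0 : Fin.succ (0 : Fin 3) = 1 := rfl
  have h1 : Fin.succ (1 : Fin 3) = 2 := rfl
  have h2 : Fin.succ (2 : Fin 3) = 3 := rfl
  rw [Fin.sum_univ_three, h0, h1, h2]
  fin_cases i <;> fin_cases j <;> simp [M0, coefM, coefScalar] <;> ring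

theorem coefM_zero_apply (ν β s : ℝ) {i : Fin 5} (hi : i ≠ 3) (j : Fin 5) :
    coefM ν β 0 s i j = 0 := by
  fin_cases i <;> fin_cases j <;> simp [coefM] at hi ⊢

theorem coefM_zero_diag (ν β s : ℝ) : coefM ν β 0 s 3 3 = s ^ ν := by
  simp [coefM]

theorem contDiffOn_coefM (ν β : ℝ) (l : Fin 4) (i j : Fin 5) :
    ContDiffOn ℝ 1 (fun s => coefM ν β l s i j) (Set.Ioi 0) := by
  intro x hx
  have hx : x ≠ 0 := (ne_of_gt hx)
  apply ContDiffAt.contDiffWithinAt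
  have h1 : ContDiffAt ℝ 1 (fun s : ℝ => s ^ ν) x := Real.contDiffAt_rpow_const_of_ne hx
  have h2 : ContDiffAt ℝ 1 (fun s : ℝ => s⁻¹) x := contDiffAt_inv ℝ hx
  fin_cases l <;> fin_cases i <;> fin_cases j <;> simp [coefM, div_eq_mul_inv] <;> fun_prop

theorem exists_abs_sub_le_of_contDiffOn {g : ℝ → ℝ} (hg : ContDiffOn ℝ 1 g (Set.Ioi 0)) {a : ℝ}
    (ha : 0 < a) : ∃ C, 0 ≤ C ∧ ∀ x ∈ Set.Icc a 1, |g 1 - g x| ≤ C * (1 - x) := by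
  have hsub : Set.Icc a 1 ⊆ Set.Ioi 0 := fun x hx => lt_of_lt_of_le ha hx.1
  obtain ⟨C, hC⟩ := isCompact_Icc.exists_bound_of_continuousOn
    ((hg.continuousOn_deriv_of_isOpen isOpen_Ioi le_rfl).mono hsub)
  refine ⟨|C|, abs_nonneg C, fun x hx => ?_⟩
  have := (convex_Icc a 1).norm_image_sub_le_of_norm_deriv_le (f := g) (C := |C|) (x := x) (y := 1)
    (fun y hy => (hg.differentiableOn one_ne_zero).differentiableAt (isOpen_Ioi.mem_nhds (hsub hy)))
    (fun y hy => (hC y hy).trans (le_abs_self C)) hx ⟨hx.1.trans hx.2, le_rfl⟩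
  rwa [Real.norm_eq_abs, Real.norm_of_nonneg (by linarith [hx.2])] at this

namespace IsModelProfile

variable {ν y₀ ξ₀ θ : ℝ} {s : ℝ → ℝ}

theorem mem_Icc (h : IsModelProfile ν y₀ ξ₀ θ s) (y : ℝ) : s y ∈ Set.Icc ξ₀ 1 :=
  ⟨h.ge y, (h.lt_one y).le⟩

theorem pos (h : IsModelProfile ν y₀ ξ₀ θ s) (y : ℝ) : 0 < s y := h.xi_pos.trans_le (h.ge y)

theorem two_theta_le (h : IsModelProfile ν y₀ ξ₀ θ s) (y : ℝ) : 2 * θ ≤ s y ^ ν :=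
  h.theta_le.trans (Real.rpow_le_rpow h.xi_pos.le (h.ge y) (by linarith [h.one_lt_nu]))

theorem rpow_le_one (h : IsModelProfile ν y₀ ξ₀ θ s) (y : ℝ) : s y ^ ν ≤ 1 :=
  Real.rpow_le_one (h.pos y).le (h.lt_one y).le (by linarith [h.one_lt_nu])

theorem continuous_rpow (h : IsModelProfile ν y₀ ξ₀ θ s) : Continuous fun y => s y ^ ν :=
  h.continuous.rpow_const fun y => Or.inl (h.pos y).ne'

theorem exists_bcf_comp (h : IsModelProfile ν y₀ ξ₀ θ s) {g : ℝ → ℝ}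
    (hg : ContinuousOn g (Set.Ioi 0)) : ∃ F : ℝ →ᵇ ℂ, ∀ y, F y = (g (s y) : ℂ) := by
  have hc : Continuous fun y => g (s y) := hg.comp_continuous h.continuous h.pos
  obtain ⟨C, hC⟩ := (isCompact_Icc (a := ξ₀) (b := 1)).exists_bound_of_continuousOn
    (hg.mono fun x hx => lt_of_lt_of_le h.xi_pos hx.1)
  refine ⟨BoundedContinuousFunction.ofNormedAddCommGroup (fun y => (g (s y) : ℂ))
    (Complex.continuous_ofReal.comp hc) C fun y => ?_, fun y => rfl⟩
  rw [Complex.norm_real]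
  exact hC _ (h.mem_Icc y)

theorem one_sub_mul_exp_le (h : IsModelProfile ν y₀ ξ₀ θ s) {κ : ℝ} (h0 : 0 ≤ κ) (hκ : κ ≤ θ)
    (y : ℝ) : (1 - s y) * Real.exp (κ * y) ≤ Real.exp (θ * |y₀|) := by
  have h1 : κ * y₀ ≤ θ * |y₀| :=
    (mul_le_mul_of_nonneg_left (le_abs_self y₀) h0).trans
      (mul_le_mul_of_nonneg_right hκ (abs_nonneg _))
  rcases le_total y y₀ with hy | hy
  · have h2 : 1 - s y ≤ 1 := by linarith [h.pos y]
    calc _ ≤ 1 * Real.exp (κ * y) := by gcongr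
      _ ≤ _ := by
        rw [one_mul]
        apply Real.exp_le_exp.2
        nlinarith
  · calc _ ≤ Real.exp (2 * θ * (y₀ - y)) * Real.exp (κ * y) := by
          gcongr
          exact h.decay y
      _ ≤ _ := by
        rw [← Real.exp_add]
        apply Real.exp_le_exp.2
        have := h.theta_pos
        nlinarith

theorem exists_bcf_weighted (h : IsModelProfile ν y₀ ξ₀ θ s) {g : ℝ → ℝ}
    (hg : ContDiffOn ℝ 1 g (Set.Ioi 0)) : ∃ C, ∀ κ, ∃ F : ℝ →ᵇ ℂ, ‖F‖ ≤ C ∧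
      (0 ≤ κ → κ ≤ θ → ∀ y, F y = ((g 1 : ℂ) - g (s y)) * Real.exp (κ * y)) := by
  obtain ⟨C, hC0, hC⟩ := exists_abs_sub_le_of_contDiffOn hg h.xi_pos
  refine ⟨C * Real.exp (θ * |y₀|), fun κ => ?_⟩
  by_cases hκ : 0 ≤ κ ∧ κ ≤ θ
  · have hc : Continuous fun y => g (s y) := hg.continuousOn.comp_continuous h.continuous h.pos
    have hb : ∀ y, ‖((g 1 : ℂ) - g (s y)) * Real.exp (κ * y)‖ ≤ C * Real.exp (θ * |y₀|) := by
      intro y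
      rw [norm_mul, ← Complex.ofReal_sub, Complex.norm_real, Complex.norm_real, Real.norm_eq_abs,
        Real.norm_of_nonneg (Real.exp_pos _).le]
      calc _ ≤ C * (1 - s y) * Real.exp (κ * y) := by
            gcongr
            exact hC _ (h.mem_Icc y)
        _ = C * ((1 - s y) * Real.exp (κ * y)) := by ring
        _ ≤ _ := by
            gcongr
            exact h.one_sub_mul_exp_le hκ.1 hκ.2 y
    refine ⟨BoundedContinuousFunction.ofNormedAddCommGroup
      (fun y => ((g 1 : ℂ) - g (s y)) * Real.exp (κ * y)) ((continuous_const.sub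
        (Complex.continuous_ofReal.comp hc)).mul (by fun_prop)) _ hb, ?_, fun _ _ y => rfl⟩
    exact BoundedContinuousFunction.norm_ofNormedAddCommGroup_le _ (by positivity) hb
  · exact ⟨0, by simp; positivity, fun h1 h2 => absurd ⟨h1, h2⟩ hκ⟩

end IsModelProfile

theorem tendsto_coefScalar (l : Fin 3) (γ₀ : ℂ) :
    Tendsto (fun p : ℝ × ℂ => coefScalar l p.1 p.2) (smallAlpha γ₀) (𝓝 0) := by
  have h1 := tendsto_alpha γ₀
  have h2 := h1.mul (tendsto_gamma γ₀)
  have h3 := h1.pow 2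
  fin_cases l
  · simpa [coefScalar] using h1
  · simpa [coefScalar] using h2
  · simpa [coefScalar] using h3

theorem differentiable_coefScalar (l : Fin 3) (α : ℝ) : Differentiable ℂ (coefScalar l α) := by
  fin_cases l
  · exact differentiable_const _
  · exact differentiable_id.const_mul _
  · exact differentiable_const _

/-- Solutions with a prescribed exponential weight of the inhomogeneous normal mode equations, for
small `α`. The case `e = 0` corresponds to perturbations of slow modes, and the case `e = 1` to
perturbations of the fast (thermal) mode, where a factor with logarithmic derivative
`-s ^ ν + d` is taken out of the unknown. -/
theorem IsModelProfile.exists_weighted_solution {ν y₀ ξ₀ θ : ℝ} {s : ℝ → ℝ}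
    (hs : IsModelProfile ν y₀ ξ₀ θ s) (β : ℝ) {e : ℝ} (he : e = 0 ∨ e = 1) (d : ℝ → ℂ → ℂ)
    (hd : ∀ γ₀, Tendsto (fun p : ℝ × ℂ => d p.1 p.2) (smallAlpha γ₀) (𝓝 0))
    (hdd : ∀ γ₀, ∀ᶠ p in smallAlpha γ₀, DifferentiableAt ℂ (d p.1) p.2)
    (f : ℝ → ℂ → Fin 5 → (ℝ →ᵇ ℂ))
    (hfd : ∀ γ₀, ∀ᶠ p in smallAlpha γ₀, DifferentiableAt ℂ (f p.1) p.2)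
    (hfb : ∀ γ₀, ∃ C, ∀ᶠ p in smallAlpha γ₀, ‖f p.1 p.2‖ ≤ C)
    (hfk : ∀ i γ₀, i ≠ 3 → Tendsto (fun p : ℝ × ℂ => f p.1 p.2 i) (smallAlpha γ₀) (𝓝 0)) :
    ∃ X : ℝ → ℂ → Fin 5 → (ℝ →ᵇ ℂ),
      (∀ γ₀, ∀ᶠ p in smallAlpha γ₀, ∀ i t, HasDerivAt (X p.1 p.2 i)
        ((θ + e * ((s t ^ ν : ℝ) : ℂ) - d p.1 p.2) * X p.1 p.2 i t
          - ∑ j, M0 ν (s t) p.1 β p.2 i j * X p.1 p.2 j t + f p.1 p.2 i t) t) ∧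
      (∀ γ₀, ∀ᶠ p in smallAlpha γ₀, DifferentiableAt ℂ (X p.1) p.2) ∧
      (∀ i γ₀, i ≠ 3 → Tendsto (fun p : ℝ × ℂ => X p.1 p.2 i) (smallAlpha γ₀) (𝓝 0)) ∧
      (∀ γ₀, ∃ C, ∀ᶠ p in smallAlpha γ₀, ‖X p.1 p.2‖ ≤ C) ∧
      (∀ γ₀, Tendsto (fun p : ℝ × ℂ => f p.1 p.2 3) (smallAlpha γ₀) (𝓝 0) →
        Tendsto (fun p : ℝ × ℂ => X p.1 p.2) (smallAlpha γ₀) (𝓝 0)) := by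
  have hθ := hs.theta_pos
  have hcr := hs.continuous_rpow
  -- the diagonal coefficients
  set a : Fin 5 → ℝ → ℝ := fun i t => θ + e * s t ^ ν - (if i = 3 then s t ^ ν else 0) with ha
  have hac : ∀ i, Continuous (a i) := fun i => by
    by_cases hi : i = 3
    · simp only [ha, hi, if_true]
      fun_prop
    · simp only [ha, hi, if_false]
      fun_prop
  have hV : ∀ i, ∃ V : (ℝ →ᵇ ℂ) →L[ℂ] (ℝ →ᵇ ℂ), ∀ F t,
      HasDerivAt (V F) (a i t * V F t + F t) t := by
    intro i
    by_cases hi : i = 3 ∧ e = 0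
    · refine exists_stable_solution_operator hθ (hac i) fun t => ?_
      have := hs.two_theta_le t
      simp only [ha, hi.1, hi.2, if_true]
      linarith
    · refine exists_unstable_solution_operator hθ (hac i) fun t => ?_
      have h0 := hs.two_theta_le t
      by_cases h3 : i = 3
      · have he1 : e = 1 := he.resolve_left fun h => hi ⟨h3, h⟩
        simp only [ha, h3, he1, if_true]
        linarith
      · simp only [ha, h3, if_false]
        rcases he with rfl | rfl <;> linarith
  choose V hV using hV
  choose B hB using fun (l : Fin 4) (i j : Fin 5) =>
    hs.exists_bcf_comp (contDiffOn_coefM ν β l i j).continuousOn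
  let K₀ : Fin 5 → Fin 5 → (ℝ →ᵇ ℂ) := fun i j => if i = 3 ∧ j ≠ 3 then -B 0 3 j else 0
  let K : Option (Fin 3) → Fin 5 → Fin 5 → (ℝ →ᵇ ℂ) := fun l i j =>
    match l with
    | none => if i = j then -1 else 0
    | some l => -B l.succ i j
  let c : Option (Fin 3) → ℝ → ℂ → ℂ := fun l => match l with
    | none => d
    | some l => coefScalar l
  obtain ⟨X, hX, hXd, hXk, hXb, hX0⟩ := exists_perturbed_solution V K₀ 3
    (fun i j hi => by simp [K₀, hi]) (by simp [K₀]) K c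
    (fun l γ₀ => by
      rcases l with _ | l
      · exact hd γ₀
      · exact tendsto_coefScalar l γ₀)
    (fun l γ₀ => by
      rcases l with _ | l
      · exact hdd γ₀
      · exact .of_forall fun p => (differentiable_coefScalar l p.1) p.2)
    f hfd hfb hfk
  refine ⟨X, fun γ₀ => ?_, hXd, hXk, hXb, hX0⟩
  filter_upwards [hX γ₀] with p hp i t
  refine (hasDerivAt_of_eq_kernelOp (a := a) hV hp i t).congr_deriv ?_
  have hK : ∀ j, (K₀ + ∑ l, c l p.1 p.2 • K l) i j t = (if i = 3 ∧ j ≠ 3 then -B 0 3 j t else 0)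
      - (if i = j then d p.1 p.2 else 0) - ∑ l : Fin 3, coefScalar l p.1 p.2 * B l.succ i j t := by
    intro j
    rw [Fintype.sum_option]
    have h1 : (K₀ + (c none p.1 p.2 • K none + ∑ l, c (some l) p.1 p.2 • K (some l))) i j t
        = K₀ i j t + (c none p.1 p.2 * K none i j t
          + ∑ l, c (some l) p.1 p.2 * K (some l) i j t) := by
      simp [Finset.sum_apply]
    rw [h1]
    simp only [K₀, K, c]
    split_ifs <;> simp <;> ring
  have hsum : ∑ j, (if i = j then d p.1 p.2 else 0) * X p.1 p.2 j t = d p.1 p.2 * X p.1 p.2 i t := by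
    simp
  have hM : ∀ j, M0 ν (s t) p.1 β p.2 i j = -(if i = 3 ∧ j ≠ 3 then -B 0 3 j t else 0)
      + (if i = 3 ∧ j = 3 then ((s t ^ ν : ℝ) : ℂ) else 0)
      + ∑ l : Fin 3, coefScalar l p.1 p.2 * B l.succ i j t := by
    intro j
    rw [M0_apply_eq]
    simp only [hB]
    by_cases hi : i = 3
    · subst hi
      by_cases hj : j = 3
      · subst hj
        simp [coefM_zero_diag]
      · simp [hj]
    · simp [hi, coefM_zero_apply ν β (s t) hi j]
  have hsum2 : ∑ j, (if i = 3 ∧ j = 3 then ((s t ^ ν : ℝ) : ℂ) else 0) * X p.1 p.2 j t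
      = (if i = 3 then ((s t ^ ν : ℝ) : ℂ) else 0) * X p.1 p.2 i t := by
    by_cases hi : i = 3
    · subst hi
      simp
    · simp [hi]
  have hmain : ∑ j, (K₀ + ∑ l, c l p.1 p.2 • K l) i j t * X p.1 p.2 j t
      = -∑ j, M0 ν (s t) p.1 β p.2 i j * X p.1 p.2 j t
        - ∑ j, (if i = j then d p.1 p.2 else 0) * X p.1 p.2 j t
        + ∑ j, (if i = 3 ∧ j = 3 then ((s t ^ ν : ℝ) : ℂ) else 0) * X p.1 p.2 j t := by
    rw [← Finset.sum_neg_distrib, ← Finset.sum_sub_distrib, ← Finset.sum_add_distrib]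
    refine Finset.sum_congr rfl fun j _ => ?_
    rw [hK, hM]
    ring
  rw [hmain, hsum, hsum2]
  have haeq : (a i t : ℂ) = θ + e * ((s t ^ ν : ℝ) : ℂ)
      - (if i = 3 then ((s t ^ ν : ℝ) : ℂ) else 0) := by
    simp only [ha]
    split_ifs <;> push_cast <;> ring
  rw [haeq]
  ring

/-! ### Fast and slow modes -/

/-- `X` solves the scaled normal mode equations `dX/dy + M₀(s(y)) X = 0`. -/
def IsScaledMode (ν : ℝ) (s : ℝ → ℝ) (α β : ℝ) (γ : ℂ) (X : ℝ → Fin 5 → ℂ) : Prop :=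
  ∀ y i, HasDerivAt (fun t => X t i) (-∑ j, M0 ν (s y) α β γ i j * X y j) y

theorem M0_mul_EaMinus {s : ℝ} (hs : 0 < s) (ν α β : ℝ) (γ : ℂ) (i : Fin 5) :
    ∑ j, M0 ν s α β γ i j * EaMinus s β γ j = α * β * EaMinus s β γ i := by
  have hs' : (s : ℂ) ≠ 0 := by exact_mod_cast hs.ne'
  rw [Fin.sum_univ_five]
  fin_cases i <;> simp [M0, EaMinus] <;> field_simp <;> ring

theorem M0_mul_Fvec {s : ℝ} (hs : 0 < s) (ν α : ℝ) {β : ℝ} (hβ : 0 < β) {γ lam : ℂ}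
    (hlam : lam ^ 2 = -((s ^ ν : ℝ) : ℂ) * lam + α * γ * (((s ^ ν : ℝ) : ℂ) * s) + α ^ 2 * β ^ 2)
    (hne : lam - α * γ * s ≠ 0) (i : Fin 5) :
    ∑ j, M0 ν s α β γ i j * Fvec s α β γ lam j = -lam * Fvec s α β γ lam i := by
  have hs' : (s : ℂ) ≠ 0 := by exact_mod_cast hs.ne'
  have hβ' : (β : ℂ) ≠ 0 := by exact_mod_cast hβ.ne'
  rw [Fin.sum_univ_five]
  have hq : ((s ^ ν : ℝ) : ℂ) = (α ^ 2 * β ^ 2 - lam ^ 2) / (lam - α * γ * s) := by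
    rw [eq_div_iff hne]
    linear_combination hlam
  have hlam' : lam = (lam - α * γ * s) + α * γ * s := by ring
  generalize lam - α * γ * s = D at hq hne hlam'
  fin_cases i <;> simp [M0, Fvec, R0, T0, E0, hq] <;> subst hlam' <;>
    simp <;> field_simp <;> ring

theorem isBigO_one_of_tendsto {ι E : Type*} [NormedAddCommGroup E] {l : Filter ι} {f : ι → E}
    {x : E} (h : Tendsto f l (𝓝 x)) : f =O[l] (fun _ => (1 : ℝ)) := h.isBigO_one ℝ

theorem differentiable_EaMinus (s β : ℝ) (j : Fin 5) :
    Differentiable ℂ fun γ => EaMinus s β γ j := by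
  fin_cases j <;> simp [EaMinus]

/-- For small `α` the system has a solution asymptotic to `e^{-αβ y} E_{a,-}(1)` at `+∞`. -/
theorem IsModelProfile.exists_slow_mode {ν y₀ ξ₀ θ : ℝ} {s : ℝ → ℝ}
    (hs : IsModelProfile ν y₀ ξ₀ θ s) {β : ℝ} (hβ : 0 < β) :
    ∃ Y : ℝ → ℂ → Fin 5 → (ℝ →ᵇ ℂ),
      (∀ γ₀, ∀ᶠ p in smallAlpha γ₀, IsScaledMode ν s p.1 β p.2 fun y i =>
        (Real.exp (-(p.1 * β) * y) : ℂ) * EaMinus 1 β p.2 i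
          + (Real.exp (-θ * y) : ℂ) * Y p.1 p.2 i y) ∧
      (∀ γ₀, ∀ᶠ p in smallAlpha γ₀, DifferentiableAt ℂ (Y p.1) p.2) ∧
      (∀ i γ₀, i ≠ 3 → Tendsto (fun p : ℝ × ℂ => Y p.1 p.2 i) (smallAlpha γ₀) (𝓝 0)) ∧
      (∀ γ₀, ∃ C, ∀ᶠ p in smallAlpha γ₀, ‖Y p.1 p.2‖ ≤ C) := by
  choose C Q hQC hQ using fun (l : Fin 4) (i j : Fin 5) =>
    hs.exists_bcf_weighted (contDiffOn_coefM ν β l i j)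
  set f : ℝ → ℂ → Fin 5 → (ℝ →ᵇ ℂ) := fun α γ i =>
    ∑ j, EaMinus 1 β γ j • Q 0 i j (θ - α * β)
      + ∑ l : Fin 3, coefScalar l α γ • ∑ j, EaMinus 1 β γ j • Q l.succ i j (θ - α * β) with hf
  have hκ : ∀ γ₀, ∀ᶠ p in smallAlpha γ₀, 0 ≤ θ - p.1 * β ∧ θ - p.1 * β ≤ θ := by
    intro γ₀
    filter_upwards [eventually_alpha_pos γ₀, eventually_alpha_lt γ₀ (div_pos hs.theta_pos hβ)]
      with p h1 h2
    rw [lt_div_iff₀ hβ] at h2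
    have := mul_pos h1 hβ
    exact ⟨by linarith, by linarith⟩
  have hsumO : ∀ l i γ₀, (fun p : ℝ × ℂ => ∑ j, EaMinus 1 β p.2 j • Q l i j (θ - p.1 * β))
      =O[smallAlpha γ₀] (fun _ => (1 : ℝ)) := by
    intro l i γ₀
    refine IsBigO.fun_sum fun j _ => ?_
    have h1 := isBigO_one_of_tendsto
      (((differentiable_EaMinus 1 β j).continuous.tendsto γ₀).comp (tendsto_gamma γ₀))
    have h2 : (fun p : ℝ × ℂ => Q l i j (θ - p.1 * β)) =O[smallAlpha γ₀] (fun _ => (1 : ℝ)) :=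
      IsBigO.of_bound (C l i j) (.of_forall fun p => by simpa using hQC l i j _)
    simpa using h1.smul h2
  have hsum0 : ∀ i γ₀, Tendsto (fun p : ℝ × ℂ => ∑ l : Fin 3, coefScalar l p.1 p.2 •
      ∑ j, EaMinus 1 β p.2 j • Q l.succ i j (θ - p.1 * β)) (smallAlpha γ₀) (𝓝 0) := by
    intro i γ₀
    rw [← isLittleO_one_iff ℝ]
    refine IsLittleO.fun_sum fun l _ => ?_
    have h1 := (isLittleO_one_iff ℝ).2 (tendsto_coefScalar l γ₀)
    simpa using h1.smul_isBigO (hsumO l.succ i γ₀)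
  obtain ⟨Y, hY, hYd, hYk, hYb, -⟩ := hs.exists_weighted_solution β (e := 0) (Or.inl rfl)
    (fun _ _ => 0) (fun γ₀ => tendsto_const_nhds) (fun γ₀ => .of_forall fun p => by simp) f
    (fun γ₀ => .of_forall fun p => by
      rw [differentiableAt_pi]
      intro i
      refine DifferentiableAt.fun_add (DifferentiableAt.fun_sum fun j _ => ?_)
        (DifferentiableAt.fun_sum fun l _ => DifferentiableAt.fun_smul
          (differentiable_coefScalar l p.1 p.2) (DifferentiableAt.fun_sum fun j _ => ?_))
      · exact (differentiable_EaMinus 1 β j p.2).smul_const _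
      · exact (differentiable_EaMinus 1 β j p.2).smul_const _)
    (fun γ₀ => by
      have : (fun p : ℝ × ℂ => f p.1 p.2) =O[smallAlpha γ₀] (fun _ => (1 : ℝ)) :=
        isBigO_pi.2 fun i => (hsumO 0 i γ₀).add (isBigO_one_of_tendsto (hsum0 i γ₀))
      obtain ⟨C, hC⟩ := (isBigO_one_iff ℝ).1 this
      exact ⟨C, by simpa using hC⟩)
    (fun i γ₀ hi => by
      refine (hsum0 i γ₀).congr' ?_
      filter_upwards [hκ γ₀] with p hp
      have : ∀ j, Q 0 i j (θ - p.1 * β) = 0 := fun j => by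
        ext y
        rw [hQ 0 i j _ hp.1 hp.2, coefM_zero_apply _ _ _ hi, coefM_zero_apply _ _ _ hi]
        simp
      simp [hf, this])
  refine ⟨Y, fun γ₀ => ?_, hYd, hYk, hYb⟩
  filter_upwards [hY γ₀, hκ γ₀] with p hp hκp y i
  have h1 : HasDerivAt (fun t : ℝ => (Real.exp (-(p.1 * β) * t) : ℂ))
      ((Real.exp (-(p.1 * β) * y) * -(p.1 * β) : ℝ) : ℂ) y := by
    have := (((hasDerivAt_id y).const_mul (-(p.1 * β))).exp).ofReal_comp
    simpa using this
  have h2 : HasDerivAt (fun t : ℝ => (Real.exp (-θ * t) : ℂ))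
      ((Real.exp (-θ * y) * -θ : ℝ) : ℂ) y := by
    have := (((hasDerivAt_id y).const_mul (-θ)).exp).ofReal_comp
    simpa using this
  refine ((h1.mul_const (EaMinus 1 β p.2 i)).add (h2.mul (hp i y))).congr_deriv ?_
  have hfy : f p.1 p.2 i y = Real.exp ((θ - p.1 * β) * y) *
      ∑ j, (M0 ν 1 p.1 β p.2 i j - M0 ν (s y) p.1 β p.2 i j) * EaMinus 1 β p.2 j := by
    have h3 : f p.1 p.2 i y = ∑ j, EaMinus 1 β p.2 j * Q 0 i j (θ - p.1 * β) y
      + ∑ l : Fin 3, coefScalar l p.1 p.2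
        * ∑ j, EaMinus 1 β p.2 j * Q l.succ i j (θ - p.1 * β) y := by
      simp [hf]
    rw [h3]
    simp only [hQ _ _ _ _ hκp.1 hκp.2, M0_apply_eq, Finset.mul_sum]
    rw [Finset.sum_comm, ← Finset.sum_add_distrib]
    refine Finset.sum_congr rfl fun j _ => ?_
    simp only [Fin.sum_univ_three]
    ring
  have hE : (Real.exp (-θ * y) : ℂ) * Real.exp ((θ - p.1 * β) * y)
      = Real.exp (-(p.1 * β) * y) := by
    rw [← Complex.ofReal_mul, ← Real.exp_add]
    congr 2
    ring
  have h4 := M0_mul_EaMinus one_pos ν p.1 β p.2 i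
  push_cast at hE hfy ⊢
  rw [hfy]
  generalize Complex.exp ((θ - p.1 * β) * y) = e₁ at hE ⊢
  generalize Complex.exp (-(θ : ℂ) * y) = e₂ at hE ⊢
  generalize Complex.exp (-(p.1 * β : ℂ) * y) = e₃ at hE ⊢
  simp only [mul_add, sub_mul, Finset.sum_add_distrib, Finset.sum_sub_distrib, h4, mul_sub]
  have h5 : ∀ (c : ℂ) (g : Fin 5 → ℂ), ∑ j, M0 ν (s y) p.1 β p.2 i j * (c * g j)
      = c * ∑ j, M0 ν (s y) p.1 β p.2 i j * g j := by
    intro c g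
    rw [Finset.mul_sum]
    exact Finset.sum_congr rfl fun j _ => by ring
  rw [h5, h5]
  linear_combination (p.1 * β * EaMinus 1 β p.2 i
    - ∑ j, M0 ν (s y) p.1 β p.2 i j * EaMinus 1 β p.2 j) * hE

theorem Fvec_apply (s α β : ℝ) (γ lam : ℂ) (i : Fin 5) : Fvec s α β γ lam i =
    (![0, 0, 0, 1, 0] : Fin 5 → ℂ) i + (α : ℂ) * R0 s β γ i
      + ((α : ℂ) ^ 2 / (lam - α * γ * s)) * T0 s β γ i
      + ((α : ℂ) ^ 3 * (s : ℂ) ^ 2 / (lam - α * γ * s) ^ 2) * E0 s β γ i := rfl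

theorem tendsto_lambdaMinus_one (ν β : ℝ) (γ₀ : ℂ) :
    Tendsto (fun p : ℝ × ℂ => lambdaMinus ν 1 p.1 β p.2) (smallAlpha γ₀) (𝓝 (-1)) := by
  simpa using tendsto_lambdaMinus one_pos ν β γ₀

theorem tendsto_lambdaMinus_sub (ν β : ℝ) (γ₀ : ℂ) :
    Tendsto (fun p : ℝ × ℂ => lambdaMinus ν 1 p.1 β p.2 - p.1 * p.2 * ((1 : ℝ) : ℂ))
      (smallAlpha γ₀) (𝓝 (-1)) := by
  have := (tendsto_lambdaMinus_one ν β γ₀).sub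
    (((tendsto_alpha γ₀).mul (tendsto_gamma γ₀)).mul_const ((1 : ℝ) : ℂ))
  simpa using this

theorem eventually_lambdaMinus_sub_ne (ν β : ℝ) (γ₀ : ℂ) :
    ∀ᶠ p in smallAlpha γ₀, lambdaMinus ν 1 p.1 β p.2 - p.1 * p.2 * ((1 : ℝ) : ℂ) ≠ 0 :=
  (tendsto_lambdaMinus_sub ν β γ₀).eventually_ne (by simp)

/-- The thermal eigenvector for `λ₋(1)` tends to the unit vector of the thermal unknown. -/
theorem tendsto_Fvec_lambdaMinus (ν β : ℝ) (γ₀ : ℂ) (i : Fin 5) :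
    Tendsto (fun p : ℝ × ℂ => Fvec 1 p.1 β p.2 (lambdaMinus ν 1 p.1 β p.2) i) (smallAlpha γ₀)
      (𝓝 ((![0, 0, 0, 1, 0] : Fin 5 → ℂ) i)) := by
  have h1 := tendsto_alpha γ₀
  have h2 := tendsto_gamma γ₀
  have h3 := tendsto_lambdaMinus_sub ν β γ₀
  have hR : Tendsto (fun p : ℝ × ℂ => R0 1 β p.2 i) (smallAlpha γ₀) (𝓝 (R0 1 β γ₀ i)) := by
    have : Continuous fun γ => R0 1 β γ i := by
      fin_cases i <;> simp [R0] <;> fun_prop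
    exact (this.tendsto γ₀).comp h2
  have hT : Tendsto (fun p : ℝ × ℂ => T0 1 β p.2 i) (smallAlpha γ₀) (𝓝 (T0 1 β γ₀ i)) := by
    have : Continuous fun γ => T0 1 β γ i := by
      fin_cases i <;> simp [T0] <;> fun_prop
    exact (this.tendsto γ₀).comp h2
  have hE : Tendsto (fun p : ℝ × ℂ => E0 1 β p.2 i) (smallAlpha γ₀) (𝓝 (E0 1 β γ₀ i)) := by
    have : Continuous fun γ => E0 1 β γ i := by
      fin_cases i <;> simp [E0] <;> fun_prop
    exact (this.tendsto γ₀).comp h2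
  have := (((h1.mul hR).const_add ((![0, 0, 0, 1, 0] : Fin 5 → ℂ) i)).add
    (((h1.pow 2).div h3 (by simp)).mul hT)).add
    ((((h1.pow 3).mul_const (((1 : ℝ) : ℂ) ^ 2)).div (h3.pow 2) (by simp)).mul hE)
  simpa [Fvec_apply] using this

theorem eventually_differentiableAt_Fvec (ν β : ℝ) (γ₀ : ℂ) (i : Fin 5) :
    ∀ᶠ p in smallAlpha γ₀,
      DifferentiableAt ℂ (fun γ => Fvec 1 p.1 β γ (lambdaMinus ν 1 p.1 β γ) i) p.2 := by
  filter_upwards [eventually_differentiableAt_lambdaMinus one_pos ν β γ₀,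
    eventually_lambdaMinus_sub_ne ν β γ₀] with p hd hne
  have hR : Differentiable ℂ fun γ => R0 1 β γ i := by
    fin_cases i <;> simp [R0]
  have hT : Differentiable ℂ fun γ => T0 1 β γ i := by
    fin_cases i <;> simp [T0]
  have hE : Differentiable ℂ fun γ => E0 1 β γ i := by
    fin_cases i <;> simp [E0]; fun_prop
  have hR' := hR p.2
  have hT' := hT p.2
  have hE' := hE p.2
  have hD : DifferentiableAt ℂ
      (fun γ => lambdaMinus ν 1 p.1 β γ - p.1 * γ * ((1 : ℝ) : ℂ)) p.2 :=
    hd.sub ((differentiableAt_id.const_mul _).mul_const _)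
  have : DifferentiableAt ℂ (fun γ => (![0, 0, 0, 1, 0] : Fin 5 → ℂ) i + (p.1 : ℂ) * R0 1 β γ i
      + ((p.1 : ℂ) ^ 2 / (lambdaMinus ν 1 p.1 β γ - p.1 * γ * ((1 : ℝ) : ℂ))) * T0 1 β γ i
      + ((p.1 : ℂ) ^ 3 * ((1 : ℝ) : ℂ) ^ 2
        / (lambdaMinus ν 1 p.1 β γ - p.1 * γ * ((1 : ℝ) : ℂ)) ^ 2) * E0 1 β γ i) p.2 :=
    (((hR'.const_mul _).const_add _).add (((differentiableAt_const _).div hD hne).mul hT')).add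
      (((differentiableAt_const _).div (hD.pow 2) (pow_ne_zero 2 hne)).mul hE')
  simpa [Fvec_apply] using this

/-- The scalar factor of the fast mode: its logarithmic derivative is `1 + λ - s ^ ν`. -/
noncomputable def fastFactor (ν : ℝ) (s : ℝ → ℝ) (y₀ : ℝ) (lam : ℂ) (y : ℝ) : ℂ :=
  Complex.exp ((1 + lam) * (y - y₀) - (∫ t in y₀..y, s t ^ ν : ℝ))

theorem IsModelProfile.hasDerivAt_fastFactor {ν y₀ ξ₀ θ : ℝ} {s : ℝ → ℝ}
    (hs : IsModelProfile ν y₀ ξ₀ θ s) (lam : ℂ) (y : ℝ) :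
    HasDerivAt (fastFactor ν s y₀ lam)
      (fastFactor ν s y₀ lam y * (1 + lam - ((s y ^ ν : ℝ) : ℂ))) y := by
  have h1 := (hs.continuous_rpow.integral_hasStrictDerivAt y₀ y).hasDerivAt.ofReal_comp
  have h2 : HasDerivAt (fun y : ℝ => (1 + lam) * ((y : ℂ) - y₀)) (1 + lam) y := by
    simpa using (((hasDerivAt_id y).ofReal_comp).sub_const (y₀ : ℂ)).const_mul (1 + lam)
  exact (h2.sub h1).cexp

/-- For small `α` the system has a solution which is asymptotic to a multiple of
`e^{λ₋(1) y} F₋(1)` at `+∞`. -/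
theorem IsModelProfile.exists_fast_mode {ν y₀ ξ₀ θ : ℝ} {s : ℝ → ℝ}
    (hs : IsModelProfile ν y₀ ξ₀ θ s) {β : ℝ} (hβ : 0 < β) :
    ∃ Y : ℝ → ℂ → Fin 5 → (ℝ →ᵇ ℂ),
      (∀ γ₀, ∀ᶠ p in smallAlpha γ₀, IsScaledMode ν s p.1 β p.2 fun y i =>
        fastFactor ν s y₀ (lambdaMinus ν 1 p.1 β p.2) y *
          (Fvec 1 p.1 β p.2 (lambdaMinus ν 1 p.1 β p.2) i
            + (Real.exp (-θ * y) : ℂ) * Y p.1 p.2 i y)) ∧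
      (∀ γ₀, ∀ᶠ p in smallAlpha γ₀, DifferentiableAt ℂ (Y p.1) p.2) ∧
      (∀ γ₀, Tendsto (fun p : ℝ × ℂ => Y p.1 p.2) (smallAlpha γ₀) (𝓝 0)) := by
  choose C Q hQC hQ using fun (l : Fin 4) (i j : Fin 5) =>
    hs.exists_bcf_weighted (contDiffOn_coefM ν β l i j)
  have hpow : ContDiffOn ℝ 1 (fun x : ℝ => x ^ ν) (Set.Ioi 0) := fun x hx =>
    (Real.contDiffAt_rpow_const_of_ne (ne_of_gt hx)).contDiffWithinAt
  obtain ⟨C', hH⟩ := hs.exists_bcf_weighted hpow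
  obtain ⟨H, -, hH⟩ := hH θ
  replace hH := hH hs.theta_pos.le le_rfl
  replace hQ := fun l i j => hQ l i j θ hs.theta_pos.le le_rfl
  set F : ℝ → ℂ → Fin 5 → ℂ := fun α γ => Fvec 1 α β γ (lambdaMinus ν 1 α β γ) with hF
  have hF3 : ∀ α γ, F α γ 3 = 1 := fun α γ => by simp [hF, Fvec, R0, T0, E0]
  -- the slow components of the eigenvector
  set u : ℝ → ℂ → Fin 5 → ℂ := fun α γ j => if j = 3 then 0 else F α γ j with hu
  have hu0 : ∀ j γ₀, Tendsto (fun p : ℝ × ℂ => u p.1 p.2 j) (smallAlpha γ₀) (𝓝 0) := by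
    intro j γ₀
    have := tendsto_Fvec_lambdaMinus ν β γ₀ j
    fin_cases j <;> simp [hu, hF] at this ⊢ <;> exact this
  have hFd : ∀ j γ₀, ∀ᶠ p in smallAlpha γ₀, DifferentiableAt ℂ (fun γ => F p.1 γ j) p.2 :=
    fun j γ₀ => eventually_differentiableAt_Fvec ν β γ₀ j
  have hud : ∀ j γ₀, ∀ᶠ p in smallAlpha γ₀, DifferentiableAt ℂ (fun γ => u p.1 γ j) p.2 := by
    intro j γ₀
    by_cases hj : j = 3
    · simp [hu, hj]
    · simpa [hu, hj] using hFd j γ₀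
  set f : ℝ → ℂ → Fin 5 → (ℝ →ᵇ ℂ) := fun α γ i =>
    (∑ j, u α γ j • Q 0 i j θ - u α γ i • H)
      + ∑ l : Fin 3, coefScalar l α γ • ∑ j, F α γ j • Q l.succ i j θ with hf
  have hf0 : ∀ i γ₀, Tendsto (fun p : ℝ × ℂ => f p.1 p.2 i) (smallAlpha γ₀) (𝓝 0) := by
    intro i γ₀
    have h1 : Tendsto (fun p : ℝ × ℂ => ∑ j, u p.1 p.2 j • Q 0 i j θ) (smallAlpha γ₀)
        (𝓝 (∑ j, (0 : ℂ) • Q 0 i j θ)) :=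
      tendsto_finsetSum _ fun j _ => (hu0 j γ₀).smul_const _
    have h2 := (hu0 i γ₀).smul_const H
    have h3 : Tendsto (fun p : ℝ × ℂ => ∑ l : Fin 3, coefScalar l p.1 p.2 •
        ∑ j, F p.1 p.2 j • Q l.succ i j θ) (smallAlpha γ₀)
        (𝓝 (∑ l : Fin 3, (0 : ℂ) • ∑ j, (![0, 0, 0, 1, 0] : Fin 5 → ℂ) j • Q l.succ i j θ)) :=
      tendsto_finsetSum _ fun l _ => (tendsto_coefScalar l γ₀).smul
        (tendsto_finsetSum _ fun j _ => (tendsto_Fvec_lambdaMinus ν β γ₀ j).smul_const _)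
    simpa only [zero_smul, Finset.sum_const_zero, sub_zero, add_zero] using (h1.sub h2).add h3
  have hd0 : ∀ γ₀, Tendsto (fun p : ℝ × ℂ => 1 + lambdaMinus ν 1 p.1 β p.2) (smallAlpha γ₀)
      (𝓝 0) := fun γ₀ => by
    simpa using (tendsto_lambdaMinus_one ν β γ₀).const_add 1
  obtain ⟨Y, hY, hYd, -, -, hY0⟩ := hs.exists_weighted_solution β (e := 1) (Or.inr rfl)
    (fun α γ => 1 + lambdaMinus ν 1 α β γ) hd0
    (fun γ₀ => (eventually_differentiableAt_lambdaMinus one_pos ν β γ₀).mono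
      fun p hp => hp.const_add 1) f
    (fun γ₀ => by
      filter_upwards [eventually_all.2 fun j => hFd j γ₀, eventually_all.2 fun j => hud j γ₀]
        with p hp1 hp2
      rw [differentiableAt_pi]
      intro i
      refine DifferentiableAt.fun_add (DifferentiableAt.fun_sub
        (DifferentiableAt.fun_sum fun j _ => (hp2 j).smul_const _) ((hp2 i).smul_const _))
        (DifferentiableAt.fun_sum fun l _ => DifferentiableAt.fun_smul
          (differentiable_coefScalar l p.1 p.2) (DifferentiableAt.fun_sum fun j _ => ?_))
      exact (hp1 j).smul_const _)
    (fun γ₀ => by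
      have : (fun p : ℝ × ℂ => f p.1 p.2) =O[smallAlpha γ₀] (fun _ => (1 : ℝ)) :=
        isBigO_pi.2 fun i => isBigO_one_of_tendsto (hf0 i γ₀)
      obtain ⟨C, hC⟩ := (isBigO_one_iff ℝ).1 this
      exact ⟨C, by simpa using hC⟩)
    (fun i γ₀ _ => hf0 i γ₀)
  refine ⟨Y, fun γ₀ => ?_, hYd, fun γ₀ => hY0 γ₀ (hf0 3 γ₀)⟩
  filter_upwards [hY γ₀, eventually_lambdaMinus_sub_ne ν β γ₀] with p hp hne y i
  have h2 : HasDerivAt (fun t : ℝ => (Real.exp (-θ * t) : ℂ))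
      ((Real.exp (-θ * y) * -θ : ℝ) : ℂ) y := by
    have := (((hasDerivAt_id y).const_mul (-θ)).exp).ofReal_comp
    simpa using this
  refine ((hs.hasDerivAt_fastFactor (lambdaMinus ν 1 p.1 β p.2) y).fun_mul
    ((h2.fun_mul (hp i y)).const_add (F p.1 p.2 i))).congr_deriv ?_
  have hlam := lambdaMinus_sq one_pos ν p.1 β p.2
  have h4 := M0_mul_Fvec one_pos ν p.1 hβ hlam hne i
  change ∑ j, M0 ν 1 p.1 β p.2 i j * F p.1 p.2 j = _ * F p.1 p.2 i at h4
  have hM : ∀ x, ∑ j, M0 ν x p.1 β p.2 i j * F p.1 p.2 j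
      = ∑ j, (coefM ν β 0 x i j : ℂ) * u p.1 p.2 j + (if i = 3 then ((x ^ ν : ℝ) : ℂ) else 0)
        + ∑ l : Fin 3, coefScalar l p.1 p.2 * ∑ j, (coefM ν β l.succ x i j : ℂ) * F p.1 p.2 j := by
    intro x
    have h5 : (if i = 3 then ((x ^ ν : ℝ) : ℂ) else 0)
        = ∑ j, (coefM ν β 0 x i j : ℂ) * (if j = 3 then 1 else 0) := by
      simp only [mul_ite, mul_one, mul_zero, Finset.sum_ite_eq', Finset.mem_univ, if_true]
      by_cases hi : i = 3
      · subst hi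
        rw [coefM_zero_diag, if_pos rfl]
      · rw [coefM_zero_apply _ _ _ hi, if_neg hi, Complex.ofReal_zero]
    have h6 : ∀ j, F p.1 p.2 j = u p.1 p.2 j + (if j = 3 then 1 else 0) := by
      intro j
      by_cases hj : j = 3
      · subst hj
        simp [hu, hF3]
      · simp [hu, hj]
    rw [h5, ← Finset.sum_add_distrib]
    simp only [Finset.mul_sum]
    rw [Finset.sum_comm, ← Finset.sum_add_distrib]
    refine Finset.sum_congr rfl fun j _ => ?_
    rw [M0_apply_eq]
    conv_lhs => rw [add_mul]
    rw [← mul_add, ← h6, Finset.sum_mul]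
    congr 1
    exact Finset.sum_congr rfl fun l _ => by ring
  have hfy : f p.1 p.2 i y = Real.exp (θ * y) * ((((s y ^ ν : ℝ) : ℂ) - 1) * F p.1 p.2 i
      + (∑ j, M0 ν 1 p.1 β p.2 i j * F p.1 p.2 j
        - ∑ j, M0 ν (s y) p.1 β p.2 i j * F p.1 p.2 j)) := by
    have h3 : f p.1 p.2 i y = (∑ j, u p.1 p.2 j * Q 0 i j θ y - u p.1 p.2 i * H y)
      + ∑ l : Fin 3, coefScalar l p.1 p.2
        * ∑ j, F p.1 p.2 j * Q l.succ i j θ y := by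
      simp [hf]
    have h7 : ∀ (l : Fin 4) (g : Fin 5 → ℂ), ∑ j, g j * Q l i j θ y = Real.exp (θ * y) *
        (∑ j, (coefM ν β l 1 i j : ℂ) * g j - ∑ j, (coefM ν β l (s y) i j : ℂ) * g j) := by
      intro l g
      rw [← Finset.sum_sub_distrib, Finset.mul_sum]
      refine Finset.sum_congr rfl fun j _ => ?_
      rw [hQ]
      ring
    have h8 : u p.1 p.2 i = F p.1 p.2 i - (if i = 3 then 1 else 0) := by
      by_cases hi : i = 3
      · subst hi
        simp [hu, hF3]
      · simp [hu, hi]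
    rw [h3, hM, hM, h7, hH, h8]
    simp only [h7, Fin.sum_univ_three]
    have h9 : ∀ x : ℝ, (if i = 3 then ((x ^ ν : ℝ) : ℂ) else 0)
        = (if i = 3 then 1 else 0) * ((x ^ ν : ℝ) : ℂ) := fun x => by split_ifs <;> simp
    rw [h9, h9, Real.one_rpow, Complex.ofReal_one]
    ring
  have hE : (Real.exp (-θ * y) : ℂ) * Real.exp (θ * y) = 1 := by
    rw [← Complex.ofReal_mul, ← Real.exp_add]
    simp
  rw [hfy, h4]
  push_cast at hE ⊢
  generalize Complex.exp (θ * y) = e₁ at hE ⊢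
  generalize Complex.exp (-(θ : ℂ) * y) = e₂ at hE ⊢
  generalize fastFactor ν s y₀ (lambdaMinus ν 1 p.1 β p.2) y = N
  have h5 : ∑ j, M0 ν (s y) p.1 β p.2 i j * (N * (F p.1 p.2 j + e₂ * Y p.1 p.2 j y))
      = N * (∑ j, M0 ν (s y) p.1 β p.2 i j * F p.1 p.2 j
        + e₂ * ∑ j, M0 ν (s y) p.1 β p.2 i j * Y p.1 p.2 j y) := by
    rw [Finset.mul_sum, ← Finset.sum_add_distrib, Finset.mul_sum]
    exact Finset.sum_congr rfl fun j _ => by ring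
  rw [h5]
  linear_combination (N * ((((s y ^ ν : ℝ) : ℂ) - 1) * F p.1 p.2 i
    - lambdaMinus ν 1 p.1 β p.2 * F p.1 p.2 i
    - ∑ j, M0 ν (s y) p.1 β p.2 i j * F p.1 p.2 j)) * hE

/-! ### Left eigenvectors and triangular form -/

/-- Linear forms in which the frozen system becomes triangular. The first three rows are left
eigenvectors of `-M₀(s)` for `λ₊(s)`, `λ₋(s)`, `-αβ`; the last two complete the triangular form,
with the eigenvalues `αγs` and `αβ`. Unlike the eigenvectors, these forms do not degenerate for
`γ s = β`. -/
noncomputable def leftForms (ν s α β : ℝ) (γ : ℂ) : Matrix (Fin 5) (Fin 5) ℂ :=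
  let q : ℂ := s ^ 2 / (β + γ * s) - β
  let p : ℂ := -(α * β * (s ^ 2 / (β + γ * s) + (β + γ * s)))
  !![-(1 / s), 0, 0, lambdaPlus ν s α β γ, 1;
     -(1 / s), 0, 0, lambdaMinus ν s α β γ, 1;
     -(q / s), β, β, p, (β + γ * s) + β + q;
     0, β, -(γ * s), 0, β;
     0, 0, 0, 0, 1]

/-- The lower triangular matrix of the frozen system in the coordinates `leftForms`. -/
noncomputable def triangularForm (ν s α β : ℝ) (γ : ℂ) : Matrix (Fin 5) (Fin 5) ℂ :=
  let q : ℂ := s ^ 2 / (β + γ * s) - β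
  let p : ℂ := -(α * β * (s ^ 2 / (β + γ * s) + (β + γ * s)))
  let lp := lambdaPlus ν s α β γ
  let lm := lambdaMinus ν s α β γ
  let c₄ : ℂ := α ^ 2 * β ^ 3 - α * ((s ^ ν : ℝ) : ℂ) * s ^ 2 + α * β * γ * s * ((s ^ ν : ℝ) : ℂ)
  let cd : ℂ := -(α * β * γ * s)
  let e₄ : ℂ := α * β * p / (β + γ * s) + α ^ 2 * β ^ 2
  let ed : ℂ := α * β * q / (β + γ * s)
  !![lp, 0, 0, 0, 0;
     0, lm, 0, 0, 0;
     0, 0, -(α * β), 0, 0;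
     (c₄ - cd * lm) / (lp - lm), (cd * lp - c₄) / (lp - lm), 0, α * γ * s, 0;
     (e₄ - ed * lm) / (lp - lm), (ed * lp - e₄) / (lp - lm), -(α * β / (β + γ * s)),
       α * β / (β + γ * s), α * β]

theorem leftForms_mul {ν s α β : ℝ} {γ : ℂ} (hs : 0 < s) (hβ : 0 < β)
    (hτ : (β : ℂ) + γ * s ≠ 0) (hΔ : lambdaPlus ν s α β γ - lambdaMinus ν s α β γ ≠ 0) :
    leftForms ν s α β γ * -M0 ν s α β γ = triangularForm ν s α β γ * leftForms ν s α β γ := by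
  have hs' : (s : ℂ) ≠ 0 := by exact_mod_cast hs.ne'
  have hβ' : (β : ℂ) ≠ 0 := by exact_mod_cast hβ.ne'
  have hm := lambdaMinus_sq hs ν α β γ
  have hq : ((s ^ ν : ℝ) : ℂ) = -lambdaPlus ν s α β γ - lambdaMinus ν s α β γ := by
    rw [lambdaPlus_eq]
    ring
  unfold leftForms triangularForm M0
  simp only [hq] at hm ⊢
  generalize lambdaPlus ν s α β γ = lp at *
  generalize lambdaMinus ν s α β γ = lm at *
  have hτ' : (β : ℂ) + s * γ ≠ 0 := by rwa [mul_comm (s : ℂ)]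
  clear hq
  ext i j
  rw [Matrix.mul_apply, Matrix.mul_apply, Fin.sum_univ_five, Fin.sum_univ_five]
  fin_cases i <;> fin_cases j <;> simp
  all_goals (try field_simp)
  all_goals (try ring1)
  · linear_combination -hm
  · linear_combination -hm
  · exact Or.inl (by ring)

theorem leftForms_mulVec_injective {ν s α β : ℝ} {γ : ℂ} (hs : 0 < s) (hβ : 0 < β)
    (hτ : (β : ℂ) + γ * s ≠ 0) (hΔ : lambdaPlus ν s α β γ - lambdaMinus ν s α β γ ≠ 0) :
    Function.Injective (leftForms ν s α β γ).mulVec := by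
  have hs' : (s : ℂ) ≠ 0 := by exact_mod_cast hs.ne'
  have hβ' : (β : ℂ) ≠ 0 := by exact_mod_cast hβ.ne'
  have key : ∀ X, (leftForms ν s α β γ).mulVec X = 0 → X = 0 := by
    intro X hX
    have h := fun i => congrFun hX i
    have h0 := h 0
    have h1 := h 1
    have h2 := h 2
    have h3 := h 3
    have h4 := h 4
    simp only [leftForms, Matrix.mulVec, dotProduct, Fin.sum_univ_five] at h0 h1 h2 h3 h4
    simp at h0 h1 h2 h3 h4
    have e3 : X 3 = 0 := by
      have : (lambdaPlus ν s α β γ - lambdaMinus ν s α β γ) * X 3 = 0 := by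
        linear_combination h0 - h1
      exact (mul_eq_zero.1 this).resolve_left hΔ
    rw [h4, e3] at h0 h2
    rw [h4] at h3
    have e0 : X 0 = 0 := by
      simp at h0
      exact h0.resolve_left hs.ne'
    rw [e0] at h2
    have e2 : X 2 = 0 := by
      have : (β + γ * s) * X 2 = 0 := by linear_combination h2 - h3
      exact (mul_eq_zero.1 this).resolve_left hτ
    have e1 : X 1 = 0 := by
      rw [e2] at h3
      simp at h3
      exact h3.resolve_left hβ.ne'
    funext i
    fin_cases i <;> simp [e0, e1, e2, e3, h4]
  intro X Y hXY
  have := key (X - Y) (by rw [Matrix.mulVec_sub, sub_eq_zero]; exact hXY)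
  exact sub_eq_zero.1 this

theorem isUnit_det_leftForms {ν s α β : ℝ} {γ : ℂ} (hs : 0 < s) (hβ : 0 < β)
    (hτ : (β : ℂ) + γ * s ≠ 0) (hΔ : lambdaPlus ν s α β γ - lambdaMinus ν s α β γ ≠ 0) :
    IsUnit (leftForms ν s α β γ).det :=
  (Matrix.isUnit_iff_isUnit_det _).1
    (Matrix.mulVec_injective_iff_isUnit.1 (leftForms_mulVec_injective hs hβ hτ hΔ))

theorem lambdaPlus_sub_lambdaMinus_ne {ν s α β : ℝ} {γ : ℂ} (hs : 0 < s) (hα : 0 ≤ α)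
    (hγ : 0 ≤ γ.re) : lambdaPlus ν s α β γ - lambdaMinus ν s α β γ ≠ 0 := by
  have h := le_thermalRoot_re (ν := ν) (β := β) hs hα hγ
  have hp : 0 < s ^ ν := Real.rpow_pos_of_pos hs _
  have : lambdaPlus ν s α β γ - lambdaMinus ν s α β γ = 2 * thermalRoot ν s α β γ := by
    unfold lambdaPlus lambdaMinus
    ring
  rw [this]
  intro h0
  have h1 : thermalRoot ν s α β γ = 0 := by simpa using h0
  rw [h1] at h
  simp at h
  linarith

theorem beta_add_ne {s β : ℝ} {γ : ℂ} (hs : 0 < s) (hβ : 0 < β) (hγ : 0 ≤ γ.re) :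
    (β : ℂ) + γ * s ≠ 0 := by
  intro h
  have := congrArg Complex.re h
  rw [Complex.add_re, mul_comm, Complex.re_ofReal_mul, Complex.ofReal_re, Complex.zero_re] at this
  have := mul_nonneg hs.le hγ
  linarith

/-- A linear system conjugated to a triangular one, with a remainder. -/
theorem hasDerivAt_mulVec {S A U : Matrix (Fin 5) (Fin 5) ℂ} (hSA : S * A = U * S)
    {X : ℝ → Fin 5 → ℂ} {r : Fin 5 → ℂ} {y : ℝ}
    (hX : ∀ i, HasDerivAt (fun t => X t i) (A.mulVec (X y) i + r i) y) (i : Fin 5) :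
    HasDerivAt (fun t => S.mulVec (X t) i) (U.mulVec (S.mulVec (X y)) i + S.mulVec r i) y := by
  have h1 : HasDerivAt (fun t => ∑ j, S i j * X t j)
      (∑ j, S i j * (A.mulVec (X y) j + r j)) y :=
    HasDerivAt.fun_sum fun j _ => (hX j).const_mul (S i j)
  refine h1.congr_deriv ?_
  have h2 : U.mulVec (S.mulVec (X y)) = S.mulVec (A.mulVec (X y)) := by
    rw [Matrix.mulVec_mulVec, Matrix.mulVec_mulVec, hSA]
  rw [h2]
  simp [Matrix.mulVec, dotProduct, mul_add, Finset.sum_add_distrib]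

/-! ### Decaying modes -/

namespace IsModelProfile

variable {ν y₀ ξ₀ θ : ℝ} {s : ℝ → ℝ}

theorem theta_lt_one (hs : IsModelProfile ν y₀ ξ₀ θ s) : θ < 1 := by
  have h1 := hs.two_theta_le y₀
  have h2 := hs.rpow_le_one y₀
  have := hs.theta_pos
  linarith

/-- The normal mode system converges exponentially to its limit at `s = 1`. -/
theorem exists_norm_M0_sub_le (hs : IsModelProfile ν y₀ ξ₀ θ s) (α β : ℝ) (γ : ℂ) :
    ∃ K, 0 ≤ K ∧ ∀ y i j, ‖M0 ν 1 α β γ i j - M0 ν (s y) α β γ i j‖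
      ≤ K * Real.exp (2 * θ * (y₀ - y)) := by
  choose C hC0 hC using fun (l : Fin 4) (i j : Fin 5) =>
    exists_abs_sub_le_of_contDiffOn (contDiffOn_coefM ν β l i j) hs.xi_pos
  have hb : ∀ l i j y, ‖(coefM ν β l 1 i j : ℂ) - (coefM ν β l (s y) i j : ℂ)‖
      ≤ C l i j * Real.exp (2 * θ * (y₀ - y)) := by
    intro l i j y
    rw [← Complex.ofReal_sub, Complex.norm_real]
    exact (hC l i j _ (hs.mem_Icc y)).trans (mul_le_mul_of_nonneg_left (hs.decay y) (hC0 l i j))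
  set D : Fin 5 → Fin 5 → ℝ := fun i j =>
    C 0 i j + ∑ l : Fin 3, ‖coefScalar l α γ‖ * C l.succ i j with hD
  have hD0 : ∀ i j, 0 ≤ D i j := fun i j => add_nonneg (hC0 _ _ _)
    (Finset.sum_nonneg fun l _ => mul_nonneg (norm_nonneg _) (hC0 _ _ _))
  refine ⟨∑ i, ∑ j, D i j, Finset.sum_nonneg fun i _ => Finset.sum_nonneg fun j _ => hD0 i j,
    fun y i j => ?_⟩
  have h1 : D i j ≤ ∑ i, ∑ j, D i j :=
    (Finset.single_le_sum (f := fun j => D i j) (fun j _ => hD0 i j) (Finset.mem_univ j)).trans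
      (Finset.single_le_sum (f := fun i => ∑ j, D i j)
        (fun i _ => Finset.sum_nonneg fun j _ => hD0 i j) (Finset.mem_univ i))
  refine le_trans ?_ (mul_le_mul_of_nonneg_right h1 (Real.exp_pos _).le)
  have h2 : M0 ν 1 α β γ i j - M0 ν (s y) α β γ i j
      = ((coefM ν β 0 1 i j : ℂ) - (coefM ν β 0 (s y) i j : ℂ))
        + ∑ l : Fin 3, coefScalar l α γ
          * ((coefM ν β l.succ 1 i j : ℂ) - (coefM ν β l.succ (s y) i j : ℂ)) := by
    rw [M0_apply_eq, M0_apply_eq]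
    simp only [mul_sub, Finset.sum_sub_distrib]
    ring
  rw [h2, hD, add_mul, Finset.sum_mul]
  refine (norm_add_le _ _).trans (add_le_add (hb _ _ _ _) ((norm_sum_le _ _).trans
    (Finset.sum_le_sum fun l _ => ?_)))
  rw [norm_mul, mul_assoc]
  gcongr
  exact hb _ _ _ _

end IsModelProfile

theorem exists_norm_le_of_tendsto_zero {u : ℝ → ℂ} (hc : Continuous u)
    (h0 : Tendsto u atTop (𝓝 0)) (y₁ : ℝ) : ∃ B, ∀ y, y₁ ≤ y → ‖u y‖ ≤ B := by
  obtain ⟨Y, hY⟩ := eventually_atTop.1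
    (h0.norm.eventually (gt_mem_nhds (show ‖(0 : ℂ)‖ < 1 by simp)))
  obtain ⟨C, hC⟩ := (isCompact_Icc (a := y₁) (b := Y)).exists_bound_of_continuousOn hc.continuousOn
  refine ⟨max 1 C, fun y hy => ?_⟩
  rcases le_total y Y with h | h
  · exact (hC y ⟨hy, h⟩).trans (le_max_right _ _)
  · exact (hY y h).le.trans (le_max_left _ _)

theorem IsScaledMode.continuous {ν : ℝ} {s : ℝ → ℝ} {α β : ℝ} {γ : ℂ} {X : ℝ → Fin 5 → ℂ}
    (h : IsScaledMode ν s α β γ X) (i : Fin 5) : Continuous fun y => X y i :=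
  continuous_iff_continuousAt.2 fun y => (h y i).continuousAt

/-- Finite sums of functions which are `O(e^{-θ y})` on a half line. -/
theorem exists_norm_sum_le {n : ℕ} {y₁ θ : ℝ} (c : Fin n → ℂ) {u : Fin n → ℝ → ℂ}
    (hu : ∀ i, ∃ K, ∀ y, y₁ ≤ y → ‖u i y‖ ≤ K * Real.exp (-θ * y)) :
    ∃ K, ∀ y, y₁ ≤ y → ‖∑ i, c i * u i y‖ ≤ K * Real.exp (-θ * y) := by
  choose K hK using hu
  refine ⟨∑ i, ‖c i‖ * K i, fun y hy => ?_⟩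
  rw [Finset.sum_mul]
  refine (norm_sum_le _ _).trans (Finset.sum_le_sum fun i _ => ?_)
  rw [norm_mul, mul_assoc]
  gcongr
  exact hK i y hy

/-- Solutions of a lower triangular system with one diagonal entry for each sign pattern needed:
the first, fourth and fifth components grow unless they are `O(e^{-θ y})`, the second one is
strongly damped, and the third one is assumed to be `O(e^{-θ y})`. -/
theorem norm_le_of_triangular {U : Matrix (Fin 5) (Fin 5) ℂ} {θ y₁ : ℝ} (hθ : 0 < θ)
    (hU : ∀ i j, i < j → U i j = 0) (h0 : 0 ≤ (U 0 0).re) (h1 : (U 1 1).re < -θ)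
    (h3 : 0 ≤ (U 3 3).re) (h4 : 0 ≤ (U 4 4).re) {Z f : Fin 5 → ℝ → ℂ}
    (hZ : ∀ i y, y₁ ≤ y → HasDerivAt (Z i) (∑ j, U i j * Z j y + f i y) y)
    (hf : ∀ i, ∃ K, ∀ y, y₁ ≤ y → ‖f i y‖ ≤ K * Real.exp (-θ * y))
    (hlim : ∀ i, Tendsto (Z i) atTop (𝓝 0))
    (h2 : ∃ K, ∀ y, y₁ ≤ y → ‖Z 2 y‖ ≤ K * Real.exp (-θ * y)) (i : Fin 5) :
    ∃ K, ∀ y, y₁ ≤ y → ‖Z i y‖ ≤ K * Real.exp (-θ * y) := by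
  have hadd : ∀ {u v : ℝ → ℂ}, (∃ K, ∀ y, y₁ ≤ y → ‖u y‖ ≤ K * Real.exp (-θ * y)) →
      (∃ K, ∀ y, y₁ ≤ y → ‖v y‖ ≤ K * Real.exp (-θ * y)) →
      ∃ K, ∀ y, y₁ ≤ y → ‖u y + v y‖ ≤ K * Real.exp (-θ * y) := by
    rintro u v ⟨K, hK⟩ ⟨L, hL⟩
    exact ⟨K + L, fun y hy => (norm_add_le _ _).trans (by
      rw [add_mul]
      exact add_le_add (hK y hy) (hL y hy))⟩
  have hmul : ∀ {u : ℝ → ℂ} (c : ℂ), (∃ K, ∀ y, y₁ ≤ y → ‖u y‖ ≤ K * Real.exp (-θ * y)) →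
      ∃ K, ∀ y, y₁ ≤ y → ‖c * u y‖ ≤ K * Real.exp (-θ * y) := by
    rintro u c ⟨K, hK⟩
    exact ⟨‖c‖ * K, fun y hy => by
      rw [norm_mul, mul_assoc]
      gcongr
      exact hK y hy⟩
  have e0 : ∃ K, ∀ y, y₁ ≤ y → ‖Z 0 y‖ ≤ K * Real.exp (-θ * y) := by
    obtain ⟨K, hK⟩ := hf 0
    exact ⟨_, norm_le_of_tendsto_zero (μ := U 0 0) hθ h0 (fun y hy => (hZ 0 y hy).congr_deriv (by
      simp [Fin.sum_univ_five, hU])) hK (hlim 0)⟩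
  have e1 : ∃ K, ∀ y, y₁ ≤ y → ‖Z 1 y‖ ≤ K * Real.exp (-θ * y) := by
    obtain ⟨K, hK⟩ := hadd (hmul (U 1 0) e0) (hf 1)
    exact ⟨_, norm_le_of_re_lt (μ := U 1 1) h1 (fun y hy => (hZ 1 y hy).congr_deriv (by
      simp [Fin.sum_univ_five, hU]
      ring)) hK⟩
  have e3 : ∃ K, ∀ y, y₁ ≤ y → ‖Z 3 y‖ ≤ K * Real.exp (-θ * y) := by
    obtain ⟨K, hK⟩ := hadd (hadd (hadd (hmul (U 3 0) e0) (hmul (U 3 1) e1)) (hmul (U 3 2) h2)) (hf 3)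
    exact ⟨_, norm_le_of_tendsto_zero (μ := U 3 3) hθ h3 (fun y hy => (hZ 3 y hy).congr_deriv (by
      simp [Fin.sum_univ_five, hU]
      ring)) hK (hlim 3)⟩
  have e4 : ∃ K, ∀ y, y₁ ≤ y → ‖Z 4 y‖ ≤ K * Real.exp (-θ * y) := by
    obtain ⟨K, hK⟩ := hadd (hadd (hadd (hadd (hmul (U 4 0) e0) (hmul (U 4 1) e1))
      (hmul (U 4 2) h2)) (hmul (U 4 3) e3)) (hf 4)
    exact ⟨_, norm_le_of_tendsto_zero (μ := U 4 4) hθ h4 (fun y hy => (hZ 4 y hy).congr_deriv (by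
      simp [Fin.sum_univ_five]
      ring)) hK (hlim 4)⟩
  fin_cases i
  · exact e0
  · exact e1
  · exact h2
  · exact e3
  · exact e4

theorem leftForms_mulVec_EaMinus_two {α β : ℝ} {γ : ℂ} (ν : ℝ) (h : (β : ℂ) + γ ≠ 0) :
    (leftForms ν 1 α β γ).mulVec (EaMinus 1 β γ) 2 = -(2 * β * (β + γ)) := by
  have h' : (β : ℂ) + γ * 1 ≠ 0 := by simpa using h
  simp [leftForms, EaMinus, Matrix.mulVec, dotProduct, Fin.sum_univ_five]
  field_simp
  ring

/-- A mode which tends to `0` at `+∞` is a multiple of `e^{-αβ y} E_{a,-}(1)`, up to an error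
`O(e^{-θ y})`. -/
theorem IsModelProfile.exists_norm_sub_slow_le {ν y₀ ξ₀ θ : ℝ} {s : ℝ → ℝ}
    (hs : IsModelProfile ν y₀ ξ₀ θ s) {α β : ℝ} {γ : ℂ} (hα : 0 < α) (hβ : 0 < β)
    (hαβ : α * β < θ) (hγ : 0 ≤ γ.re) {X : ℝ → Fin 5 → ℂ} (hX : IsScaledMode ν s α β γ X)
    (h0 : ∀ i, Tendsto (fun y => X y i) atTop (𝓝 0)) :
    ∃ c : ℂ, ∀ i, ∃ K, ∀ y, y₀ ≤ y →
      ‖X y i - c * ((Real.exp (-(α * β) * y) : ℂ) * EaMinus 1 β γ i)‖ ≤ K * Real.exp (-θ * y) := by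
  have hθ := hs.theta_pos
  have hτ := beta_add_ne (s := 1) one_pos hβ hγ
  have hτ1 : (β : ℂ) + γ ≠ 0 := by simpa using hτ
  have hΔ := lambdaPlus_sub_lambdaMinus_ne (ν := ν) (β := β) (γ := γ) one_pos hα.le hγ
  set S := leftForms ν 1 α β γ with hS
  set U := triangularForm ν 1 α β γ with hU
  have hSM : S * -M0 ν 1 α β γ = U * S := leftForms_mul one_pos hβ hτ hΔ
  have hSu : IsUnit S.det := isUnit_det_leftForms one_pos hβ hτ hΔ
  -- the remainder of the system frozen at `s = 1`
  set r : ℝ → Fin 5 → ℂ := fun y => (M0 ν 1 α β γ - M0 ν (s y) α β γ).mulVec (X y) with hr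
  have hrb : ∀ i, ∃ K, ∀ y, y₀ ≤ y → ‖r y i‖ ≤ K * Real.exp (-θ * y) := by
    intro i
    obtain ⟨K, hK0, hK⟩ := hs.exists_norm_M0_sub_le α β γ
    choose B hB using fun j => exists_norm_le_of_tendsto_zero (hX.continuous j) (h0 j) y₀
    refine ⟨∑ j, K * Real.exp (θ * y₀) * B j, fun y hy => ?_⟩
    rw [Finset.sum_mul]
    change ‖∑ j, (M0 ν 1 α β γ - M0 ν (s y) α β γ) i j * X y j‖ ≤ _
    refine (norm_sum_le _ _).trans (Finset.sum_le_sum fun j _ => ?_)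
    rw [norm_mul]
    have h1 : Real.exp (2 * θ * (y₀ - y)) ≤ Real.exp (θ * y₀) * Real.exp (-θ * y) := by
      rw [← Real.exp_add]
      apply Real.exp_le_exp.2
      nlinarith
    calc _ ≤ K * (Real.exp (θ * y₀) * Real.exp (-θ * y)) * B j := by
          gcongr
          · exact (hK y i j).trans (by gcongr)
          · exact hB j y hy
      _ = _ := by ring
  have hfb : ∀ i : Fin 5, ∃ K : ℝ, ∀ y, y₀ ≤ y → ‖S.mulVec (r y) i‖ ≤ K * Real.exp (-θ * y) := by
    intro i
    obtain ⟨K, hK⟩ := exists_norm_sum_le (y₁ := y₀) (θ := θ) (fun j => S i j)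
      (u := fun j y => r y j) hrb
    exact ⟨K, hK⟩
  -- the perturbed modes
  set E : ℝ → ℂ := fun y => (Real.exp (-(α * β) * y) : ℂ) with hEdef
  have hE : ∀ y, HasDerivAt E (-(α * β) * E y) y := by
    intro y
    have := (((hasDerivAt_id y).const_mul (-(α * β))).exp).ofReal_comp
    refine this.congr_deriv ?_
    simp [hEdef]
    ring
  have hElim : Tendsto E atTop (𝓝 0) := by
    have h1 : Tendsto (fun y : ℝ => α * β * y) atTop atTop :=
      tendsto_id.const_mul_atTop (mul_pos hα hβ)
    have h2 := (Complex.continuous_ofReal.tendsto 0).comp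
      (Real.tendsto_exp_neg_atTop_nhds_zero.comp h1)
    simp only [Complex.ofReal_zero] at h2
    refine h2.congr fun y => ?_
    simp [hEdef]
  set W : ℂ → ℝ → Fin 5 → ℂ := fun c y i => X y i - c * (E y * EaMinus 1 β γ i) with hW
  have hWd : ∀ c y i, HasDerivAt (fun t => W c t i) ((-M0 ν 1 α β γ).mulVec (W c y) i + r y i) y := by
    intro c y i
    refine ((hX y i).sub (((hE y).mul_const (EaMinus 1 β γ i)).const_mul c)).congr_deriv ?_
    have h4 := M0_mul_EaMinus one_pos ν α β γ i
    simp only [hr, hW, Matrix.mulVec, dotProduct, Matrix.neg_apply, Matrix.sub_apply, neg_mul,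
      sub_mul, mul_sub, Finset.sum_sub_distrib, Finset.sum_neg_distrib]
    have h5 : ∑ j, M0 ν 1 α β γ i j * (c * (E y * EaMinus 1 β γ j))
        = c * E y * ∑ j, M0 ν 1 α β γ i j * EaMinus 1 β γ j := by
      rw [Finset.mul_sum]
      exact Finset.sum_congr rfl fun j _ => by ring
    rw [h5, h4]
    ring
  have hZd : ∀ c i y, HasDerivAt (fun t => S.mulVec (W c t) i)
      (∑ j, U i j * S.mulVec (W c y) j + S.mulVec (r y) i) y := fun c i y =>
    hasDerivAt_mulVec hSM (hWd c y) i
  have hWlim : ∀ c i, Tendsto (fun y => W c y i) atTop (𝓝 0) := by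
    intro c i
    simpa using (h0 i).sub ((hElim.mul_const (EaMinus 1 β γ i)).const_mul c)
  have hZlim : ∀ c i, Tendsto (fun y => S.mulVec (W c y) i) atTop (𝓝 0) := by
    intro c i
    have : Tendsto (fun y => ∑ j, S i j * W c y j) atTop (𝓝 (∑ j, S i j * 0)) :=
      tendsto_finsetSum _ fun j _ => (hWlim c j).const_mul _
    simp only [mul_zero, Finset.sum_const_zero] at this
    exact this
  have hUtri : ∀ i j, i < j → U i j = 0 := by
    intro i j hij
    fin_cases i <;> fin_cases j <;> simp [hU, triangularForm] at hij ⊢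
  -- the amplitude of the slow mode
  obtain ⟨K₂, hK₂⟩ := hfb 2
  obtain ⟨m, hm⟩ := exists_norm_sub_exp_le (u := fun t => S.mulVec (X t) 2)
    (f := fun y => S.mulVec (r y) 2) (μ := ((-(α * β) : ℝ) : ℂ)) (θ := θ) (y₁ := y₀)
    (by rw [Complex.ofReal_re]; linarith)
    (fun y _ => by
      have := hZd 0 2 y
      simp only [hW, zero_mul, sub_zero] at this
      refine this.congr_deriv ?_
      rw [Fin.sum_univ_five]
      simp [hU, triangularForm])
    hK₂
  have hEa2 : S.mulVec (EaMinus 1 β γ) 2 = -(2 * β * (β + γ)) :=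
    leftForms_mulVec_EaMinus_two ν hτ1
  have hEa2ne : S.mulVec (EaMinus 1 β γ) 2 ≠ 0 := by
    rw [hEa2]
    have : (β : ℂ) ≠ 0 := by exact_mod_cast hβ.ne'
    simp [this, hτ1]
  set c : ℂ := m / S.mulVec (EaMinus 1 β γ) 2 with hc
  refine ⟨c, ?_⟩
  have hlm := lambdaMinus_re_le (ν := ν) (β := β) one_pos hα.le hγ
  rw [Real.one_rpow] at hlm
  have hZ := norm_le_of_triangular (U := U) (y₁ := y₀) hθ hUtri
    (by simpa [hU, triangularForm] using (lambdaPlus_re_pos (ν := ν) one_pos hα hβ hγ).le)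
    (by
      simp only [hU, triangularForm]
      simp
      linarith [hs.theta_lt_one])
    (by
      simp only [hU, triangularForm]
      simp
      positivity)
    (by
      simp only [hU, triangularForm]
      simp
      positivity)
    (Z := fun i y => S.mulVec (W c y) i) (f := fun i y => S.mulVec (r y) i)
    (fun i y _ => hZd c i y) hfb (hZlim c)
    ⟨_, fun y hy => by
      have h1 : S.mulVec (W c y) 2
          = S.mulVec (X y) 2 - m * Complex.exp (((-(α * β) : ℝ) : ℂ) * y) := by
        have h2 : W c y = X y - (c * E y) • EaMinus 1 β γ := by
          funext i
          simp [hW, mul_assoc]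
        rw [h2, Matrix.mulVec_sub, Matrix.mulVec_smul, Pi.sub_apply, Pi.smul_apply, smul_eq_mul, hc]
        have h3 : E y = Complex.exp (((-(α * β) : ℝ) : ℂ) * y) := by
          simp only [hEdef]
          push_cast
          rfl
        rw [h3]
        field_simp
      rw [h1]
      exact hm y hy⟩
  intro i
  obtain ⟨K, hK⟩ := exists_norm_sum_le (fun j => S⁻¹ i j)
    (u := fun j y => S.mulVec (W c y) j) hZ
  refine ⟨K, fun y hy => ?_⟩
  have h1 : W c y i = ∑ j, S⁻¹ i j * S.mulVec (W c y) j := by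
    have : S⁻¹.mulVec (S.mulVec (W c y)) = W c y := by
      rw [Matrix.mulVec_mulVec, Matrix.nonsing_inv_mul _ hSu, Matrix.one_mulVec]
    conv_lhs => rw [← this]
    rfl
  change ‖W c y i‖ ≤ _
  rw [h1]
  exact hK y hy

/-- A strongly damped equation, started from `0`, is controlled by its source. -/
theorem norm_le_of_damped {u f : ℝ → ℂ} {a : ℝ → ℝ} {θ K y₁ : ℝ} (hθ : 0 < θ)
    (hac : Continuous a) (ha : ∀ t, 2 * θ ≤ a t)
    (hu : ∀ t, y₁ ≤ t → HasDerivAt u (-(a t) * u t + f t) t) (h0 : u y₁ = 0)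
    (hf : ∀ t, y₁ ≤ t → ‖f t‖ ≤ K * Real.exp (-θ * t)) (t : ℝ) (ht : y₁ ≤ t) :
    ‖u t‖ ≤ K / θ * Real.exp (-θ * t) := by
  have hK : 0 ≤ K := nonneg_of_mul_nonneg_left ((norm_nonneg _).trans (hf t ht)) (Real.exp_pos _)
  set A : ℝ → ℝ := fun T => ∫ τ in y₁..T, a τ with hAdef
  have hA : ∀ T, HasDerivAt A (a T) T := fun T => (hac.integral_hasStrictDerivAt y₁ T).hasDerivAt
  have hP : ∀ T, y₁ ≤ T → HasDerivAt (fun T => ((Real.exp (A T) : ℝ) : ℂ) * u T)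
      (((Real.exp (A T) : ℝ) : ℂ) * f T) T := by
    intro T hT
    refine ((hA T).exp.ofReal_comp.mul (hu T hT)).congr_deriv ?_
    push_cast
    ring
  have hB : ∀ τ, HasDerivAt
      (fun τ => K / θ * (Real.exp (A τ - θ * τ) - Real.exp (A y₁ - θ * y₁)))
      (K / θ * (Real.exp (A τ - θ * τ) * (a τ - θ))) τ := by
    intro τ
    have := ((((hA τ).sub ((hasDerivAt_id τ).const_mul θ)).exp).sub_const
      (Real.exp (A y₁ - θ * y₁))).const_mul (K / θ)
    refine this.congr_deriv ?_
    simp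
  have hn : ∀ T, ‖((Real.exp (A T) : ℝ) : ℂ)‖ = Real.exp (A T) := fun T => by
    rw [Complex.norm_real, Real.norm_of_nonneg (Real.exp_pos _).le]
  have h1 := image_norm_le_of_norm_deriv_right_le_deriv_boundary (a := y₁) (b := t)
    (f := fun T => ((Real.exp (A T) : ℝ) : ℂ) * u T)
    (fun τ hτ => (hP τ hτ.1).continuousAt.continuousWithinAt)
    (fun τ hτ => (hP τ hτ.1).hasDerivWithinAt)
    (by simp [h0]) hB
    (fun τ hτ => by
      rw [norm_mul, hn]
      have h2 : 1 ≤ (a τ - θ) / θ := (one_le_div hθ).2 (by linarith [ha τ])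
      calc Real.exp (A τ) * ‖f τ‖ ≤ Real.exp (A τ) * (K * Real.exp (-θ * τ)) := by
            gcongr
            exact hf τ hτ.1
        _ = K * Real.exp (A τ - θ * τ) * 1 := by
            rw [sub_eq_add_neg, Real.exp_add, neg_mul]
            ring
        _ ≤ K * Real.exp (A τ - θ * τ) * ((a τ - θ) / θ) := by gcongr
        _ = _ := by ring)
    (Set.right_mem_Icc.2 ht)
  rw [norm_mul, hn] at h1
  have h2 : K / θ * (Real.exp (A t - θ * t) - Real.exp (A y₁ - θ * y₁))
      ≤ Real.exp (A t) * (K / θ * Real.exp (-θ * t)) := by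
    have h3 : Real.exp (A t - θ * t) = Real.exp (A t) * Real.exp (-θ * t) := by
      rw [← Real.exp_add]
      ring_nf
    have h4 : 0 ≤ K / θ * Real.exp (A y₁ - θ * y₁) := by positivity
    rw [h3]
    linarith
  exact le_of_mul_le_mul_left (h1.trans h2) (Real.exp_pos _)

/-- All the rows of `M₀` but the thermal one are small with `α`, uniformly in the profile. -/
theorem IsModelProfile.eventually_norm_M0_le {ν y₀ ξ₀ θ : ℝ} {s : ℝ → ℝ}
    (hs : IsModelProfile ν y₀ ξ₀ θ s) (β : ℝ) (γ₀ : ℂ) {δ : ℝ} (hδ : 0 < δ) :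
    ∀ᶠ p in smallAlpha γ₀, ∀ y i j, i ≠ 3 → ‖M0 ν (s y) p.1 β p.2 i j‖ ≤ δ := by
  choose F hF using fun (l : Fin 4) (i j : Fin 5) =>
    hs.exists_bcf_comp (contDiffOn_coefM ν β l i j).continuousOn
  have h1 : ∀ i j, ∀ᶠ p in smallAlpha γ₀,
      ∑ l : Fin 3, ‖coefScalar l p.1 p.2‖ * ‖F l.succ i j‖ < δ := by
    intro i j
    have : Tendsto (fun p : ℝ × ℂ => ∑ l : Fin 3, ‖coefScalar l p.1 p.2‖ * ‖F l.succ i j‖)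
        (smallAlpha γ₀) (𝓝 (∑ l : Fin 3, ‖(0 : ℂ)‖ * ‖F l.succ i j‖)) :=
      tendsto_finsetSum _ fun l _ => (tendsto_coefScalar l γ₀).norm.mul_const _
    exact this.eventually (gt_mem_nhds (by simpa using hδ))
  filter_upwards [eventually_all.2 fun i => eventually_all.2 (h1 i)] with p hp y i j hi
  rw [M0_apply_eq, coefM_zero_apply ν β _ hi, Complex.ofReal_zero, zero_add]
  refine ((norm_sum_le _ _).trans (Finset.sum_le_sum fun l _ => ?_)).trans (hp i j).le
  rw [norm_mul, ← hF]
  gcongr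
  exact (F l.succ i j).norm_coe_le_norm y

/-- For small `α`, a mode which is `O(e^{-θ y})` and whose thermal component vanishes at `y₀` is
zero to the right of `y₀`. -/
theorem IsModelProfile.eventually_eq_zero {ν y₀ ξ₀ θ : ℝ} {s : ℝ → ℝ}
    (hs : IsModelProfile ν y₀ ξ₀ θ s) (β : ℝ) (γ₀ : ℂ) :
    ∀ᶠ p in smallAlpha γ₀, ∀ X, IsScaledMode ν s p.1 β p.2 X →
      (∀ i, ∃ K, ∀ y, y₀ ≤ y → ‖X y i‖ ≤ K * Real.exp (-θ * y)) → X y₀ 3 = 0 →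
      ∀ y, y₀ ≤ y → X y = 0 := by
  have hθ := hs.theta_pos
  have hξ := hs.xi_pos
  set L : ℝ := max 1 ((1 / ξ₀ + 1) / θ) with hL
  have hL0 : 0 < L := lt_max_of_lt_left one_pos
  have hδ : 0 < θ / (10 * L) := by positivity
  filter_upwards [hs.eventually_norm_M0_le β γ₀ hδ] with p hp X hX hK h3 y hy
  choose K hK using hK
  -- the equations turn any bound into a bound half as large
  have step : ∀ B, (∀ i t, y₀ ≤ t → ‖X t i‖ ≤ B * Real.exp (-θ * t)) →
      ∀ i t, y₀ ≤ t → ‖X t i‖ ≤ B / 2 * Real.exp (-θ * t) := by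
    intro B hB
    have hB0 : 0 ≤ B := nonneg_of_mul_nonneg_left ((norm_nonneg _).trans (hB 0 y hy))
      (Real.exp_pos _)
    have slow : ∀ i, i ≠ 3 → ∀ t, y₀ ≤ t →
        ‖X t i‖ ≤ B / (2 * L) * Real.exp (-θ * t) := by
      intro i hi t ht
      have h1 := norm_le_of_tendsto_zero (u := fun t => X t i)
        (f := fun t => -∑ j, M0 ν (s t) p.1 β p.2 i j * X t j) (μ := 0)
        (K := 5 * (θ / (10 * L)) * B) (y₁ := y₀) hθ (by simp)
        (fun t _ => (hX t i).congr_deriv (by ring))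
        (fun t ht => by
          rw [norm_neg]
          refine (norm_sum_le _ _).trans ((Finset.sum_le_sum (g := fun _ =>
            θ / (10 * L) * (B * Real.exp (-θ * t))) fun j _ => ?_).trans_eq ?_)
          · rw [norm_mul]
            gcongr
            · exact hp t i j hi
            · exact hB j t ht
          · simp
            ring)
        (by
          have h4 : Tendsto (fun t => K i * Real.exp (-θ * t)) atTop (𝓝 0) := by
            have : Tendsto (fun y : ℝ => θ * y) atTop atTop := tendsto_id.const_mul_atTop hθ
            have := (Real.tendsto_exp_neg_atTop_nhds_zero.comp this).const_mul (K i)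
            simpa [neg_mul, Function.comp_def] using this
          exact squeeze_zero_norm' ((eventually_ge_atTop y₀).mono (hK i)) h4) t ht
      refine h1.trans_eq ?_
      field_simp
      ring
    have fast : ∀ t, y₀ ≤ t → ‖X t 3‖ ≤ B / 2 * Real.exp (-θ * t) := by
      intro t ht
      have h1 := norm_le_of_damped (u := fun t => X t 3) (a := fun t => s t ^ ν)
        (f := fun t => -(1 / (s t : ℂ)) * X t 0 + X t 4)
        (K := (1 / ξ₀ + 1) * (B / (2 * L))) (y₁ := y₀) hθ hs.continuous_rpow hs.two_theta_le
        (fun t _ => (hX t 3).congr_deriv (by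
          rw [Fin.sum_univ_five]
          simp [M0]
          ring)) h3
        (fun t ht => by
          refine (norm_add_le _ _).trans ?_
          have h5 : ‖-(1 / (s t : ℂ))‖ ≤ 1 / ξ₀ := by
            rw [norm_neg, norm_div, norm_one, Complex.norm_real, Real.norm_of_nonneg (hs.pos t).le]
            exact one_div_le_one_div_of_le hξ (hs.ge t)
          have h6 := slow 0 (by decide) t ht
          have h7 := slow 4 (by decide) t ht
          have h8 : ‖-(1 / (s t : ℂ)) * X t 0‖
              ≤ 1 / ξ₀ * (B / (2 * L) * Real.exp (-θ * t)) := by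
            rw [norm_mul]
            gcongr
          linarith) t ht
      refine h1.trans (mul_le_mul_of_nonneg_right ?_ (Real.exp_pos _).le)
      have h9 : (1 / ξ₀ + 1) / θ ≤ L := le_max_right _ _
      calc (1 / ξ₀ + 1) * (B / (2 * L)) / θ = (1 / ξ₀ + 1) / θ * (B / (2 * L)) := by ring
        _ ≤ L * (B / (2 * L)) := by gcongr
        _ = B / 2 := by field_simp
    intro i t ht
    by_cases hi : i = 3
    · subst hi
      exact fast t ht
    · refine (slow i hi t ht).trans ?_
      have h10 : 1 ≤ L := le_max_left _ _
      gcongr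
      linarith
  have hall : ∀ n : ℕ, ∀ i t, y₀ ≤ t →
      ‖X t i‖ ≤ (∑ j, |K j|) * (1 / 2) ^ n * Real.exp (-θ * t) := by
    intro n
    induction n with
    | zero =>
      intro i t ht
      refine (hK i t ht).trans ?_
      rw [pow_zero, mul_one]
      gcongr
      exact (le_abs_self _).trans
        (Finset.single_le_sum (f := fun j => |K j|) (fun j _ => abs_nonneg _) (Finset.mem_univ i))
    | succ n ih =>
      intro i t ht
      refine (step _ ih i t ht).trans_eq ?_
      ring
  funext i
  have hlim : Tendsto (fun n : ℕ => (∑ j, |K j|) * (1 / 2 : ℝ) ^ n * Real.exp (-θ * y)) atTop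
      (𝓝 0) := by
    have := ((tendsto_pow_atTop_nhds_zero_of_lt_one (r := (1 / 2 : ℝ)) (by norm_num)
      (by norm_num)).const_mul (∑ j, |K j|)).mul_const (Real.exp (-θ * y))
    simpa using this
  have := ge_of_tendsto' hlim fun n => hall n i y hy
  exact norm_le_zero_iff.1 this

/-! ### The modes which decay at `+∞` -/

theorem IsModelProfile.norm_fastFactor_le {ν y₀ ξ₀ θ : ℝ} {s : ℝ → ℝ}
    (hs : IsModelProfile ν y₀ ξ₀ θ s) {lam : ℂ} (hlam : lam.re ≤ θ - 1) {y : ℝ} (hy : y₀ ≤ y) :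
    ‖fastFactor ν s y₀ lam y‖ ≤ Real.exp (θ * y₀) * Real.exp (-θ * y) := by
  have h1 : 2 * θ * (y - y₀) ≤ ∫ t in y₀..y, s t ^ ν := by
    have := intervalIntegral.integral_mono_on (μ := MeasureTheory.volume) hy
      intervalIntegrable_const (hs.continuous_rpow.intervalIntegrable y₀ y)
      (fun x _ => hs.two_theta_le x) (f := fun _ => 2 * θ)
    rw [intervalIntegral.integral_const, smul_eq_mul, mul_comm] at this
    exact this
  unfold fastFactor
  rw [Complex.norm_exp, ← Real.exp_add]
  apply Real.exp_le_exp.2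
  rw [Complex.sub_re, Complex.ofReal_re, ← Complex.ofReal_sub, Complex.re_mul_ofReal,
    Complex.add_re, Complex.one_re]
  have h2 : (1 + lam.re) * (y - y₀) ≤ θ * (y - y₀) :=
    mul_le_mul_of_nonneg_right (by linarith) (by linarith)
  linarith

theorem fastFactor_self (ν : ℝ) (s : ℝ → ℝ) (y₀ : ℝ) (lam : ℂ) : fastFactor ν s y₀ lam y₀ = 1 := by
  simp [fastFactor]

theorem fastFactor_ne_zero (ν : ℝ) (s : ℝ → ℝ) (y₀ : ℝ) (lam : ℂ) (y : ℝ) :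
    fastFactor ν s y₀ lam y ≠ 0 := Complex.exp_ne_zero _

theorem IsScaledMode.add {ν : ℝ} {s : ℝ → ℝ} {α β : ℝ} {γ : ℂ} {X Y : ℝ → Fin 5 → ℂ}
    (hX : IsScaledMode ν s α β γ X) (hY : IsScaledMode ν s α β γ Y) (a b : ℂ) :
    IsScaledMode ν s α β γ fun y i => a * X y i + b * Y y i := by
  intro y i
  refine (((hX y i).const_mul a).add ((hY y i).const_mul b)).congr_deriv ?_
  simp only [mul_add, Finset.sum_add_distrib, neg_add, mul_neg, Finset.mul_sum]
  congr 2 <;> exact Finset.sum_congr rfl fun j _ => by ring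

/-- `φ` and `ψ` are, for small `α` and for `γ` close to `γ₀`, bases of the modes which decay at
`+∞`. The fast mode `φ` has the thermal decay rate, and the slow mode `ψ` decays like
`e^{-αβ y}`; the thermal component of `ψ` is normalized to vanish at `y₀`. -/
structure IsDecayingBasis (ν y₀ : ℝ) (s : ℝ → ℝ) (β : ℝ) (φ ψ : ℝ → ℂ → ℝ → Fin 5 → ℂ)
    (γ₀ : ℂ) : Prop where
  fast_mode : ∀ᶠ p in smallAlpha γ₀, IsScaledMode ν s p.1 β p.2 (φ p.1 p.2)
  slow_mode : ∀ᶠ p in smallAlpha γ₀, IsScaledMode ν s p.1 β p.2 (ψ p.1 p.2)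
  fast_lim : ∀ᶠ p in smallAlpha γ₀, ∀ i, Tendsto (fun y => φ p.1 p.2 y i) atTop (𝓝 0)
  slow_lim : ∀ᶠ p in smallAlpha γ₀, ∀ i, Tendsto (fun y => ψ p.1 p.2 y i) atTop (𝓝 0)
  fast_asymp : ∀ᶠ p in smallAlpha γ₀, ∀ i, Tendsto (fun y =>
    (fastFactor ν s y₀ (lambdaMinus ν 1 p.1 β p.2) y)⁻¹ * φ p.1 p.2 y i) atTop
    (𝓝 (Fvec 1 p.1 β p.2 (lambdaMinus ν 1 p.1 β p.2) i))
  slow_asymp : ∀ᶠ p in smallAlpha γ₀, ∀ i, Tendsto (fun y : ℝ =>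
    (Real.exp (p.1 * β * y) : ℂ) * ψ p.1 p.2 y i) atTop (𝓝 (EaMinus 1 β p.2 i))
  fast_init : ∀ i, Tendsto (fun p : ℝ × ℂ => φ p.1 p.2 y₀ i) (smallAlpha γ₀)
    (𝓝 ((![0, 0, 0, 1, 0] : Fin 5 → ℂ) i))
  slow_init : ∀ i, Tendsto (fun p : ℝ × ℂ => ψ p.1 p.2 y₀ i) (smallAlpha γ₀)
    (𝓝 (EaMinus 1 β γ₀ i))
  fast_diff : ∀ᶠ p in smallAlpha γ₀, ∀ i, DifferentiableAt ℂ (fun γ => φ p.1 γ y₀ i) p.2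
  slow_diff : ∀ᶠ p in smallAlpha γ₀, ∀ i, DifferentiableAt ℂ (fun γ => ψ p.1 γ y₀ i) p.2
  classify : ∀ᶠ p in smallAlpha γ₀, 0 ≤ p.2.re → ∀ X, IsScaledMode ν s p.1 β p.2 X →
    (∀ i, Tendsto (fun y => X y i) atTop (𝓝 0)) →
    ∃ c k : ℂ, ∀ y, y₀ ≤ y → ∀ i, X y i = c * ψ p.1 p.2 y i + k * φ p.1 p.2 y i

theorem tendsto_ofReal_exp_neg_mul {θ : ℝ} (hθ : 0 < θ) :
    Tendsto (fun y : ℝ => (Real.exp (-θ * y) : ℂ)) atTop (𝓝 0) := by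
  have h1 : Tendsto (fun y : ℝ => θ * y) atTop atTop := tendsto_id.const_mul_atTop hθ
  have h2 := (Complex.continuous_ofReal.tendsto 0).comp
    (Real.tendsto_exp_neg_atTop_nhds_zero.comp h1)
  simp only [Complex.ofReal_zero] at h2
  refine h2.congr fun y => ?_
  simp

theorem tendsto_exp_mul_bcf {θ : ℝ} (hθ : 0 < θ) (Y : ℝ →ᵇ ℂ) :
    Tendsto (fun y : ℝ => (Real.exp (-θ * y) : ℂ) * Y y) atTop (𝓝 0) := by
  have h1 := tendsto_ofReal_exp_neg_mul hθ
  refine squeeze_zero_norm (a := fun y => ‖(Real.exp (-θ * y) : ℂ)‖ * ‖Y‖) (fun y => ?_) ?_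
  · rw [norm_mul]
    gcongr
    exact Y.norm_coe_le_norm y
  · simpa using h1.norm.mul_const ‖Y‖

/-- For small `α`, the modes which tend to `0` at `+∞` form a plane, which depends
holomorphically on `γ`. -/
theorem IsModelProfile.exists_isDecayingBasis {ν y₀ ξ₀ θ : ℝ} {s : ℝ → ℝ}
    (hs : IsModelProfile ν y₀ ξ₀ θ s) {β : ℝ} (hβ : 0 < β) :
    ∃ φ ψ : ℝ → ℂ → ℝ → Fin 5 → ℂ, ∀ γ₀, IsDecayingBasis ν y₀ s β φ ψ γ₀ := by
  have hθ := hs.theta_pos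
  obtain ⟨V, hV, hVd, hV0, hVb⟩ := hs.exists_slow_mode hβ
  obtain ⟨W, hW, hWd, hW0⟩ := hs.exists_fast_mode hβ
  set N : ℝ → ℂ → ℝ → ℂ := fun α γ y => fastFactor ν s y₀ (lambdaMinus ν 1 α β γ) y with hN
  set φ : ℝ → ℂ → ℝ → Fin 5 → ℂ := fun α γ y i => N α γ y *
    (Fvec 1 α β γ (lambdaMinus ν 1 α β γ) i + (Real.exp (-θ * y) : ℂ) * W α γ i y) with hφ
  set χ : ℝ → ℂ → ℝ → Fin 5 → ℂ := fun α γ y i =>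
    (Real.exp (-(α * β) * y) : ℂ) * EaMinus 1 β γ i + (Real.exp (-θ * y) : ℂ) * V α γ i y with hχ
  set κ : ℝ → ℂ → ℂ := fun α γ => -(χ α γ y₀ 3 / φ α γ y₀ 3) with hκ
  set ψ : ℝ → ℂ → ℝ → Fin 5 → ℂ := fun α γ y i => 1 * χ α γ y i + κ α γ * φ α γ y i with hψ
  refine ⟨φ, ψ, fun γ₀ => ?_⟩
  -- values at `y₀`
  have hN1 : ∀ α γ, N α γ y₀ = 1 := fun α γ => fastFactor_self ν s y₀ _
  have hφ0 : ∀ i, Tendsto (fun p : ℝ × ℂ => φ p.1 p.2 y₀ i) (smallAlpha γ₀)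
      (𝓝 ((![0, 0, 0, 1, 0] : Fin 5 → ℂ) i)) := by
    intro i
    have h1 : Tendsto (fun p : ℝ × ℂ => W p.1 p.2 i y₀) (smallAlpha γ₀) (𝓝 0) := by
      refine squeeze_zero_norm (a := fun p : ℝ × ℂ => ‖W p.1 p.2‖) (fun p => ?_) ?_
      · exact ((W p.1 p.2 i).norm_coe_le_norm y₀).trans (norm_le_pi_norm _ i)
      · simpa using (hW0 γ₀).norm
    have h2 := (tendsto_Fvec_lambdaMinus ν β γ₀ i).add (h1.const_mul (Real.exp (-θ * y₀) : ℂ))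
    simp only [mul_zero, add_zero] at h2
    refine h2.congr fun p => ?_
    simp only [hφ, hN1, one_mul]
  have hφ3 : Tendsto (fun p : ℝ × ℂ => φ p.1 p.2 y₀ 3) (smallAlpha γ₀) (𝓝 1) := hφ0 3
  have hφne : ∀ᶠ p in smallAlpha γ₀, φ p.1 p.2 y₀ 3 ≠ 0 := hφ3.eventually_ne one_ne_zero
  have hEa : ∀ i, Tendsto (fun p : ℝ × ℂ => (Real.exp (-(p.1 * β) * y₀) : ℂ) * EaMinus 1 β p.2 i)
      (smallAlpha γ₀) (𝓝 (EaMinus 1 β γ₀ i)) := by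
    intro i
    have h1 : Tendsto (fun p : ℝ × ℂ => (Real.exp (-(p.1 * β) * y₀) : ℂ)) (smallAlpha γ₀)
        (𝓝 (Real.exp (-(0 * β) * y₀) : ℂ)) := by
      have : Continuous fun p : ℝ × ℂ => (Real.exp (-(p.1 * β) * y₀) : ℂ) := by fun_prop
      exact (this.tendsto (0, γ₀)).mono_left (smallAlpha_le_nhds γ₀)
    simp only [zero_mul, neg_zero, Real.exp_zero, Complex.ofReal_one] at h1
    have h2 := h1.mul (((differentiable_EaMinus 1 β i).continuous.tendsto γ₀).comp
      (tendsto_gamma γ₀))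
    simpa using h2
  have hVlim : ∀ i, i ≠ 3 → Tendsto (fun p : ℝ × ℂ => V p.1 p.2 i y₀) (smallAlpha γ₀) (𝓝 0) := by
    intro i hi
    refine squeeze_zero_norm (a := fun p : ℝ × ℂ => ‖V p.1 p.2 i‖) (fun p => ?_) ?_
    · exact (V p.1 p.2 i).norm_coe_le_norm y₀
    · simpa using (hV0 i γ₀ hi).norm
  have hχ0 : ∀ i, i ≠ 3 → Tendsto (fun p : ℝ × ℂ => χ p.1 p.2 y₀ i) (smallAlpha γ₀)
      (𝓝 (EaMinus 1 β γ₀ i)) := by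
    intro i hi
    have := (hEa i).add ((hVlim i hi).const_mul (Real.exp (-θ * y₀) : ℂ))
    rw [mul_zero, add_zero] at this
    exact this
  have hκb : ∃ C, ∀ᶠ p in smallAlpha γ₀, ‖κ p.1 p.2‖ ≤ C := by
    obtain ⟨C, hC⟩ := hVb γ₀
    refine ⟨2 * (Real.exp (-θ * y₀) * C), ?_⟩
    have h1 : ∀ᶠ p in smallAlpha γ₀, 1 / 2 < ‖φ p.1 p.2 y₀ 3‖ := by
      have := hφ3.norm
      rw [norm_one] at this
      exact this.eventually (lt_mem_nhds (by norm_num))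
    filter_upwards [hC, h1] with p hp h1
    have h2 : ‖χ p.1 p.2 y₀ 3‖ ≤ Real.exp (-θ * y₀) * C := by
      have : χ p.1 p.2 y₀ 3 = (Real.exp (-θ * y₀) : ℂ) * V p.1 p.2 3 y₀ := by
        simp [hχ, EaMinus]
      rw [this, norm_mul, Complex.norm_real, Real.norm_of_nonneg (Real.exp_pos _).le]
      gcongr
      exact (((V p.1 p.2 3).norm_coe_le_norm y₀).trans (norm_le_pi_norm _ _)).trans hp
    simp only [hκ]
    rw [norm_neg, norm_div, div_le_iff₀ (by linarith)]
    have := norm_nonneg (χ p.1 p.2 y₀ 3)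
    nlinarith
  have hlam : ∀ᶠ p in smallAlpha γ₀, (lambdaMinus ν 1 p.1 β p.2).re ≤ θ - 1 := by
    have h1 := (Complex.continuous_re.tendsto _).comp (tendsto_lambdaMinus_one ν β γ₀)
    have h2 : (-1 : ℂ).re < θ - 1 := by simpa using hθ
    filter_upwards [h1.eventually (gt_mem_nhds h2)] with p hp
    exact le_of_lt hp
  have hαβ : ∀ᶠ p in smallAlpha γ₀, 0 < p.1 ∧ p.1 * β < θ := by
    filter_upwards [eventually_alpha_pos γ₀, eventually_alpha_lt γ₀ (div_pos hθ hβ)] with p h1 h2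
    exact ⟨h1, (lt_div_iff₀ hβ).1 h2⟩
  have hmodes : ∀ᶠ p in smallAlpha γ₀, IsScaledMode ν s p.1 β p.2 (ψ p.1 p.2) := by
    filter_upwards [hV γ₀, hW γ₀] with p h1 h2
    exact h1.add h2 1 (κ p.1 p.2)
  -- decay of the fast mode
  have hφbd : ∀ p : ℝ × ℂ, (lambdaMinus ν 1 p.1 β p.2).re ≤ θ - 1 → ∀ i, ∃ K, ∀ y, y₀ ≤ y →
      ‖φ p.1 p.2 y i‖ ≤ K * Real.exp (-θ * y) := by
    intro p hp i
    refine ⟨Real.exp (θ * y₀) * (‖Fvec 1 p.1 β p.2 (lambdaMinus ν 1 p.1 β p.2) i‖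
      + Real.exp (-θ * y₀) * ‖W p.1 p.2 i‖), fun y hy => ?_⟩
    simp only [hφ, hN]
    rw [norm_mul, mul_right_comm]
    refine mul_le_mul (hs.norm_fastFactor_le hp hy) ((norm_add_le _ _).trans ?_) (norm_nonneg _)
      (by positivity)
    rw [norm_mul, Complex.norm_real, Real.norm_of_nonneg (Real.exp_pos _).le]
    have h1 : Real.exp (-θ * y) ≤ Real.exp (-θ * y₀) := Real.exp_le_exp.2 (by nlinarith)
    gcongr
    exact (W p.1 p.2 i).norm_coe_le_norm y
  have hexp0 : ∀ K : ℝ, Tendsto (fun y => K * Real.exp (-θ * y)) atTop (𝓝 0) := by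
    intro K
    have h1 : Tendsto (fun y : ℝ => θ * y) atTop atTop := tendsto_id.const_mul_atTop hθ
    have := (Real.tendsto_exp_neg_atTop_nhds_zero.comp h1).const_mul K
    simpa [neg_mul, Function.comp_def] using this
  have hfl : ∀ᶠ p in smallAlpha γ₀, ∀ i, Tendsto (fun y => φ p.1 p.2 y i) atTop (𝓝 0) := by
    filter_upwards [hlam] with p hp i
    obtain ⟨K, hK⟩ := hφbd p hp i
    exact squeeze_zero_norm' ((eventually_ge_atTop y₀).mono hK) (hexp0 K)
  have hsa : ∀ᶠ p in smallAlpha γ₀, ∀ i, Tendsto (fun y : ℝ =>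
      (Real.exp (p.1 * β * y) : ℂ) * ψ p.1 p.2 y i) atTop (𝓝 (EaMinus 1 β p.2 i)) := by
    filter_upwards [hlam, hαβ] with p hp h2 i
    obtain ⟨K, hK⟩ := hφbd p hp i
    have h3 : Tendsto (fun y : ℝ => (Real.exp (p.1 * β * y) : ℂ) * φ p.1 p.2 y i) atTop (𝓝 0) := by
      have h4 := ((tendsto_ofReal_exp_neg_mul (sub_pos.2 h2.2)).norm).mul_const K
      rw [norm_zero, zero_mul] at h4
      refine squeeze_zero_norm' ((eventually_ge_atTop y₀).mono fun y hy => ?_) h4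
      rw [norm_mul, Complex.norm_real, Complex.norm_real, Real.norm_of_nonneg (Real.exp_pos _).le,
        Real.norm_of_nonneg (Real.exp_pos _).le]
      calc _ ≤ Real.exp (p.1 * β * y) * (K * Real.exp (-θ * y)) := by
            gcongr
            exact hK y hy
        _ = Real.exp (p.1 * β * y) * Real.exp (-θ * y) * K := by ring
        _ = _ := by
            rw [← Real.exp_add]
            ring_nf
    have h5 : Tendsto (fun y : ℝ => (Real.exp (-(θ - p.1 * β) * y) : ℂ) * V p.1 p.2 i y) atTop
        (𝓝 0) := tendsto_exp_mul_bcf (sub_pos.2 h2.2) _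
    have h6 := (h5.const_add (EaMinus 1 β p.2 i)).add (h3.const_mul (κ p.1 p.2))
    simp only [add_zero, mul_zero] at h6
    refine h6.congr fun y => ?_
    have e1 : (Real.exp (-(θ - p.1 * β) * y) : ℂ)
        = (Real.exp (p.1 * β * y) : ℂ) * (Real.exp (-θ * y) : ℂ) := by
      rw [← Complex.ofReal_mul, ← Real.exp_add]
      ring_nf
    have e2 : (Real.exp (p.1 * β * y) : ℂ) * (Real.exp (-(p.1 * β) * y) : ℂ) = 1 := by
      rw [← Complex.ofReal_mul, ← Real.exp_add]
      simp
    simp only [hψ, hχ]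
    rw [e1]
    linear_combination -(EaMinus 1 β p.2 i) * e2
  refine ⟨hW γ₀, hmodes, hfl, ?_, ?_, hsa, hφ0, ?_, ?_, ?_, ?_⟩
  · -- decay of the slow mode
    filter_upwards [hsa, hαβ] with p hp h2 i
    have h3 := (tendsto_ofReal_exp_neg_mul (mul_pos h2.1 hβ)).mul (hp i)
    rw [zero_mul] at h3
    refine h3.congr fun y => ?_
    rw [← mul_assoc, ← Complex.ofReal_mul, ← Real.exp_add]
    simp
  · -- asymptotics of the fast mode
    filter_upwards with p i
    have h1 := (tendsto_exp_mul_bcf hθ (W p.1 p.2 i)).const_add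
      (Fvec 1 p.1 β p.2 (lambdaMinus ν 1 p.1 β p.2) i)
    rw [add_zero] at h1
    refine h1.congr fun y => ?_
    simp only [hφ, hN]
    rw [inv_mul_cancel_left₀ (fastFactor_ne_zero _ _ _ _ _)]
  · intro i
    by_cases hi : i = 3
    · subst hi
      refine (tendsto_congr' ?_).2 (tendsto_const_nhds (x := EaMinus 1 β γ₀ 3))
      filter_upwards [hφne] with p hp
      simp only [hψ, hκ]
      have : EaMinus 1 β γ₀ 3 = 0 := by simp [EaMinus]
      rw [this]
      field_simp
      ring
    · obtain ⟨C, hC⟩ := hκb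
      have h1 : (![0, 0, 0, 1, 0] : Fin 5 → ℂ) i = 0 := by
        fin_cases i <;> simp at hi ⊢
      have h2 := hφ0 i
      rw [h1] at h2
      have h3 : Tendsto (fun p : ℝ × ℂ => κ p.1 p.2 * φ p.1 p.2 y₀ i) (smallAlpha γ₀) (𝓝 0) := by
        have h4 := h2.norm.const_mul C
        rw [norm_zero, mul_zero] at h4
        refine squeeze_zero_norm' (hC.mono fun p hp => ?_) h4
        rw [norm_mul]
        gcongr
      simpa [hψ] using (hχ0 i hi).add h3
  · filter_upwards [hWd γ₀, eventually_all.2 (eventually_differentiableAt_Fvec ν β γ₀)] with p h1 h2 i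
    simp only [hφ, hN1, one_mul]
    have h3 : DifferentiableAt ℂ (fun γ => W p.1 γ i y₀) p.2 :=
      ((BoundedContinuousFunction.evalCLM (β := ℂ) ℂ y₀).differentiableAt).comp p.2
        (differentiableAt_pi.1 h1 i)
    exact (h2 i).add (h3.const_mul _)
  · filter_upwards [hWd γ₀, hVd γ₀, eventually_all.2 (eventually_differentiableAt_Fvec ν β γ₀), hφne]
      with p h1 h1' h2 h4 i
    have h3 : ∀ i, DifferentiableAt ℂ (fun γ => W p.1 γ i y₀) p.2 := fun i =>
      ((BoundedContinuousFunction.evalCLM (β := ℂ) ℂ y₀).differentiableAt).comp p.2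
        (differentiableAt_pi.1 h1 i)
    have h3' : ∀ i, DifferentiableAt ℂ (fun γ => V p.1 γ i y₀) p.2 := fun i =>
      ((BoundedContinuousFunction.evalCLM (β := ℂ) ℂ y₀).differentiableAt).comp p.2
        (differentiableAt_pi.1 h1' i)
    have hd1 : ∀ i, DifferentiableAt ℂ (fun γ => φ p.1 γ y₀ i) p.2 := by
      intro i
      simp only [hφ, hN1, one_mul]
      exact (h2 i).add ((h3 i).const_mul _)
    have hd2 : ∀ i, DifferentiableAt ℂ (fun γ => χ p.1 γ y₀ i) p.2 := by
      intro i
      exact ((differentiable_EaMinus 1 β i p.2).const_mul _).add ((h3' i).const_mul _)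
    exact ((hd2 i).const_mul 1).add ((((hd2 3).div (hd1 3) h4).neg).mul (hd1 i))
  · filter_upwards [hs.eventually_eq_zero β γ₀, hαβ, hlam, hφne, hV γ₀, hW γ₀]
      with p hz h2 h3 h4 h5 h6 hre X hX hX0
    obtain ⟨c, hc⟩ := hs.exists_norm_sub_slow_le h2.1 hβ h2.2 hre hX hX0
    set k : ℂ := (X y₀ 3 - c * χ p.1 p.2 y₀ 3) / φ p.1 p.2 y₀ 3 with hk
    set D : ℝ → Fin 5 → ℂ := fun y i =>
      1 * (1 * X y i + (-c) * χ p.1 p.2 y i) + (-k) * φ p.1 p.2 y i with hD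
    have hDm : IsScaledMode ν s p.1 β p.2 D := (hX.add h5 1 (-c)).add h6 1 (-k)
    have hDb : ∀ i, ∃ K, ∀ y, y₀ ≤ y → ‖D y i‖ ≤ K * Real.exp (-θ * y) := by
      intro i
      obtain ⟨K, hK⟩ := hc i
      obtain ⟨L, hL⟩ := hφbd p h3 i
      refine ⟨K + ‖c‖ * ‖V p.1 p.2 i‖ + ‖k‖ * L, fun y hy => ?_⟩
      have e : D y i = (X y i - c * ((Real.exp (-(p.1 * β) * y) : ℂ) * EaMinus 1 β p.2 i))
          - c * ((Real.exp (-θ * y) : ℂ) * V p.1 p.2 i y) - k * φ p.1 p.2 y i := by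
        simp only [hD, hχ]
        ring
      rw [e, add_mul, add_mul]
      refine (norm_sub_le _ _).trans (add_le_add ((norm_sub_le _ _).trans
        (add_le_add (hK y hy) ?_)) ?_)
      · rw [norm_mul, norm_mul, Complex.norm_real, Real.norm_of_nonneg (Real.exp_pos _).le,
          mul_assoc, mul_comm ‖V p.1 p.2 i‖]
        gcongr
        exact (V p.1 p.2 i).norm_coe_le_norm y
      · rw [norm_mul, mul_assoc]
        gcongr
        exact hL y hy
    have hD3 : D y₀ 3 = 0 := by
      simp only [hD, hk]
      field_simp
      ring
    have hzero := hz D hDm hDb hD3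
    refine ⟨c, k - c * κ p.1 p.2, fun y hy i => ?_⟩
    have := congrFun (hzero y hy) i
    simp only [hD, Pi.zero_apply] at this
    simp only [hψ]
    linear_combination this

/-! ### Matching at `y₀` -/

/-- Uniqueness for linear systems, in the form of a differential inequality. -/
theorem eq_zero_of_norm_deriv_le {E : Type*} [NormedAddCommGroup E] [NormedSpace ℝ E]
    {u u' : ℝ → E} {C t₀ : ℝ} (hu : ∀ t, HasDerivAt u (u' t) t) (hC : ∀ t, ‖u' t‖ ≤ C * ‖u t‖)
    (h0 : u t₀ = 0) (t : ℝ) : u t = 0 := by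
  have key : ∀ (v v' : ℝ → E) (b : ℝ), (∀ t, HasDerivAt v (v' t) t) →
      (∀ t, ‖v' t‖ ≤ C * ‖v t‖) → v b = 0 → ∀ t, b ≤ t → v t = 0 := by
    intro v v' b hv hC h0 t ht
    have := norm_le_gronwallBound_of_norm_deriv_right_le (f := v) (f' := v') (δ := 0) (K := C)
      (ε := 0) (a := b) (b := t) (fun τ _ => (hv τ).continuousAt.continuousWithinAt)
      (fun τ _ => (hv τ).hasDerivWithinAt) (by simp [h0]) (fun τ _ => by simpa using hC τ) t
      (Set.right_mem_Icc.2 ht)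
    simpa [gronwallBound_ε0_δ0] using this
  rcases le_total t₀ t with h | h
  · exact key u u' t₀ hu hC h0 t h
  · have := key (fun τ => u (-τ)) (fun τ => -u' (-τ)) (-t₀)
      (fun τ => by
        have := (hu (-τ)).scomp τ (hasDerivAt_neg τ)
        simpa [Function.comp_def] using this)
      (fun τ => by simpa using hC (-τ)) (by simpa using h0) (-t) (by linarith)
    simpa using this

theorem IsModelProfile.exists_norm_M0_le {ν y₀ ξ₀ θ : ℝ} {s : ℝ → ℝ}
    (hs : IsModelProfile ν y₀ ξ₀ θ s) (α β : ℝ) (γ : ℂ) :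
    ∃ C, 0 ≤ C ∧ ∀ y i j, ‖M0 ν (s y) α β γ i j‖ ≤ C := by
  choose F hF using fun (l : Fin 4) (i j : Fin 5) =>
    hs.exists_bcf_comp (contDiffOn_coefM ν β l i j).continuousOn
  set D : Fin 5 → Fin 5 → ℝ := fun i j =>
    ‖F 0 i j‖ + ∑ l : Fin 3, ‖coefScalar l α γ‖ * ‖F l.succ i j‖ with hD
  have hD0 : ∀ i j, 0 ≤ D i j := fun i j => add_nonneg (norm_nonneg _)
    (Finset.sum_nonneg fun l _ => mul_nonneg (norm_nonneg _) (norm_nonneg _))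
  refine ⟨∑ i, ∑ j, D i j, Finset.sum_nonneg fun i _ => Finset.sum_nonneg fun j _ => hD0 i j,
    fun y i j => ?_⟩
  have h1 : D i j ≤ ∑ i, ∑ j, D i j :=
    (Finset.single_le_sum (f := fun j => D i j) (fun j _ => hD0 i j) (Finset.mem_univ j)).trans
      (Finset.single_le_sum (f := fun i => ∑ j, D i j)
        (fun i _ => Finset.sum_nonneg fun j _ => hD0 i j) (Finset.mem_univ i))
  refine le_trans ?_ h1
  rw [M0_apply_eq, ← hF]
  refine (norm_add_le _ _).trans (add_le_add ((F 0 i j).norm_coe_le_norm y)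
    ((norm_sum_le _ _).trans (Finset.sum_le_sum fun l _ => ?_)))
  rw [norm_mul, ← hF]
  gcongr
  exact (F l.succ i j).norm_coe_le_norm y

theorem IsModelProfile.mode_eq_zero {ν y₀ ξ₀ θ : ℝ} {s : ℝ → ℝ}
    (hs : IsModelProfile ν y₀ ξ₀ θ s) {α β : ℝ} {γ : ℂ} {X : ℝ → Fin 5 → ℂ}
    (hX : IsScaledMode ν s α β γ X) {y₁ : ℝ} (h0 : X y₁ = 0) (y : ℝ) : X y = 0 := by
  obtain ⟨C, hC0, hC⟩ := hs.exists_norm_M0_le α β γ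
  refine eq_zero_of_norm_deriv_le (u := X) (C := 5 * C)
    (u' := fun y i => -∑ j, M0 ν (s y) α β γ i j * X y j)
    (fun t => hasDerivAt_pi.2 fun i => hX t i) (fun t => ?_) h0 y
  refine (pi_norm_le_iff_of_nonneg (by positivity)).2 fun i => ?_
  rw [norm_neg]
  refine (norm_sum_le _ _).trans ((Finset.sum_le_sum (g := fun _ => C * ‖X t‖)
    fun j _ => ?_).trans_eq (by simp; ring))
  rw [norm_mul]
  gcongr
  · exact hC t i j
  · exact norm_le_pi_norm _ j

theorem exp_mul_eq_of_hasDerivAt {u : ℝ → ℂ} {μ : ℂ} {y₁ : ℝ}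
    (hu : ∀ t, t ≤ y₁ → HasDerivAt u (μ * u t) t) {t : ℝ} (ht : t ≤ y₁) :
    Complex.exp (-μ * y₁) * u y₁ = Complex.exp (-μ * t) * u t := by
  have := norm_exp_mul_sub_le (u := u) (f := fun _ => 0) (μ := μ) (K := 0) (δ := μ.re + 1) ht
    (by linarith) (fun τ hτ => by simpa using hu τ hτ.2) (fun τ _ => by simp)
  rw [zero_mul, zero_div] at this
  exact sub_eq_zero.1 (norm_le_zero_iff.1 this)

/-- An exponential which does not vanish does not tend to `0` in the direction of its growth. -/
theorem eq_zero_of_tendsto_atBot {u : ℝ → ℂ} {μ : ℂ} {y₁ : ℝ} (hμ : μ.re ≤ 0)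
    (hu : ∀ t, t ≤ y₁ → HasDerivAt u (μ * u t) t) (h0 : Tendsto u atBot (𝓝 0)) : u y₁ = 0 := by
  have h1 : ∀ᶠ t in atBot, ‖u y₁‖ ≤ ‖u t‖ := by
    filter_upwards [eventually_le_atBot y₁] with t ht
    have h2 := congrArg norm (exp_mul_eq_of_hasDerivAt hu ht)
    rw [norm_mul, norm_mul, norm_exp_neg_mul, norm_exp_neg_mul] at h2
    have h3 : Real.exp (-(μ.re * t)) ≤ Real.exp (-(μ.re * y₁)) := by
      apply Real.exp_le_exp.2
      nlinarith
    have h4 : Real.exp (-(μ.re * y₁)) * ‖u y₁‖ ≤ Real.exp (-(μ.re * y₁)) * ‖u t‖ := by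
      rw [h2]
      gcongr
    exact le_of_mul_le_mul_left h4 (Real.exp_pos _)
  have := ge_of_tendsto h0.norm h1
  rw [norm_zero] at this
  exact norm_le_zero_iff.1 this

section Left

variable {ν y₀ ξ₀ θ : ℝ} {s : ℝ → ℝ}

/-- To the left of `y₀` the system has constant coefficients, and the forms `leftForms` make it
triangular. -/
theorem IsModelProfile.hasDerivAt_leftForms (hs : IsModelProfile ν y₀ ξ₀ θ s) {α β : ℝ} {γ : ℂ}
    (hα : 0 < α) (hβ : 0 < β) (hγ : 0 ≤ γ.re) {X : ℝ → Fin 5 → ℂ}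
    (hX : IsScaledMode ν s α β γ X) (i : Fin 5) {y : ℝ} (hy : y ≤ y₀) :
    HasDerivAt (fun t => (leftForms ν ξ₀ α β γ).mulVec (X t) i)
      (∑ j, triangularForm ν ξ₀ α β γ i j * (leftForms ν ξ₀ α β γ).mulVec (X y) j) y := by
  have h1 := leftForms_mul (ν := ν) hs.xi_pos hβ (beta_add_ne hs.xi_pos hβ hγ)
    (lambdaPlus_sub_lambdaMinus_ne (ν := ν) (β := β) hs.xi_pos hα.le hγ)
  have h2 := hasDerivAt_mulVec h1 (X := X) (r := 0) (y := y)
    (fun i => (hX y i).congr_deriv (by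
      rw [hs.eq_left y hy]
      simp [Matrix.mulVec, dotProduct, neg_mul])) i
  refine h2.congr_deriv ?_
  rw [Matrix.mulVec_zero, Pi.zero_apply, add_zero]
  rfl

theorem triangularForm_one (ν s α β : ℝ) (γ : ℂ) (v : Fin 5 → ℂ) :
    ∑ j, triangularForm ν s α β γ 1 j * v j = lambdaMinus ν s α β γ * v 1 := by
  rw [Fin.sum_univ_five]
  simp [triangularForm]

theorem triangularForm_two (ν s α β : ℝ) (γ : ℂ) (v : Fin 5 → ℂ) :
    ∑ j, triangularForm ν s α β γ 2 j * v j = -(α * β) * v 2 := by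
  rw [Fin.sum_univ_five]
  simp [triangularForm]

theorem lambdaMinus_re_neg {s : ℝ} (hs : 0 < s) (ν : ℝ) {α : ℝ} (β : ℝ) {γ : ℂ} (hα : 0 ≤ α)
    (hγ : 0 ≤ γ.re) : (lambdaMinus ν s α β γ).re < 0 :=
  (lambdaMinus_re_le (ν := ν) (β := β) hs hα hγ).trans_lt (neg_neg_of_pos (Real.rpow_pos_of_pos hs ν))

/-- A mode which tends to `0` at `-∞` has no component at `y₀` along the thermal mode of
rate `λ₋` and the acoustic mode of rate `-αβ`, whose rates have negative real part. -/
theorem IsModelProfile.leftForms_eq_zero (hs : IsModelProfile ν y₀ ξ₀ θ s) {α β : ℝ} {γ : ℂ}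
    (hα : 0 < α) (hβ : 0 < β) (hγ : 0 ≤ γ.re) {X : ℝ → Fin 5 → ℂ}
    (hX : IsScaledMode ν s α β γ X) (h0 : ∀ i, Tendsto (fun y => X y i) atBot (𝓝 0)) :
    (leftForms ν ξ₀ α β γ).mulVec (X y₀) 1 = 0 ∧ (leftForms ν ξ₀ α β γ).mulVec (X y₀) 2 = 0 := by
  have hlim : ∀ i, Tendsto (fun y => (leftForms ν ξ₀ α β γ).mulVec (X y) i) atBot (𝓝 0) := by
    intro i
    have : Tendsto (fun y => ∑ j, leftForms ν ξ₀ α β γ i j * X y j) atBot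
        (𝓝 (∑ j, leftForms ν ξ₀ α β γ i j * 0)) :=
      tendsto_finsetSum _ fun j _ => (h0 j).const_mul _
    simp only [mul_zero, Finset.sum_const_zero] at this
    exact this
  constructor
  · refine eq_zero_of_tendsto_atBot (y₁ := y₀)
      (u := fun y => (leftForms ν ξ₀ α β γ).mulVec (X y) 1)
      (lambdaMinus_re_neg hs.xi_pos ν β hα.le hγ).le
      (fun t ht => (hs.hasDerivAt_leftForms hα hβ hγ hX 1 ht).congr_deriv
        (triangularForm_one _ _ _ _ _ _)) (hlim 1)
  · refine eq_zero_of_tendsto_atBot (μ := -(α * β)) (y₁ := y₀)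
      (u := fun y => (leftForms ν ξ₀ α β γ).mulVec (X y) 2) (by simpa using (mul_pos hα hβ).le)
      (fun t ht => (hs.hasDerivAt_leftForms hα hβ hγ hX 2 ht).congr_deriv
        (triangularForm_two _ _ _ _ _ _)) (hlim 2)

/-- Conversely, these two conditions suffice when `Re γ > 0`. -/
theorem IsModelProfile.tendsto_atBot (hs : IsModelProfile ν y₀ ξ₀ θ s) {α β : ℝ} {γ : ℂ}
    (hα : 0 < α) (hβ : 0 < β) (hγ : 0 < γ.re) {X : ℝ → Fin 5 → ℂ}
    (hX : IsScaledMode ν s α β γ X) (h1 : (leftForms ν ξ₀ α β γ).mulVec (X y₀) 1 = 0)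
    (h2 : (leftForms ν ξ₀ α β γ).mulVec (X y₀) 2 = 0) (i : Fin 5) :
    Tendsto (fun y => X y i) atBot (𝓝 0) := by
  set S := leftForms ν ξ₀ α β γ with hS
  set U := triangularForm ν ξ₀ α β γ with hU
  set Z : Fin 5 → ℝ → ℂ := fun i y => S.mulVec (X y) i with hZdef
  have hξ := hs.xi_pos
  have hd : ∀ i y, y ≤ y₀ → HasDerivAt (Z i) (∑ j, U i j * Z j y) y := fun i y hy =>
    hs.hasDerivAt_leftForms hα hβ hγ.le hX i hy
  have hzero : ∀ (i : Fin 5) (μ : ℂ), (∀ y, y ≤ y₀ → HasDerivAt (Z i) (μ * Z i y) y) →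
      Z i y₀ = 0 → ∀ y, y ≤ y₀ → Z i y = 0 := by
    intro i μ hμ h0 y hy
    have := exp_mul_eq_of_hasDerivAt hμ hy
    rw [h0, mul_zero] at this
    exact (mul_eq_zero.1 this.symm).resolve_left (Complex.exp_ne_zero _)
  have z1 : ∀ y, y ≤ y₀ → Z 1 y = 0 := hzero 1 _ (fun y hy => (hd 1 y hy).congr_deriv
    (triangularForm_one _ _ _ _ _ _)) h1
  have z2 : ∀ y, y ≤ y₀ → Z 2 y = 0 := hzero 2 (-(α * β)) (fun y hy => (hd 2 y hy).congr_deriv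
    (triangularForm_two _ _ _ _ _ _)) h2
  have hp0 := lambdaPlus_re_pos (ν := ν) hξ hα hβ hγ.le
  have hp3 : 0 < α * γ.re * ξ₀ := by positivity
  have hp4 : 0 < α * β := by positivity
  obtain ⟨δ, hδ0, hδ⟩ : ∃ δ, 0 < δ ∧ δ < min (lambdaPlus ν ξ₀ α β γ).re (min (α * γ.re * ξ₀) (α * β)) :=
    exists_between (lt_min hp0 (lt_min hp3 hp4))
  rw [lt_min_iff, lt_min_iff] at hδ
  obtain ⟨d0, d3, d4⟩ := hδ
  have b0 : ∃ K, ∀ y, y ≤ y₀ → ‖Z 0 y‖ ≤ K * Real.exp (δ * y) :=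
    ⟨_, norm_le_of_lt_re (f := fun _ => 0) (K := 0) d0 (fun t ht => (hd 0 t ht).congr_deriv (by
      rw [Fin.sum_univ_five]
      simp [hU, triangularForm])) (fun t _ => by simp)⟩
  obtain ⟨K0, hK0⟩ := b0
  have b3 : ∃ K, ∀ y, y ≤ y₀ → ‖Z 3 y‖ ≤ K * Real.exp (δ * y) :=
    ⟨_, norm_le_of_lt_re (f := fun t => U 3 0 * Z 0 t) (K := ‖U 3 0‖ * K0) (μ := U 3 3)
      (by
        have : U 3 3 = ((α * ξ₀ : ℝ) : ℂ) * γ := by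
          simp [hU, triangularForm]
          ring
        rw [this, Complex.re_ofReal_mul]
        linarith)
      (fun t ht => (hd 3 t ht).congr_deriv (by
        rw [Fin.sum_univ_five, z1 t ht, z2 t ht]
        have : U 3 4 = 0 := by simp [hU, triangularForm]
        rw [this]
        ring)) (fun t ht => by
          rw [norm_mul, mul_assoc]
          gcongr
          exact hK0 t ht)⟩
  obtain ⟨K3, hK3⟩ := b3
  have b4 : ∃ K, ∀ y, y ≤ y₀ → ‖Z 4 y‖ ≤ K * Real.exp (δ * y) :=
    ⟨_, norm_le_of_lt_re (f := fun t => U 4 0 * Z 0 t + U 4 3 * Z 3 t)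
      (K := ‖U 4 0‖ * K0 + ‖U 4 3‖ * K3) (μ := U 4 4)
      (by
        have : U 4 4 = ((α * β : ℝ) : ℂ) := by simp [hU, triangularForm]
        rw [this, Complex.ofReal_re]
        exact d4)
      (fun t ht => (hd 4 t ht).congr_deriv (by
        rw [Fin.sum_univ_five, z1 t ht, z2 t ht]
        ring)) (fun t ht => by
          refine (norm_add_le _ _).trans ?_
          rw [norm_mul, norm_mul, add_mul, mul_assoc, mul_assoc]
          have := hK0 t ht
          have := hK3 t ht
          gcongr)⟩
  obtain ⟨K4, hK4⟩ := b4
  have hexp : ∀ K : ℝ, Tendsto (fun y => K * Real.exp (δ * y)) atBot (𝓝 0) := by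
    intro K
    have : Tendsto (fun y : ℝ => δ * y) atBot atBot := tendsto_id.const_mul_atBot hδ0
    simpa using (Real.tendsto_exp_atBot.comp this).const_mul K
  have hZ : ∀ i, Tendsto (Z i) atBot (𝓝 0) := by
    have ev := eventually_le_atBot y₀
    intro i
    fin_cases i
    · exact squeeze_zero_norm' (ev.mono hK0) (hexp K0)
    · exact (tendsto_congr' (ev.mono z1)).2 tendsto_const_nhds
    · exact (tendsto_congr' (ev.mono z2)).2 tendsto_const_nhds
    · exact squeeze_zero_norm' (ev.mono hK3) (hexp K3)
    · exact squeeze_zero_norm' (ev.mono hK4) (hexp K4)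
  have hSu : IsUnit S.det := isUnit_det_leftForms hξ hβ (beta_add_ne hξ hβ hγ.le)
    (lambdaPlus_sub_lambdaMinus_ne hξ hα.le hγ.le)
  have hX' : ∀ y, X y i = ∑ j, S⁻¹ i j * Z j y := by
    intro y
    have : S⁻¹.mulVec (S.mulVec (X y)) = X y := by
      rw [Matrix.mulVec_mulVec, Matrix.nonsing_inv_mul _ hSu, Matrix.one_mulVec]
    conv_lhs => rw [← this]
    rfl
  have : Tendsto (fun y => ∑ j, S⁻¹ i j * Z j y) atBot (𝓝 (∑ j, S⁻¹ i j * 0)) :=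
    tendsto_finsetSum _ fun j _ => (hZ j).const_mul _
  simp only [mul_zero, Finset.sum_const_zero] at this
  exact this.congr fun y => (hX' y).symm

end Left

/-- There is a nontrivial mode which tends to `0` at `±∞`. -/
def HasGrowingMode (ν : ℝ) (s : ℝ → ℝ) (α β : ℝ) (γ : ℂ) : Prop :=
  0 ≤ γ.re ∧ ∃ X, IsScaledMode ν s α β γ X ∧ X ≠ 0 ∧
    (∀ i, Tendsto (fun y => X y i) atBot (𝓝 0)) ∧ ∀ i, Tendsto (fun y => X y i) atTop (𝓝 0)

/-- The determinant which expresses that some combination of `φ` and `ψ` satisfies at `y₀` the two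
conditions for decay at `-∞`. -/
noncomputable def matching (ν y₀ ξ₀ β : ℝ) (φ ψ : ℝ → ℂ → ℝ → Fin 5 → ℂ) (α : ℝ) (γ : ℂ) : ℂ :=
  (leftForms ν ξ₀ α β γ).mulVec (φ α γ y₀) 1 * (leftForms ν ξ₀ α β γ).mulVec (ψ α γ y₀) 2
    - (leftForms ν ξ₀ α β γ).mulVec (ψ α γ y₀) 1 * (leftForms ν ξ₀ α β γ).mulVec (φ α γ y₀) 2

/-- The limit of `matching` for `α → 0`. -/
noncomputable def matchingLimit (ν ξ₀ β : ℝ) (γ : ℂ) : ℂ :=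
  -((ξ₀ ^ ν : ℝ) : ℂ) * (β / (ξ₀ * (β + γ * ξ₀))
    * (ξ₀ ^ 2 * (1 - ξ₀) - (1 + ξ₀) * (β + γ * ξ₀) ^ 2))

section Matching

variable {ν y₀ ξ₀ θ β : ℝ} {s : ℝ → ℝ} {φ ψ χ : ℝ → ℂ → ℝ → Fin 5 → ℂ} {γ₀ : ℂ} {v : Fin 5 → ℂ}

theorem leftForms_mulVec_one (ν s α β : ℝ) (γ : ℂ) (X : Fin 5 → ℂ) :
    (leftForms ν s α β γ).mulVec X 1 = -(1 / s) * X 0 + lambdaMinus ν s α β γ * X 3 + X 4 := by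
  simp [leftForms, Matrix.mulVec, dotProduct, Fin.sum_univ_five]

theorem leftForms_mulVec_two (ν s α β : ℝ) (γ : ℂ) (X : Fin 5 → ℂ) :
    (leftForms ν s α β γ).mulVec X 2 = -((s ^ 2 / (β + γ * s) - β) / s) * X 0 + β * X 1 + β * X 2
      + -(α * β * (s ^ 2 / (β + γ * s) + (β + γ * s))) * X 3
      + ((β + γ * s) + β + (s ^ 2 / (β + γ * s) - β)) * X 4 := by
  simp [leftForms, Matrix.mulVec, dotProduct, Fin.sum_univ_five]

theorem tendsto_leftForms_one (hξ : 0 < ξ₀)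
    (hχ : ∀ i, Tendsto (fun p : ℝ × ℂ => χ p.1 p.2 y₀ i) (smallAlpha γ₀) (𝓝 (v i))) :
    Tendsto (fun p : ℝ × ℂ => (leftForms ν ξ₀ p.1 β p.2).mulVec (χ p.1 p.2 y₀) 1) (smallAlpha γ₀)
      (𝓝 (-(1 / ξ₀) * v 0 + -((ξ₀ ^ ν : ℝ) : ℂ) * v 3 + v 4)) := by
  simp only [leftForms_mulVec_one]
  exact (((hχ 0).const_mul _).add ((tendsto_lambdaMinus hξ ν β γ₀).mul (hχ 3))).add (hχ 4)

theorem tendsto_leftForms_two (hτ : (β : ℂ) + γ₀ * ξ₀ ≠ 0)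
    (hχ : ∀ i, Tendsto (fun p : ℝ × ℂ => χ p.1 p.2 y₀ i) (smallAlpha γ₀) (𝓝 (v i))) :
    Tendsto (fun p : ℝ × ℂ => (leftForms ν ξ₀ p.1 β p.2).mulVec (χ p.1 p.2 y₀) 2) (smallAlpha γ₀)
      (𝓝 (-((ξ₀ ^ 2 / (β + γ₀ * ξ₀) - β) / ξ₀) * v 0 + β * v 1 + β * v 2
        + ((β + γ₀ * ξ₀) + β + (ξ₀ ^ 2 / (β + γ₀ * ξ₀) - β)) * v 4)) := by
  simp only [leftForms_mulVec_two]
  have h1 : Tendsto (fun p : ℝ × ℂ => (β : ℂ) + p.2 * ξ₀) (smallAlpha γ₀) (𝓝 (β + γ₀ * ξ₀)) :=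
    ((tendsto_gamma γ₀).mul_const _).const_add _
  have h2 : Tendsto (fun p : ℝ × ℂ => (ξ₀ : ℂ) ^ 2 / (β + p.2 * ξ₀)) (smallAlpha γ₀)
      (𝓝 (ξ₀ ^ 2 / (β + γ₀ * ξ₀))) := tendsto_const_nhds.div h1 hτ
  have h3 := (((tendsto_alpha γ₀).mul_const (β : ℂ)).mul (h2.add h1)).neg.mul (hχ 3)
  rw [zero_mul, zero_mul, neg_zero, zero_mul] at h3
  have h4 := (((((((h2.sub_const (β : ℂ)).div_const (ξ₀ : ℂ)).neg.mul (hχ 0)).add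
    ((hχ 1).const_mul (β : ℂ))).add ((hχ 2).const_mul (β : ℂ))).add h3).add
    (((h1.add_const (β : ℂ)).add (h2.sub_const (β : ℂ))).mul (hχ 4)))
  rw [add_zero] at h4
  exact h4

/-- The limits at `y₀` of `φ` and `ψ` are the thermal unit vector and `E_{a,-}(1)`, which gives
`matchingLimit`. -/
theorem IsDecayingBasis.tendsto_matching (h : IsDecayingBasis ν y₀ s β φ ψ γ₀) (hξ : 0 < ξ₀)
    (hβ : 0 < β) (hγ₀ : 0 ≤ γ₀.re) :
    Tendsto (fun p : ℝ × ℂ => matching ν y₀ ξ₀ β φ ψ p.1 p.2) (smallAlpha γ₀)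
      (𝓝 (matchingLimit ν ξ₀ β γ₀)) := by
  have hτ := beta_add_ne hξ hβ hγ₀
  have hξ' : (ξ₀ : ℂ) ≠ 0 := by exact_mod_cast hξ.ne'
  have h1 := tendsto_leftForms_one (ν := ν) (β := β) hξ h.fast_init
  have h2 := tendsto_leftForms_one (ν := ν) (β := β) hξ h.slow_init
  have h3 := tendsto_leftForms_two (ν := ν) hτ h.fast_init
  have h4 := tendsto_leftForms_two (ν := ν) hτ h.slow_init
  have h5 := (h1.mul h4).sub (h2.mul h3)
  unfold matching
  convert h5 using 2
  have hτ' : (β : ℂ) + ξ₀ * γ₀ ≠ 0 := by rwa [mul_comm (ξ₀ : ℂ)]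
  simp only [matchingLimit, EaMinus]
  generalize ((ξ₀ ^ ν : ℝ) : ℂ) = q
  simp
  field_simp
  exact Or.inl (by ring)

theorem differentiableAt_leftForms {α : ℝ} {γ : ℂ} (hτ : (β : ℂ) + γ * ξ₀ ≠ 0)
    (hl : DifferentiableAt ℂ (fun γ => lambdaMinus ν ξ₀ α β γ) γ)
    (hχ : ∀ i, DifferentiableAt ℂ (fun γ => χ α γ y₀ i) γ) :
    DifferentiableAt ℂ (fun γ => (leftForms ν ξ₀ α β γ).mulVec (χ α γ y₀) 1) γ ∧
      DifferentiableAt ℂ (fun γ => (leftForms ν ξ₀ α β γ).mulVec (χ α γ y₀) 2) γ := by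
  have h0 := hχ 0
  have h1 := hχ 1
  have h2 := hχ 2
  have h3 := hχ 3
  have h4 := hχ 4
  have hd : DifferentiableAt ℂ (fun γ : ℂ => (ξ₀ : ℂ) ^ 2 / (β + γ * ξ₀)) γ :=
    (differentiableAt_const _).div (by fun_prop) hτ
  constructor
  · simp only [leftForms_mulVec_one]
    fun_prop
  · simp only [leftForms_mulVec_two]
    have hq := (hd.sub_const (β : ℂ))
    exact (((((hq.div_const (ξ₀ : ℂ)).neg.mul h0).add (h1.const_mul _)).add (h2.const_mul _)).add
      ((((hd.add (by fun_prop)).const_mul ((α : ℂ) * β)).neg).mul h3)).add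
      ((((by fun_prop : DifferentiableAt ℂ (fun γ : ℂ => (β : ℂ) + γ * ξ₀ + β) γ)).add hq).mul h4)

theorem IsDecayingBasis.eventually_differentiableAt_matching
    (h : IsDecayingBasis ν y₀ s β φ ψ γ₀) (hξ : 0 < ξ₀) (hβ : 0 < β) (hγ₀ : 0 ≤ γ₀.re) :
    ∀ᶠ p in smallAlpha γ₀,
      DifferentiableAt ℂ (fun γ => matching ν y₀ ξ₀ β φ ψ p.1 γ) p.2 := by
  have h1 : Tendsto (fun p : ℝ × ℂ => (β : ℂ) + p.2 * ξ₀) (smallAlpha γ₀) (𝓝 (β + γ₀ * ξ₀)) :=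
    ((tendsto_gamma γ₀).mul_const _).const_add _
  filter_upwards [h.fast_diff, h.slow_diff, eventually_differentiableAt_lambdaMinus hξ ν β γ₀,
    h1.eventually_ne (beta_add_ne hξ hβ hγ₀)] with p hφ hψ hl hτ
  obtain ⟨a1, a2⟩ := differentiableAt_leftForms hτ hl hφ
  obtain ⟨b1, b2⟩ := differentiableAt_leftForms hτ hl hψ
  exact (a1.mul b2).sub (b1.mul a2)

/-- Decaying modes correspond to zeros of the determinant `matching`. (For `Re γ = 0` only one
implication holds: the vorticity mode does not decay at `-∞` then.) -/
theorem IsDecayingBasis.eventually_hasGrowingMode (h : IsDecayingBasis ν y₀ s β φ ψ γ₀)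
    (hs : IsModelProfile ν y₀ ξ₀ θ s) (hβ : 0 < β) :
    ∀ᶠ p in smallAlpha γ₀,
      (HasGrowingMode ν s p.1 β p.2 → matching ν y₀ ξ₀ β φ ψ p.1 p.2 = 0) ∧
      (0 < p.2.re → matching ν y₀ ξ₀ β φ ψ p.1 p.2 = 0 → HasGrowingMode ν s p.1 β p.2) := by
  have hξ := hs.xi_pos
  -- the slow combination does not vanish at `y₀`
  have hne : ∀ᶠ p in smallAlpha γ₀,
      (leftForms ν ξ₀ p.1 β p.2).mulVec (φ p.1 p.2 y₀) 1 * ψ p.1 p.2 y₀ 4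
        + -(leftForms ν ξ₀ p.1 β p.2).mulVec (ψ p.1 p.2 y₀) 1 * φ p.1 p.2 y₀ 4 ≠ 0 := by
    have h1 := tendsto_leftForms_one (ν := ν) (β := β) hξ h.fast_init
    have h2 := tendsto_leftForms_one (ν := ν) (β := β) hξ h.slow_init
    refine ((h1.mul (h.slow_init 4)).add (h2.neg.mul (h.fast_init 4))).eventually_ne ?_
    have h3 : (ξ₀ ^ ν : ℝ) ≠ 0 := (Real.rpow_pos_of_pos hξ ν).ne'
    have h4 : ((ξ₀ ^ ν : ℝ) : ℂ) ≠ 0 := by exact_mod_cast h3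
    simpa [EaMinus, hβ.ne'] using h4
  filter_upwards [h.fast_mode, h.slow_mode, h.fast_lim, h.slow_lim, h.classify, hne,
    eventually_alpha_pos γ₀] with p hφ hψ hφl hψl hc hne hα
  have hlin : ∀ (a b : ℂ) (i : Fin 5), (leftForms ν ξ₀ p.1 β p.2).mulVec
      (fun i => a * φ p.1 p.2 y₀ i + b * ψ p.1 p.2 y₀ i) i
      = a * (leftForms ν ξ₀ p.1 β p.2).mulVec (φ p.1 p.2 y₀) i
        + b * (leftForms ν ξ₀ p.1 β p.2).mulVec (ψ p.1 p.2 y₀) i := by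
    intro a b i
    have : (fun i => a * φ p.1 p.2 y₀ i + b * ψ p.1 p.2 y₀ i)
        = a • φ p.1 p.2 y₀ + b • ψ p.1 p.2 y₀ := rfl
    rw [this, Matrix.mulVec_add, Matrix.mulVec_smul, Matrix.mulVec_smul]
    rfl
  constructor
  · rintro ⟨hre, X, hX, hX0, hbot, htop⟩
    obtain ⟨c, k, hck⟩ := hc hre X hX htop
    have hXy : X y₀ = fun i => k * φ p.1 p.2 y₀ i + c * ψ p.1 p.2 y₀ i := by
      funext i
      rw [hck y₀ le_rfl i, add_comm]
    obtain ⟨e1, e2⟩ := hs.leftForms_eq_zero hα hβ hre hX hbot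
    rw [hXy, hlin] at e1 e2
    by_contra hD
    unfold matching at hD
    have hk : k = 0 := by
      refine (mul_eq_zero.1 (?_ : k * _ = 0)).resolve_right hD
      linear_combination (leftForms ν ξ₀ p.1 β p.2).mulVec (ψ p.1 p.2 y₀) 2 * e1
        - (leftForms ν ξ₀ p.1 β p.2).mulVec (ψ p.1 p.2 y₀) 1 * e2
    have hc0 : c = 0 := by
      refine (mul_eq_zero.1 (?_ : c * _ = 0)).resolve_right hD
      linear_combination (leftForms ν ξ₀ p.1 β p.2).mulVec (φ p.1 p.2 y₀) 1 * e2
        - (leftForms ν ξ₀ p.1 β p.2).mulVec (φ p.1 p.2 y₀) 2 * e1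
    have hXz : X y₀ = 0 := by
      rw [hXy, hk, hc0]
      funext i
      simp
    exact hX0 (funext fun y => hs.mode_eq_zero hX hXz y)
  · intro hre hD
    set a := (leftForms ν ξ₀ p.1 β p.2).mulVec (φ p.1 p.2 y₀) 1 with ha
    set b := (leftForms ν ξ₀ p.1 β p.2).mulVec (ψ p.1 p.2 y₀) 1 with hb
    set X : ℝ → Fin 5 → ℂ := fun y i => (-b) * φ p.1 p.2 y i + a * ψ p.1 p.2 y i with hXdef
    have hX : IsScaledMode ν s p.1 β p.2 X := hφ.add hψ (-b) a
    refine ⟨hre.le, X, hX, ?_, fun i => hs.tendsto_atBot hα hβ hre hX ?_ ?_ i, fun i => ?_⟩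
    · intro h0
      refine hne ?_
      have := congrFun (congrFun h0 y₀) 4
      simp only [hXdef, Pi.zero_apply] at this
      rw [← this]
      ring
    · rw [hXdef, hlin]
      ring
    · rw [hXdef, hlin, ← hD]
      unfold matching
      ring
    · have := ((hφl i).const_mul (-b)).add ((hψl i).const_mul a)
      rw [mul_zero, mul_zero, add_zero] at this
      exact this

end Matching

/-! ### Zeros of the matching determinant -/

/-- Uniformity on a compact set of `γ` of properties which hold locally uniformly. -/
theorem eventually_forall_of_isCompact {K : Set ℂ} (hK : IsCompact K) {l : Filter ℝ}
    {P : ℝ → ℂ → Prop} (h : ∀ γ₀ ∈ K, ∀ᶠ p in l ×ˢ 𝓝 γ₀, P p.1 p.2) :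
    ∀ᶠ α in l, ∀ γ ∈ K, P α γ := by
  have := hK.mem_prod_nhdsSet_of_forall (s := {p : ℝ × ℂ | P p.1 p.2}) h
  exact (Eventually.curry this).mono fun _ h => h.self_of_nhdsSet

/-- If holomorphic functions `f α` converge locally uniformly to a function with a simple zero
`z₀`, then eventually they have exactly one zero in a small disc around `z₀`. -/
theorem eventually_exists_unique_zero {l : Filter ℝ} {f : ℝ → ℂ → ℂ} {f₀ : ℂ → ℂ} {z₀ : ℂ}
    {R : ℝ} (hR : 0 < R)
    (hd : ∀ z ∈ Metric.closedBall z₀ R, ∀ᶠ p in l ×ˢ 𝓝 z, DifferentiableAt ℂ (f p.1) p.2)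
    (h₀ : ∀ z ∈ Metric.closedBall z₀ R, DifferentiableAt ℂ f₀ z)
    (hz0 : f₀ z₀ = 0) (hz' : deriv f₀ z₀ ≠ 0)
    (hlim : ∀ z ∈ Metric.closedBall z₀ R, Tendsto (fun p : ℝ × ℂ => f p.1 p.2) (l ×ˢ 𝓝 z)
      (𝓝 (f₀ z))) :
    ∃ ρ, 0 < ρ ∧ ρ ≤ R ∧ ∀ᶠ α in l, ∃ z ∈ Metric.closedBall z₀ ρ, f α z = 0 ∧
      ∀ z' ∈ Metric.closedBall z₀ ρ, f α z' = 0 → z' = z := by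
  set a := deriv f₀ z₀ with ha
  have ha0 : 0 < ‖a‖ := norm_pos_iff.2 hz'
  -- the radius
  have hdo : DifferentiableOn ℂ f₀ (Metric.ball z₀ R) := fun z hz =>
    (h₀ z (Metric.ball_subset_closedBall hz)).differentiableWithinAt
  have hcd : ContinuousAt (deriv f₀) z₀ :=
    ((hdo.deriv Metric.isOpen_ball).differentiableAt
      (Metric.isOpen_ball.mem_nhds (Metric.mem_ball_self hR))).continuousAt
  obtain ⟨r, hr0, hr⟩ := Metric.continuousAt_iff.1 hcd (‖a‖ / 4) (by positivity)
  set ρ := min (R / 2) (r / 2) with hρ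
  have hρ0 : 0 < ρ := by positivity
  have hρR : 2 * ρ ≤ R := by
    have := min_le_left (R / 2) (r / 2)
    linarith
  have hρr : ρ < r := by
    have := min_le_right (R / 2) (r / 2)
    linarith
  refine ⟨ρ, hρ0, by linarith, ?_⟩
  set η := ρ * ‖a‖ / 4 with hη
  have hη0 : 0 < η := by positivity
  have hsub : Metric.closedBall z₀ (2 * ρ) ⊆ Metric.closedBall z₀ R :=
    Metric.closedBall_subset_closedBall hρR
  have e1 : ∀ᶠ α in l, ∀ z ∈ Metric.closedBall z₀ (2 * ρ), ‖f α z - f₀ z‖ < η := by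
    refine eventually_forall_of_isCompact (P := fun α z => ‖f α z - f₀ z‖ < η)
      (isCompact_closedBall z₀ (2 * ρ)) fun z hz => ?_
    have h1 : Tendsto (fun p : ℝ × ℂ => f₀ p.2) (l ×ˢ 𝓝 z) (𝓝 (f₀ z)) :=
      (h₀ z (hsub hz)).continuousAt.tendsto.comp tendsto_snd
    have h2 := ((hlim z (hsub hz)).sub h1).norm
    rw [sub_self, norm_zero] at h2
    exact h2.eventually (gt_mem_nhds hη0)
  have e2 : ∀ᶠ α in l, ∀ z ∈ Metric.closedBall z₀ (2 * ρ), DifferentiableAt ℂ (f α) z :=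
    eventually_forall_of_isCompact (P := fun α z => DifferentiableAt ℂ (f α) z)
      (isCompact_closedBall z₀ (2 * ρ)) fun z hz => hd z (hsub hz)
  filter_upwards [e1, e2] with α h1 h2
  -- the Newton map with frozen derivative contracts the disc
  set N : ℂ → ℂ := fun z => z - f α z / a with hN
  have hNd : ∀ z ∈ Metric.closedBall z₀ ρ, HasDerivAt N (1 - deriv (f α) z / a) z ∧
      ‖1 - deriv (f α) z / a‖ ≤ 1 / 2 := by
    intro z hz
    have hz2 : Metric.closedBall z ρ ⊆ Metric.closedBall z₀ (2 * ρ) := by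
      intro w hw
      rw [Metric.mem_closedBall] at *
      linarith [dist_triangle w z z₀]
    have hzz := hz2 (Metric.mem_closedBall_self hρ0.le)
    refine ⟨(hasDerivAt_id z).sub ((h2 z hzz).hasDerivAt.div_const a), ?_⟩
    have hg : ‖deriv (fun w => f α w - f₀ w) z‖ ≤ η / ρ := by
      refine Complex.norm_deriv_le_of_forall_mem_sphere_norm_le hρ0 ?_ ?_
      · refine DifferentiableOn.diffContOnCl fun w hw => ?_
        rw [closure_ball _ hρ0.ne'] at hw
        exact ((h2 w (hz2 hw)).sub (h₀ w (hsub (hz2 hw)))).differentiableWithinAt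
      · intro w hw
        exact (h1 w (hz2 (Metric.sphere_subset_closedBall hw))).le
    have hg' : deriv (fun w => f α w - f₀ w) z = deriv (f α) z - deriv f₀ z :=
      deriv_fun_sub (h2 z hzz) (h₀ z (hsub hzz))
    have hf₀ : ‖deriv f₀ z - a‖ ≤ ‖a‖ / 4 := by
      have := hr (x := z) ((Metric.mem_closedBall.1 hz).trans_lt hρr)
      rw [dist_eq_norm] at this
      exact this.le
    have e : 1 - deriv (f α) z / a
        = -((deriv (fun w => f α w - f₀ w) z + (deriv f₀ z - a)) / a) := by
      rw [hg']
      field_simp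
      ring
    rw [e, norm_neg, norm_div, div_le_iff₀ ha0]
    have hηρ : η / ρ = ‖a‖ / 4 := by
      rw [hη]
      field_simp
    calc _ ≤ η / ρ + ‖a‖ / 4 := (norm_add_le _ _).trans (add_le_add hg hf₀)
      _ = 1 / 2 * ‖a‖ := by
        rw [hηρ]
        ring
  have hcontr : ∀ z ∈ Metric.closedBall z₀ ρ, ∀ w ∈ Metric.closedBall z₀ ρ,
      ‖N w - N z‖ ≤ 1 / 2 * ‖w - z‖ := fun z hz w hw =>
    (convex_closedBall z₀ ρ).norm_image_sub_le_of_norm_hasDerivWithin_le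
      (fun x hx => (hNd x hx).1.hasDerivWithinAt) (fun x hx => (hNd x hx).2) hz hw
  have hz₀ : z₀ ∈ Metric.closedBall z₀ ρ := Metric.mem_closedBall_self hρ0.le
  have hmaps : Set.MapsTo N (Metric.closedBall z₀ ρ) (Metric.closedBall z₀ ρ) := by
    intro z hz
    have h3 := hcontr z₀ hz₀ z hz
    have h4 : ‖N z₀ - z₀‖ ≤ ρ / 4 := by
      have h5 := (h1 z₀ (Metric.mem_closedBall_self (by positivity))).le
      rw [hz0, sub_zero] at h5
      have : N z₀ - z₀ = -(f α z₀ / a) := by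
        simp only [hN]
        ring
      rw [this, norm_neg, norm_div, div_le_iff₀ ha0]
      calc _ ≤ η := h5
        _ = _ := by
          rw [hη]
          ring
    rw [Metric.mem_closedBall, dist_eq_norm] at *
    have h6 : N z - z₀ = (N z - N z₀) + (N z₀ - z₀) := by ring
    rw [h6]
    refine (norm_add_le _ _).trans ?_
    linarith
  have hcw : ContractingWith (1 / 2) (hmaps.restrict N _ _) := by
    refine ⟨by norm_num, LipschitzWith.of_dist_le_mul fun x y => ?_⟩
    have := hcontr y y.2 x x.2
    rw [Subtype.dist_eq, Subtype.dist_eq, dist_eq_norm, dist_eq_norm]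
    simpa using this
  obtain ⟨z, hzm, hfix, -⟩ := hcw.exists_fixedPoint' Metric.isClosed_closedBall.isComplete hmaps hz₀
    (edist_ne_top _ _)
  have hiff : ∀ w, N w = w ↔ f α w = 0 := by
    intro w
    simp only [hN]
    rw [sub_eq_self, div_eq_zero_iff]
    exact or_iff_left hz'
  refine ⟨z, hzm, (hiff z).1 hfix, fun w hw hw0 => ?_⟩
  have h7 := hcontr z hzm w hw
  rw [(hiff w).2 hw0, hfix] at h7
  have h8 := norm_nonneg (w - z)
  exact sub_eq_zero.1 (norm_le_zero_iff.1 (by linarith))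

/-- The other root, where `β + γ ξ₀` is negative, is excluded by `Re γ ≥ 0`. -/
theorem matchingLimit_eq_zero {ν ξ₀ β : ℝ} (hξ : 0 < ξ₀) (hξ1 : ξ₀ < 1) (hβ : 0 < β) {γ : ℂ}
    (hγ : 0 ≤ γ.re) (h : matchingLimit ν ξ₀ β γ = 0) :
    γ = ((Real.sqrt ((1 - ξ₀) / (1 + ξ₀)) - β / ξ₀ : ℝ) : ℂ) := by
  have hξ' : (ξ₀ : ℂ) ≠ 0 := by exact_mod_cast hξ.ne'
  have hβ' : (β : ℂ) ≠ 0 := by exact_mod_cast hβ.ne'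
  have hτ := beta_add_ne hξ hβ hγ
  have hp : ((ξ₀ ^ ν : ℝ) : ℂ) ≠ 0 := by exact_mod_cast (Real.rpow_pos_of_pos hξ ν).ne'
  unfold matchingLimit at h
  have h1 := (mul_eq_zero.1 ((mul_eq_zero.1 h).resolve_left (neg_ne_zero.2 hp))).resolve_left
    (div_ne_zero hβ' (mul_ne_zero hξ' hτ))
  set q := Real.sqrt ((1 - ξ₀) / (1 + ξ₀)) with hq
  have hq0 : 0 ≤ q := Real.sqrt_nonneg _
  have hq2 : q ^ 2 * (1 + ξ₀) = 1 - ξ₀ := by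
    rw [hq, Real.sq_sqrt (div_nonneg (by linarith) (by linarith))]
    field_simp
  have hq2' : (q : ℂ) ^ 2 * (1 + ξ₀) = 1 - ξ₀ := by exact_mod_cast hq2
  have hne : (1 + ξ₀ : ℂ) ≠ 0 := by
    exact_mod_cast (by linarith : (1 + ξ₀ : ℝ) ≠ 0)
  have h2 : (β + γ * ξ₀ - ξ₀ * q) * (β + γ * ξ₀ + ξ₀ * q) = 0 := by
    refine (mul_eq_zero.1 (?_ : (1 + ξ₀ : ℂ) * _ = 0)).resolve_left hne
    linear_combination -h1 - (ξ₀ : ℂ) ^ 2 * hq2'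
  have h3 : (β + γ * ξ₀ + ξ₀ * q : ℂ) ≠ 0 := by
    intro h0
    have := congrArg Complex.re h0
    simp at this
    nlinarith [mul_nonneg hγ hξ.le, mul_nonneg hξ.le hq0]
  have h4 := (mul_eq_zero.1 h2).resolve_right h3
  push_cast
  field_simp
  linear_combination h4

/-- For `γ` real and positive this derivative is positive: the zero of `matchingLimit` is simple. -/
theorem hasDerivAt_matchingLimit {ν ξ₀ β : ℝ} (hξ : 0 < ξ₀) {γ : ℂ}
    (hτ : (β : ℂ) + γ * ξ₀ ≠ 0) :
    HasDerivAt (matchingLimit ν ξ₀ β) (((ξ₀ ^ ν : ℝ) : ℂ) * β *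
      (ξ₀ ^ 2 * (1 - ξ₀) / (β + γ * ξ₀) ^ 2 + (1 + ξ₀))) γ := by
  have hξ' : (ξ₀ : ℂ) ≠ 0 := by exact_mod_cast hξ.ne'
  have h1 : HasDerivAt (fun γ : ℂ => (β : ℂ) + γ * ξ₀) ξ₀ γ := by
    simpa using ((hasDerivAt_id γ).mul_const (ξ₀ : ℂ)).const_add (β : ℂ)
  have h2 := ((((hasDerivAt_const γ (β : ℂ)).fun_div (h1.const_mul (ξ₀ : ℂ))
    (mul_ne_zero hξ' hτ)).fun_mul (((h1.fun_pow 2).const_mul (1 + ξ₀ : ℂ)).const_sub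
      ((ξ₀ : ℂ) ^ 2 * (1 - ξ₀)))).const_mul (-((ξ₀ ^ ν : ℝ) : ℂ)))
  refine h2.congr_deriv ?_
  generalize ((ξ₀ ^ ν : ℝ) : ℂ) = q
  generalize (β : ℂ) + γ * ξ₀ = τ at hτ
  simp
  field_simp
  ring

theorem matchingLimit_root {ν ξ₀ β : ℝ} (hξ : 0 < ξ₀) (hξ1 : ξ₀ < 1) :
    matchingLimit ν ξ₀ β ((Real.sqrt ((1 - ξ₀) / (1 + ξ₀)) - β / ξ₀ : ℝ) : ℂ) = 0 := by
  have hξ' : (ξ₀ : ℂ) ≠ 0 := by exact_mod_cast hξ.ne'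
  set q := Real.sqrt ((1 - ξ₀) / (1 + ξ₀)) with hq
  have hq2 : q ^ 2 * (1 + ξ₀) = 1 - ξ₀ := by
    rw [hq, Real.sq_sqrt (div_nonneg (by linarith) (by linarith))]
    field_simp
  have hq2' : (q : ℂ) ^ 2 * (1 + ξ₀) = 1 - ξ₀ := by exact_mod_cast hq2
  have h1 : (β : ℂ) + ((q - β / ξ₀ : ℝ) : ℂ) * ξ₀ = ξ₀ * q := by
    push_cast
    field_simp
    ring
  unfold matchingLimit
  rw [h1]
  have h2 : (ξ₀ : ℂ) ^ 2 * (1 - ξ₀) - (1 + ξ₀) * (ξ₀ * q) ^ 2 = 0 := by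
    linear_combination -(ξ₀ : ℂ) ^ 2 * hq2'
  rw [h2, mul_zero, mul_zero]

theorem M0_conj (ν s α β : ℝ) (γ : ℂ) (i j : Fin 5) :
    M0 ν s α β (starRingEnd ℂ γ) i j = starRingEnd ℂ (M0 ν s α β γ i j) := by
  fin_cases i <;> fin_cases j <;> simp [M0, Complex.conj_ofNat]

/-- The coefficients of `M₀` are real polynomials in `γ`, so that growth rates come in conjugate
pairs. -/
theorem HasGrowingMode.conj {ν : ℝ} {s : ℝ → ℝ} {α β : ℝ} {γ : ℂ}
    (h : HasGrowingMode ν s α β γ) : HasGrowingMode ν s α β (starRingEnd ℂ γ) := by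
  obtain ⟨hre, X, hX, h0, hbot, htop⟩ := h
  have hlim : ∀ {l : Filter ℝ} (i : Fin 5), Tendsto (fun y => X y i) l (𝓝 0) →
      Tendsto (fun y => starRingEnd ℂ (X y i)) l (𝓝 0) := by
    intro l i hl
    have := (Complex.continuous_conj.tendsto 0).comp hl
    rw [map_zero] at this
    exact this
  refine ⟨by simpa using hre, fun y i => starRingEnd ℂ (X y i), fun y i => ?_, fun h => h0 ?_,
    fun i => hlim i (hbot i), fun i => hlim i (htop i)⟩
  · have := (hX y i).star_conj
    refine this.congr_deriv ?_
    simp [M0_conj]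
  · funext y i
    have := congrFun (congrFun h y) i
    simpa using this

section Zeros

variable {ν y₀ ξ₀ θ β : ℝ} {s : ℝ → ℝ}

/-- For small `α`, all the growth rates in a disc are close to the zero of the limit. -/
theorem IsModelProfile.eventually_growing_mode_close (hs : IsModelProfile ν y₀ ξ₀ θ s)
    (hξ1 : ξ₀ < 1) (hβ : 0 < β) (M : ℝ) {ε : ℝ} (hε : 0 < ε) :
    ∀ᶠ α in 𝓝[>] (0 : ℝ), ∀ γ : ℂ, ‖γ‖ ≤ M → HasGrowingMode ν s α β γ →
      ‖γ - ((Real.sqrt ((1 - ξ₀) / (1 + ξ₀)) - β / ξ₀ : ℝ) : ℂ)‖ < ε := by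
  set g : ℂ := ((Real.sqrt ((1 - ξ₀) / (1 + ξ₀)) - β / ξ₀ : ℝ) : ℂ) with hg
  obtain ⟨φ, ψ, hb⟩ := hs.exists_isDecayingBasis hβ
  set K : Set ℂ := Metric.closedBall 0 M ∩ ({γ | 0 ≤ γ.re} ∩ {γ | ε ≤ ‖γ - g‖}) with hK
  have hKc : IsCompact K := (isCompact_closedBall 0 M).inter_right
    ((isClosed_le continuous_const Complex.continuous_re).inter
      (isClosed_le continuous_const (by fun_prop)))
  have h1 : ∀ᶠ α in 𝓝[>] (0 : ℝ), ∀ γ ∈ K, ¬ HasGrowingMode ν s α β γ := by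
    refine eventually_forall_of_isCompact (P := fun α γ => ¬ HasGrowingMode ν s α β γ) hKc
      fun γ₀ hγ₀ => ?_
    have h2 : matchingLimit ν ξ₀ β γ₀ ≠ 0 := by
      intro h0
      have h3 := matchingLimit_eq_zero hs.xi_pos hξ1 hβ hγ₀.2.1 h0
      have h4 : ε ≤ ‖γ₀ - g‖ := hγ₀.2.2
      rw [h3, sub_self, norm_zero] at h4
      linarith
    have h5 := ((hb γ₀).tendsto_matching hs.xi_pos hβ hγ₀.2.1).eventually_ne h2
    have h6 := (hb γ₀).eventually_hasGrowingMode hs hβ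
    filter_upwards [h5, h6] with p hp hp'
    exact fun h => hp (hp'.1 h)
  filter_upwards [h1] with α hα γ hγ hm
  by_contra hcon
  exact hα γ ⟨by simpa using hγ, hm.1, not_lt.1 hcon⟩ hm

/-- If the zero of the limit is positive then, for small `α`, there is exactly one growth rate in a
disc which contains it, and this growth rate is real. -/
theorem IsModelProfile.eventually_exists_unique_growing_mode (hs : IsModelProfile ν y₀ ξ₀ θ s)
    (hξ1 : ξ₀ < 1) (hβ : 0 < β) {g M ε : ℝ}
    (hg : g = Real.sqrt ((1 - ξ₀) / (1 + ξ₀)) - β / ξ₀) (hg0 : 0 < g) (hM : g < M) (hε : 0 < ε) :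
    ∀ᶠ α in 𝓝[>] (0 : ℝ), ∃ γ : ℝ, |γ| ≤ M ∧ |γ - g| < ε ∧ HasGrowingMode ν s α β γ ∧
      ∀ γ' : ℂ, ‖γ'‖ ≤ M → HasGrowingMode ν s α β γ' → γ' = γ := by
  have hξ := hs.xi_pos
  obtain ⟨φ, ψ, hb⟩ := hs.exists_isDecayingBasis hβ
  set R : ℝ := min (ε / 2) (min (g / 2) (M - g)) with hR
  have hR0 : 0 < R := lt_min (by linarith) (lt_min (by linarith) (by linarith))
  have hRε : R < ε := (min_le_left _ _).trans_lt (by linarith)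
  have hRg : R < g := ((min_le_right _ _).trans (min_le_left _ _)).trans_lt (by linarith)
  have hRM : R ≤ M - g := (min_le_right _ _).trans (min_le_right _ _)
  have hre : ∀ γ ∈ Metric.closedBall (g : ℂ) R, 0 < γ.re := by
    intro γ hγ
    rw [Metric.mem_closedBall, dist_eq_norm] at hγ
    have h1 := (Complex.abs_re_le_norm (γ - g)).trans hγ
    rw [Complex.sub_re, Complex.ofReal_re] at h1
    have := (abs_le.1 h1).1
    linarith
  have hderiv : deriv (matchingLimit ν ξ₀ β) (g : ℂ) ≠ 0 := by
    have hgg : (0 : ℝ) ≤ (g : ℂ).re := by simpa using hg0.le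
    rw [(hasDerivAt_matchingLimit hξ (beta_add_ne hξ hβ hgg)).deriv]
    have h1 : 0 < ξ₀ ^ ν * β * (ξ₀ ^ 2 * (1 - ξ₀) / (β + g * ξ₀) ^ 2 + (1 + ξ₀)) := by
      have : 0 < 1 - ξ₀ := by linarith
      have := Real.rpow_pos_of_pos hξ ν
      positivity
    exact_mod_cast h1.ne'
  obtain ⟨ρ, hρ0, hρR, hρ⟩ := eventually_exists_unique_zero (l := 𝓝[>] (0 : ℝ))
    (f := matching ν y₀ ξ₀ β φ ψ) (f₀ := matchingLimit ν ξ₀ β) (z₀ := (g : ℂ)) hR0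
    (fun z hz => (hb z).eventually_differentiableAt_matching hξ hβ (hre z hz).le)
    (fun z hz => (hasDerivAt_matchingLimit hξ
      (beta_add_ne hξ hβ (hre z hz).le)).differentiableAt)
    (by
      rw [hg]
      exact matchingLimit_root hξ hξ1) hderiv
    (fun z hz => (hb z).tendsto_matching hξ hβ (hre z hz).le)
  have hiff : ∀ᶠ α in 𝓝[>] (0 : ℝ), ∀ γ ∈ Metric.closedBall (g : ℂ) R,
      (HasGrowingMode ν s α β γ → matching ν y₀ ξ₀ β φ ψ α γ = 0) ∧
      (0 < γ.re → matching ν y₀ ξ₀ β φ ψ α γ = 0 → HasGrowingMode ν s α β γ) :=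
    eventually_forall_of_isCompact
      (P := fun α γ => (HasGrowingMode ν s α β γ → matching ν y₀ ξ₀ β φ ψ α γ = 0) ∧
        (0 < γ.re → matching ν y₀ ξ₀ β φ ψ α γ = 0 → HasGrowingMode ν s α β γ))
      (isCompact_closedBall _ _) fun γ₀ _ => (hb γ₀).eventually_hasGrowingMode hs hβ
  have hclose := hs.eventually_growing_mode_close hξ1 hβ M hρ0
  rw [← hg] at hclose
  filter_upwards [hρ, hiff, hclose] with α ⟨z, hz, hz0, hzu⟩ hiff hclose
  have hsub : Metric.closedBall (g : ℂ) ρ ⊆ Metric.closedBall (g : ℂ) R :=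
    Metric.closedBall_subset_closedBall hρR
  have hzm : HasGrowingMode ν s α β z := (hiff z (hsub hz)).2 (hre z (hsub hz)) hz0
  have huniq : ∀ γ' : ℂ, ‖γ'‖ ≤ M → HasGrowingMode ν s α β γ' → γ' = z := by
    intro γ' h1 h2
    have h3 : γ' ∈ Metric.closedBall (g : ℂ) ρ := by
      rw [Metric.mem_closedBall, dist_eq_norm]
      exact (hclose γ' h1 h2).le
    exact hzu γ' h3 ((hiff γ' (hsub h3)).1 h2)
  have hzR : ‖z - g‖ ≤ R := by
    have := hsub hz
    rwa [Metric.mem_closedBall, dist_eq_norm] at this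
  have hzM : ‖z‖ ≤ M := by
    have h1 : z = (z - g) + g := by ring
    rw [h1]
    refine (norm_add_le _ _).trans ?_
    rw [Complex.norm_real, Real.norm_of_nonneg hg0.le]
    linarith
  -- the mode is real because its conjugate is another one
  have hconj : starRingEnd ℂ z = z := huniq _ (by simpa using hzM) hzm.conj
  obtain ⟨x, rfl⟩ := Complex.conj_eq_iff_real.1 hconj
  refine ⟨x, ?_, ?_, hzm, huniq⟩
  · simpa using hzM
  · rw [← Complex.ofReal_sub, Complex.norm_real, Real.norm_eq_abs] at hzR
    exact hzR.trans_lt hRε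

end Zeros

/-! ### Physical and scaled unknowns -/

namespace Params

theorem alpha_pos (P : Params) : 0 < P.alpha := by
  have := P.k_pos
  have := P.L0_pos
  have := P.Va_pos
  have := P.g_pos
  unfold alpha eps Fr
  positivity

theorem beta_pos (P : Params) : 0 < P.beta := by
  have := P.k_pos
  have := P.L0_pos
  have := P.Va_pos
  have := P.g_pos
  unfold beta eps Fr
  positivity

theorem alpha_mul_Va (P : Params) : P.alpha * P.Va = Real.sqrt (P.g * P.k) * P.L0 := by
  have := P.k_pos
  have := P.L0_pos
  have := P.Va_pos
  have := P.g_pos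
  have h : P.eps / P.Fr = P.g * P.k * (P.L0 / P.Va) ^ 2 := by
    unfold eps Fr
    field_simp
  rw [alpha, h, Real.sqrt_mul (by positivity), Real.sqrt_sq (by positivity)]
  field_simp

theorem alpha_mul_beta (P : Params) : P.alpha * P.beta = P.k * P.L0 := by
  have := P.k_pos
  have := P.L0_pos
  have := P.Va_pos
  have := P.g_pos
  rw [alpha, beta, ← Real.sqrt_mul (by unfold eps Fr; positivity)]
  have h : P.eps / P.Fr * (P.eps * P.Fr) = (P.k * P.L0) ^ 2 := by
    unfold eps Fr
    field_simp
  rw [h, Real.sqrt_sq (by positivity)]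

theorem beta_mul_sqrt (P : Params) : P.beta * Real.sqrt (P.g * P.k) = P.k * P.Va := by
  have h1 := P.alpha_mul_Va
  have h2 := P.alpha_mul_beta
  have := P.L0_pos
  have h3 : P.L0 * (P.beta * Real.sqrt (P.g * P.k)) = P.L0 * (P.k * P.Va) := by
    linear_combination -P.beta * h1 + P.Va * h2
  exact mul_left_cancel₀ this.ne' h3

theorem alpha_mul_Va_sq (P : Params) : P.alpha * P.Va ^ 2 = P.g * P.L0 * P.beta := by
  have h1 := P.alpha_mul_Va
  have h2 := P.beta_mul_sqrt
  have h3 : Real.sqrt (P.g * P.k) ^ 2 = P.g * P.k :=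
    Real.sq_sqrt (mul_pos P.g_pos P.k_pos).le
  have h4 : P.k * (P.alpha * P.Va ^ 2) = P.k * (P.g * P.L0 * P.beta) := by
    linear_combination P.k * P.Va * h1 - P.L0 * Real.sqrt (P.g * P.k) * h2
      + P.L0 * P.beta * h3
  exact mul_left_cancel₀ P.k_pos.ne' h4

end Params

theorem deriv_Zfun (P : Params) {ν : ℝ} (hν : 1 < ν) {t : ℝ} (ht : 0 < t) :
    deriv (Zfun P ν) (P.rhoA * t) = -(1 / (P.rhoA * (t ^ ν * t ^ 2))) := by
  have hρ := P.rhoA_pos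
  have hpos : 0 < P.rhoA * t := mul_pos hρ ht
  have h1 : HasDerivAt (fun x : ℝ => x ^ (ν + 1)) ((ν + 1) * (P.rhoA * t) ^ (ν + 1 - 1))
      (P.rhoA * t) := Real.hasDerivAt_rpow_const (Or.inl hpos.ne')
  have hne : (ν + 1) * (P.rhoA * t) ^ (ν + 1) ≠ 0 := by
    have : 0 < ν + 1 := by linarith
    positivity
  have h2 : HasDerivAt (Zfun P ν) _ (P.rhoA * t) :=
    (hasDerivAt_const (P.rhoA * t) (P.rhoA ^ (ν + 1))).fun_div (h1.const_mul (ν + 1)) hne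
  rw [h2.deriv]
  have e1 : P.rhoA ^ (ν + 1) = P.rhoA ^ ν * P.rhoA := Real.rpow_add_one hρ.ne' _
  have e2 : (P.rhoA * t) ^ (ν + 1) = P.rhoA ^ ν * t ^ ν * (P.rhoA * t) := by
    rw [Real.rpow_add_one hpos.ne', Real.mul_rpow hρ.le ht.le]
  have e3 : (P.rhoA * t) ^ (ν + 1 - 1) = P.rhoA ^ ν * t ^ ν := by
    rw [add_sub_cancel_right, Real.mul_rpow hρ.le ht.le]
  rw [e1, e2, e3]
  have p1 := Real.rpow_pos_of_pos hρ ν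
  have p2 := Real.rpow_pos_of_pos ht ν
  have p3 : 0 < ν + 1 := by linarith
  field_simp
  ring

section Reduction

variable {P : Params} {ν : ℝ} {ξ : ℝ → ℝ} {y₀ : ℝ}

theorem zPert_eq (P : Params) (hν : 1 < ν) {x : ℝ} (hs : 0 < modelProfile ξ y₀ (x / P.L0))
    (r : ℝ → ℂ) :
    zPert P ν ξ y₀ r x = -(r x / (P.rhoA * (((modelProfile ξ y₀ (x / P.L0) ^ ν : ℝ) : ℂ)
      * (modelProfile ξ y₀ (x / P.L0) : ℂ) ^ 2))) := by
  unfold zPert rhoStar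
  rw [deriv_Zfun P hν hs]
  push_cast
  ring

/-- The scaled unknowns of a normal mode. -/
noncomputable def scaledUnknowns (P : Params) (ν : ℝ) (ξ : ℝ → ℝ) (y₀ : ℝ) (r u v p : ℝ → ℂ)
    (y : ℝ) : Fin 5 → ℂ :=
  ![massFlux P ξ y₀ r u (P.L0 * y) / (P.rhoA * P.Va),
    momentumFlux P ξ y₀ r u p (P.L0 * y) / (P.rhoA * P.Va ^ 2),
    -(Complex.I * shearFlux P ξ y₀ v (P.L0 * y)) / (P.rhoA * P.Va ^ 2),
    -zPert P ν ξ y₀ r (P.L0 * y),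
    thermalFlux P ν ξ y₀ r u (P.L0 * y) / P.Va]

theorem hasDerivAt_comp_const_mul {f : ℝ → ℂ} {f' : ℂ} {c y : ℝ} (h : HasDerivAt f f' (c * y)) :
    HasDerivAt (fun t => f (c * t)) (c * f') y := by
  have h2 : HasDerivAt (fun t : ℝ => c * t) c y := by
    simpa using (hasDerivAt_id y).const_mul c
  simpa [Function.comp_def] using h.scomp y h2

/-- The normal mode equations in scaled unknowns. -/
theorem IsNormalMode.isScaledMode (hν : 1 < ν) (hs : ∀ y, 0 < modelProfile ξ y₀ y) {γ : ℂ}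
    {r u v p : ℝ → ℂ} (h : IsNormalMode P ν ξ y₀ (γ * Real.sqrt (P.g * P.k)) r u v p) :
    IsScaledMode ν (modelProfile ξ y₀) P.alpha P.beta γ (scaledUnknowns P ν ξ y₀ r u v p) := by
  intro y i
  have hL := P.L0_pos
  have hρ' : (P.rhoA : ℂ) ≠ 0 := by exact_mod_cast P.rhoA_pos.ne'
  have hV' : (P.Va : ℂ) ≠ 0 := by exact_mod_cast P.Va_pos.ne'
  have hL' : (P.L0 : ℂ) ≠ 0 := by exact_mod_cast hL.ne'
  have hβ' : (P.beta : ℂ) ≠ 0 := by exact_mod_cast P.beta_pos.ne'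
  have hx : P.L0 * y / P.L0 = y := by field_simp
  have hs0 := hs y
  have hs' : (modelProfile ξ y₀ y : ℂ) ≠ 0 := by exact_mod_cast hs0.ne'
  have hq' : ((modelProfile ξ y₀ y ^ ν : ℝ) : ℂ) ≠ 0 := by
    exact_mod_cast (Real.rpow_pos_of_pos hs0 ν).ne'
  have c1 : (P.alpha : ℂ) * P.Va = Real.sqrt (P.g * P.k) * P.L0 := by
    exact_mod_cast P.alpha_mul_Va
  have c2 : (P.alpha : ℂ) * P.beta = P.k * P.L0 := by exact_mod_cast P.alpha_mul_beta
  have c3 : (P.alpha : ℂ) * P.Va ^ 2 = P.g * P.L0 * P.beta := by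
    exact_mod_cast P.alpha_mul_Va_sq
  have hI : Complex.I ^ 2 = -1 := Complex.I_sq
  have hz := zPert_eq (ξ := ξ) (y₀ := y₀) P hν (x := P.L0 * y) (by rw [hx]; exact hs0) r
  have dm := hasDerivAt_comp_const_mul (h.mass (P.L0 * y))
  have dx := hasDerivAt_comp_const_mul (h.momentum_x (P.L0 * y))
  have dz := hasDerivAt_comp_const_mul (h.momentum_z (P.L0 * y))
  have dd := hasDerivAt_comp_const_mul (h.z_diff (P.L0 * y)).hasDerivAt
  have de := hasDerivAt_comp_const_mul (h.energy (P.L0 * y))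
  have k0 : (P.k : ℂ) = P.alpha * P.beta / P.L0 := by
    rw [eq_div_iff hL', c2]
  have k1 : (Real.sqrt (P.g * P.k) : ℂ) = P.alpha * P.Va / P.L0 := by
    rw [eq_div_iff hL', c1]
  have k2 : (P.g : ℂ) = P.alpha * P.Va ^ 2 / (P.L0 * P.beta) := by
    rw [eq_div_iff (mul_ne_zero hL' hβ'), c3]
    ring
  rw [Fin.sum_univ_five]
  simp only [massFlux, momentumFlux, shearFlux, thermalFlux, rhoStar, uStar, hx] at dm dx dz dd de
  fin_cases i
  · refine (dm.div_const (P.rhoA * P.Va : ℂ)).congr_deriv ?_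
    simp [M0, scaledUnknowns, massFlux, shearFlux, rhoStar, uStar, hx, hz, k0, k1]
    field_simp
    ring
  · refine (dx.div_const (P.rhoA * P.Va ^ 2 : ℂ)).congr_deriv ?_
    simp [M0, scaledUnknowns, massFlux, shearFlux, rhoStar, uStar, hx, hz, k0, k1, k2]
    field_simp
    ring
  · refine (((dz.const_mul Complex.I).neg).div_const (P.rhoA * P.Va ^ 2 : ℂ)).congr_deriv ?_
    simp [M0, scaledUnknowns, massFlux, momentumFlux, shearFlux, rhoStar, uStar, hx, hz, k0, k1]
    field_simp
    ring_nf
    rw [hI]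
    ring
  · refine dd.neg.congr_deriv ?_
    simp [M0, scaledUnknowns, massFlux, thermalFlux, rhoStar, uStar, hx, hz]
    generalize deriv (zPert P ν ξ y₀ r) (P.L0 * y) = D
    field_simp
    ring
  · refine (de.div_const (P.Va : ℂ)).congr_deriv ?_
    simp [M0, scaledUnknowns, shearFlux, rhoStar, uStar, hx, hz, k0]
    field_simp
    ring_nf
    rw [hI]
    ring

/-- The physical unknowns `r, u, v, p` of a scaled mode. -/
noncomputable def densityOf (P : Params) (ν : ℝ) (ξ : ℝ → ℝ) (y₀ : ℝ) (X : ℝ → Fin 5 → ℂ)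
    (x : ℝ) : ℂ :=
  P.rhoA * (((modelProfile ξ y₀ (x / P.L0) ^ ν : ℝ) : ℂ) * (modelProfile ξ y₀ (x / P.L0) : ℂ) ^ 2)
    * X (x / P.L0) 3

/-- The velocity, recovered from the mass flux. -/
noncomputable def velocityOf (P : Params) (ν : ℝ) (ξ : ℝ → ℝ) (y₀ : ℝ) (X : ℝ → Fin 5 → ℂ)
    (x : ℝ) : ℂ :=
  P.Va / modelProfile ξ y₀ (x / P.L0) * X (x / P.L0) 0
    + P.Va * ((modelProfile ξ y₀ (x / P.L0) ^ ν : ℝ) : ℂ) * X (x / P.L0) 3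

/-- The transverse velocity, recovered from the shear flux. -/
noncomputable def shearVelocityOf (P : Params) (X : ℝ → Fin 5 → ℂ) (x : ℝ) : ℂ :=
  -(Complex.I * P.Va * X (x / P.L0) 2)

/-- The pressure, recovered from the momentum flux. -/
noncomputable def pressureOf (P : Params) (ν : ℝ) (ξ : ℝ → ℝ) (y₀ : ℝ) (X : ℝ → Fin 5 → ℂ)
    (x : ℝ) : ℂ :=
  P.rhoA * P.Va ^ 2 * (X (x / P.L0) 1
    + 2 / modelProfile ξ y₀ (x / P.L0) * X (x / P.L0) 0
    + ((modelProfile ξ y₀ (x / P.L0) ^ ν : ℝ) : ℂ) * X (x / P.L0) 3)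

theorem hasDerivAt_comp_div_const {f : ℝ → ℂ} {f' : ℂ} {c x : ℝ} (h : HasDerivAt f f' (x / c)) :
    HasDerivAt (fun t => f (t / c)) (f' / c) x := by
  have h2 : HasDerivAt (fun t : ℝ => t / c) (1 / c) x := (hasDerivAt_id x).div_const c
  refine (h.scomp x h2).congr_deriv ?_
  rw [Complex.real_smul]
  push_cast
  ring

section Recovered

variable (X : ℝ → Fin 5 → ℂ)

theorem massFlux_of (hs : ∀ y, 0 < modelProfile ξ y₀ y) :
    massFlux P ξ y₀ (densityOf P ν ξ y₀ X) (velocityOf P ν ξ y₀ X)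
      = fun x => P.rhoA * P.Va * X (x / P.L0) 0 := by
  funext x
  have hs' : (modelProfile ξ y₀ (x / P.L0) : ℂ) ≠ 0 := by exact_mod_cast (hs _).ne'
  simp only [massFlux, densityOf, velocityOf, rhoStar, uStar]
  push_cast
  field_simp
  ring

theorem momentumFlux_of (hs : ∀ y, 0 < modelProfile ξ y₀ y) :
    momentumFlux P ξ y₀ (densityOf P ν ξ y₀ X) (velocityOf P ν ξ y₀ X) (pressureOf P ν ξ y₀ X)
      = fun x => P.rhoA * P.Va ^ 2 * X (x / P.L0) 1 := by
  funext x
  have hs' : (modelProfile ξ y₀ (x / P.L0) : ℂ) ≠ 0 := by exact_mod_cast (hs _).ne'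
  simp only [momentumFlux, densityOf, velocityOf, pressureOf, rhoStar, uStar]
  push_cast
  field_simp
  ring

theorem shearFlux_of (hs : ∀ y, 0 < modelProfile ξ y₀ y) :
    shearFlux P ξ y₀ (shearVelocityOf P X)
      = fun x => Complex.I * P.rhoA * P.Va ^ 2 * X (x / P.L0) 2 := by
  funext x
  have hs' : (modelProfile ξ y₀ (x / P.L0) : ℂ) ≠ 0 := by exact_mod_cast (hs _).ne'
  simp only [shearFlux, shearVelocityOf, rhoStar, uStar]
  push_cast
  field_simp

theorem zPert_of (hν : 1 < ν) (hs : ∀ y, 0 < modelProfile ξ y₀ y) :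
    zPert P ν ξ y₀ (densityOf P ν ξ y₀ X) = fun x => -X (x / P.L0) 3 := by
  funext x
  have hρ' : (P.rhoA : ℂ) ≠ 0 := by exact_mod_cast P.rhoA_pos.ne'
  have hs' : (modelProfile ξ y₀ (x / P.L0) : ℂ) ≠ 0 := by exact_mod_cast (hs _).ne'
  have hq' : ((modelProfile ξ y₀ (x / P.L0) ^ ν : ℝ) : ℂ) ≠ 0 := by
    exact_mod_cast (Real.rpow_pos_of_pos (hs _) ν).ne'
  rw [zPert_eq P hν (hs _)]
  simp only [densityOf]
  field_simp

theorem thermalFlux_of (hν : 1 < ν) (hs : ∀ y, 0 < modelProfile ξ y₀ y) {α β : ℝ} {γ : ℂ}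
    (hX : IsScaledMode ν (modelProfile ξ y₀) α β γ X) :
    thermalFlux P ν ξ y₀ (densityOf P ν ξ y₀ X) (velocityOf P ν ξ y₀ X)
      = fun x => P.Va * X (x / P.L0) 4 := by
  funext x
  have hL' : (P.L0 : ℂ) ≠ 0 := by exact_mod_cast P.L0_pos.ne'
  have hs' : (modelProfile ξ y₀ (x / P.L0) : ℂ) ≠ 0 := by exact_mod_cast (hs _).ne'
  simp only [thermalFlux, zPert_of X hν hs]
  rw [(hasDerivAt_comp_div_const (hX (x / P.L0) 3)).fun_neg.deriv, Fin.sum_univ_five]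
  simp [M0, velocityOf]
  field_simp
  ring

/-- Every scaled mode comes from a normal mode. -/
theorem IsScaledMode.isNormalMode (hν : 1 < ν) (hs : ∀ y, 0 < modelProfile ξ y₀ y) {γ : ℂ}
    (hX : IsScaledMode ν (modelProfile ξ y₀) P.alpha P.beta γ X) :
    IsNormalMode P ν ξ y₀ (γ * Real.sqrt (P.g * P.k)) (densityOf P ν ξ y₀ X)
      (velocityOf P ν ξ y₀ X) (shearVelocityOf P X) (pressureOf P ν ξ y₀ X) := by
  have hρ' : (P.rhoA : ℂ) ≠ 0 := by exact_mod_cast P.rhoA_pos.ne'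
  have hV' : (P.Va : ℂ) ≠ 0 := by exact_mod_cast P.Va_pos.ne'
  have hL' : (P.L0 : ℂ) ≠ 0 := by exact_mod_cast P.L0_pos.ne'
  have hβ' : (P.beta : ℂ) ≠ 0 := by exact_mod_cast P.beta_pos.ne'
  have c1 : (P.alpha : ℂ) * P.Va = Real.sqrt (P.g * P.k) * P.L0 := by
    exact_mod_cast P.alpha_mul_Va
  have c2 : (P.alpha : ℂ) * P.beta = P.k * P.L0 := by exact_mod_cast P.alpha_mul_beta
  have c3 : (P.alpha : ℂ) * P.Va ^ 2 = P.g * P.L0 * P.beta := by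
    exact_mod_cast P.alpha_mul_Va_sq
  have k0 : (P.k : ℂ) = P.alpha * P.beta / P.L0 := by
    rw [eq_div_iff hL', c2]
  have k1 : (Real.sqrt (P.g * P.k) : ℂ) = P.alpha * P.Va / P.L0 := by
    rw [eq_div_iff hL', c1]
  have k2 : (P.g : ℂ) = P.alpha * P.Va ^ 2 / (P.L0 * P.beta) := by
    rw [eq_div_iff (mul_ne_zero hL' hβ'), c3]
    ring
  have hI : Complex.I ^ 2 = -1 := Complex.I_sq
  have hd : ∀ x i, HasDerivAt (fun t => X (t / P.L0) i) _ x := fun x i =>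
    hasDerivAt_comp_div_const (hX (x / P.L0) i)
  have hne : ∀ x, (modelProfile ξ y₀ (x / P.L0) : ℂ) ≠ 0 := fun x => by
    exact_mod_cast (hs _).ne'
  refine ⟨fun x => ?_, fun x => ?_, fun x => ?_, ?_, fun x => ?_⟩
  · have hs' := hne x
    rw [massFlux_of X hs]
    refine ((hd x 0).const_mul _).congr_deriv ?_
    rw [Fin.sum_univ_five]
    simp [M0, densityOf, shearVelocityOf, rhoStar, k0, k1]
    field_simp
    ring_nf
    rw [hI]
    ring
  · have hs' := hne x
    rw [momentumFlux_of X hs, massFlux_of X hs, shearFlux_of X hs]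
    refine ((hd x 1).const_mul _).congr_deriv ?_
    rw [Fin.sum_univ_five]
    simp [M0, densityOf, k0, k1, k2]
    field_simp
    ring_nf
    rw [hI]
    ring
  · have hs' := hne x
    rw [shearFlux_of X hs]
    refine ((hd x 2).const_mul _).congr_deriv ?_
    rw [Fin.sum_univ_five]
    simp [M0, shearVelocityOf, pressureOf, rhoStar, k0, k1]
    field_simp
    ring
  · rw [zPert_of X hν hs]
    exact fun x => (hd x 3).fun_neg.differentiableAt
  · have hs' := hne x
    rw [thermalFlux_of X hν hs hX, zPert_of X hν hs]
    refine ((hd x 4).const_mul _).congr_deriv ?_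
    rw [Fin.sum_univ_five]
    simp [M0, shearVelocityOf, k0]
    field_simp
    ring_nf
    rw [hI]
    ring

end Recovered

/-- The growth rates are those of the scaled system. -/
theorem isReducedGrowthRate_iff (hν : 1 < ν) (hs : ∀ y, 0 < modelProfile ξ y₀ y) (γ : ℂ) :
    IsReducedGrowthRate P ν ξ y₀ γ ↔
      HasGrowingMode ν (modelProfile ξ y₀) P.alpha P.beta γ := by
  have hL := P.L0_pos
  have hρ' : (P.rhoA : ℂ) ≠ 0 := by exact_mod_cast P.rhoA_pos.ne'
  have hV' : (P.Va : ℂ) ≠ 0 := by exact_mod_cast P.Va_pos.ne'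
  have hgk : 0 < Real.sqrt (P.g * P.k) := Real.sqrt_pos.2 (mul_pos P.g_pos P.k_pos)
  have hre : 0 ≤ (γ * Real.sqrt (P.g * P.k)).re ↔ 0 ≤ γ.re := by
    rw [Complex.re_mul_ofReal]
    exact mul_nonneg_iff_of_pos_right hgk
  have t1 : Tendsto (fun y : ℝ => P.L0 * y) atBot atBot := tendsto_id.const_mul_atBot hL
  have t2 : Tendsto (fun y : ℝ => P.L0 * y) atTop atTop := tendsto_id.const_mul_atTop hL
  have t3 : Tendsto (fun x : ℝ => x / P.L0) atBot atBot := tendsto_id.atBot_div_const hL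
  have t4 : Tendsto (fun x : ℝ => x / P.L0) atTop atTop := tendsto_id.atTop_div_const hL
  unfold IsReducedGrowthRate IsLinearGrowthRate HasGrowingMode
  rw [hre]
  refine and_congr_right fun _ => ⟨?_, ?_⟩
  · rintro ⟨r, u, v, p, hm, hne, hbot, htop⟩
    have hlim : ∀ {l : Filter ℝ}, Tendsto (fun y : ℝ => P.L0 * y) l l →
        ModeTendsToZero P ν ξ y₀ r u v p l →
        ∀ i, Tendsto (fun y => scaledUnknowns P ν ξ y₀ r u v p y i) l (𝓝 0) := by
      intro l hl h i
      have m0 := (h.mass.comp hl).div_const (P.rhoA * P.Va : ℂ)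
      have m1 := (h.momentum.comp hl).div_const (P.rhoA * P.Va ^ 2 : ℂ)
      have m2 := (((h.shear.comp hl).const_mul Complex.I).neg).div_const (P.rhoA * P.Va ^ 2 : ℂ)
      have m3 := (h.z.comp hl).neg
      have m4 := (h.thermal.comp hl).div_const (P.Va : ℂ)
      simp only [mul_zero, neg_zero, zero_div] at m0 m1 m2 m3 m4
      fin_cases i
      · exact m0
      · exact m1
      · exact m2
      · exact m3
      · exact m4
    refine ⟨_, hm.isScaledMode hν hs, fun h0 => hne ?_, hlim t1 hbot, hlim t2 htop⟩
    have hX : ∀ x i, scaledUnknowns P ν ξ y₀ r u v p (x / P.L0) i = 0 := fun x i =>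
      congrFun (congrFun h0 _) i
    have hxx : ∀ x, P.L0 * (x / P.L0) = x := fun x => by field_simp
    have hsx : ∀ x, (modelProfile ξ y₀ (x / P.L0) : ℂ) ≠ 0 := fun x => by
      exact_mod_cast (hs _).ne'
    have hr : ∀ x, r x = 0 := by
      intro x
      have hq' : ((modelProfile ξ y₀ (x / P.L0) ^ ν : ℝ) : ℂ) ≠ 0 := by
        exact_mod_cast (Real.rpow_pos_of_pos (hs _) ν).ne'
      have := hX x 3
      simp only [scaledUnknowns, hxx] at this
      simpa [zPert_eq P hν (hs (x / P.L0)), hρ', hq', (hs (x / P.L0)).ne'] using this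
    have hu : ∀ x, u x = 0 := by
      intro x
      have := hX x 0
      simp only [scaledUnknowns, hxx] at this
      simpa [massFlux, rhoStar, hr, hρ', hV', (hs (x / P.L0)).ne'] using this
    have hp : ∀ x, p x = 0 := by
      intro x
      have := hX x 1
      simp only [scaledUnknowns, hxx] at this
      simpa [momentumFlux, rhoStar, hr, hu, hρ', hV'] using this
    have hv : ∀ x, v x = 0 := by
      intro x
      have := hX x 2
      simp only [scaledUnknowns, hxx] at this
      simpa [shearFlux, rhoStar, uStar, hρ', hV', (hs (x / P.L0)).ne'] using this
    exact ⟨funext hr, funext hu, funext hv, funext hp⟩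
  · rintro ⟨X, hX, hne, hbot, htop⟩
    have hlim : ∀ {l : Filter ℝ}, Tendsto (fun x : ℝ => x / P.L0) l l →
        (∀ i, Tendsto (fun y => X y i) l (𝓝 0)) →
        ModeTendsToZero P ν ξ y₀ (densityOf P ν ξ y₀ X) (velocityOf P ν ξ y₀ X)
          (shearVelocityOf P X) (pressureOf P ν ξ y₀ X) l := by
      intro l hl h
      have hc : ∀ (c : ℂ) i, Tendsto (fun x => c * X (x / P.L0) i) l (𝓝 0) := by
        intro c i
        have := ((h i).comp hl).const_mul c
        rw [mul_zero] at this
        exact this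
      refine ⟨?_, ?_, ?_, ?_, ?_⟩
      · rw [massFlux_of X hs]
        exact hc _ 0
      · rw [momentumFlux_of X hs]
        exact hc _ 1
      · rw [shearFlux_of X hs]
        exact hc _ 2
      · rw [zPert_of X hν hs]
        have := ((h 3).comp hl).neg
        rw [neg_zero] at this
        exact this
      · rw [thermalFlux_of X hν hs hX]
        exact hc _ 4
    refine ⟨_, _, _, _, hX.isNormalMode X hν hs, fun ⟨h1, h2, h3, h4⟩ => hne ?_, hlim t3 hbot,
      hlim t4 htop⟩
    have hyy : ∀ y, P.L0 * y / P.L0 = y := fun y => by field_simp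
    funext y i
    have f0 := congrFun (massFlux_of (P := P) (ν := ν) X hs) (P.L0 * y)
    have f1 := congrFun (momentumFlux_of (P := P) (ν := ν) X hs) (P.L0 * y)
    have f2 := congrFun (shearFlux_of (P := P) (ξ := ξ) (y₀ := y₀) X hs) (P.L0 * y)
    have f3 := congrFun (zPert_of (P := P) X hν hs) (P.L0 * y)
    have f4 := congrFun (thermalFlux_of (P := P) X hν hs hX) (P.L0 * y)
    have hz0 : zPert P ν ξ y₀ 0 = 0 := by
      funext x
      simp [zPert]
    rw [h1, h2] at f0 f1 f4
    rw [h4] at f1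
    rw [h3] at f2
    rw [h1] at f3
    fin_cases i
    · simpa [massFlux, hyy, hρ', hV'] using f0.symm
    · simpa [momentumFlux, hyy, hρ', hV'] using f1.symm
    · simpa [shearFlux, hyy, hρ', hV'] using f2.symm
    · simpa [hz0, hyy] using f3.symm
    · simpa [thermalFlux, hz0, hyy, hV'] using f4.symm

end Reduction

/-! ### Bivectors: uniqueness -/

/-- In a triangular system on antisymmetric matrices, all of whose rates have nonnegative real
parts, the solutions which tend to `0` are controlled by the source, with a constant which does not
depend on the half line. -/
theorem exists_norm_le_of_triangular_bivector {U : Matrix (Fin 5) (Fin 5) ℂ} {Λ : ℂ} {κ : ℝ}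
    (hκ : 0 < κ) (hU : ∀ i j, i < j → U i j = 0)
    (hre : ∀ i j, i ≠ j → 0 ≤ (U i i + U j j - Λ).re) :
    ∃ L, 0 ≤ L ∧ ∀ (Z f : ℝ → Matrix (Fin 5) (Fin 5) ℂ) (Y B : ℝ), 0 ≤ B →
      (∀ y, (Z y).transpose = -Z y) →
      (∀ i j y, Y ≤ y → HasDerivAt (fun t => Z t i j)
        ((U * Z y + Z y * U.transpose) i j - Λ * Z y i j + f y i j) y) →
      (∀ i j y, Y ≤ y → ‖f y i j‖ ≤ B * Real.exp (-κ * y)) →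
      (∀ i j, Tendsto (fun y => Z y i j) atTop (𝓝 0)) →
      ∀ i j y, Y ≤ y → ‖Z y i j‖ ≤ L * B * Real.exp (-κ * y) := by
  set u : ℝ := ∑ i, ∑ j, ‖U i j‖ with hu
  have hu0 : 0 ≤ u := Finset.sum_nonneg fun i _ => Finset.sum_nonneg fun j _ => norm_nonneg _
  have hrow : ∀ i, ∑ k, ‖U i k‖ ≤ u := fun i =>
    Finset.single_le_sum (f := fun i => ∑ j, ‖U i j‖)
      (fun i _ => Finset.sum_nonneg fun j _ => norm_nonneg _) (Finset.mem_univ i)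
  -- induction on `i + j`, since the entry `(i, j)` is driven by entries with a smaller sum
  have key : ∀ n : ℕ, ∃ L, 0 ≤ L ∧ ∀ (Z f : ℝ → Matrix (Fin 5) (Fin 5) ℂ) (Y B : ℝ), 0 ≤ B →
      (∀ y, (Z y).transpose = -Z y) →
      (∀ i j y, Y ≤ y → HasDerivAt (fun t => Z t i j)
        ((U * Z y + Z y * U.transpose) i j - Λ * Z y i j + f y i j) y) →
      (∀ i j y, Y ≤ y → ‖f y i j‖ ≤ B * Real.exp (-κ * y)) →
      (∀ i j, Tendsto (fun y => Z y i j) atTop (𝓝 0)) →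
      ∀ i j : Fin 5, (i : ℕ) + j < n → ∀ y, Y ≤ y → ‖Z y i j‖ ≤ L * B * Real.exp (-κ * y) := by
    intro n
    induction n with
    | zero => exact ⟨0, le_rfl, fun Z f Y B _ _ _ _ _ i j hij => absurd hij (Nat.not_lt_zero _)⟩
    | succ n ih =>
      obtain ⟨L, hL0, hL⟩ := ih
      refine ⟨max L ((2 * u * L + 1) / κ), le_max_of_le_left hL0, ?_⟩
      intro Z f Y B hB hanti hd hf hlim i j hij y hy
      have hlow := hL Z f Y B hB hanti hd hf hlim
      rcases Nat.lt_succ_iff_lt_or_eq.1 hij with h | h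
      · refine (hlow i j h y hy).trans ?_
        have := le_max_left L ((2 * u * L + 1) / κ)
        gcongr
      by_cases hne : i = j
      · subst hne
        have h0 : Z y i i = 0 := by
          have := congrFun (congrFun (hanti y) i) i
          rw [Matrix.transpose_apply, Matrix.neg_apply] at this
          exact self_eq_neg.1 this
        rw [h0, norm_zero]
        positivity
      have hs1 : ∀ t, ∑ k, U i k * Z t k j
          = U i i * Z t i j + ∑ k, (if k < i then U i k else 0) * Z t k j := by
        intro t
        rw [← Finset.add_sum_erase _ _ (Finset.mem_univ i),
          ← Finset.add_sum_erase Finset.univ (fun k => (if k < i then U i k else 0) * Z t k j)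
            (Finset.mem_univ i)]
        simp only [lt_self_iff_false, if_false, zero_mul, zero_add]
        congr 1
        refine Finset.sum_congr rfl fun k hk => ?_
        rcases lt_or_gt_of_ne (Finset.ne_of_mem_erase hk) with h | h
        · rw [if_pos h]
        · rw [if_neg (not_lt.2 h.le), hU i k h]
      have hs2 : ∀ t, ∑ k, Z t i k * U j k
          = U j j * Z t i j + ∑ k, (if k < j then U j k else 0) * Z t i k := by
        intro t
        rw [← Finset.add_sum_erase _ _ (Finset.mem_univ j),
          ← Finset.add_sum_erase Finset.univ (fun k => (if k < j then U j k else 0) * Z t i k)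
            (Finset.mem_univ j)]
        simp only [lt_self_iff_false, if_false, zero_mul, zero_add]
        congr 1
        · ring
        refine Finset.sum_congr rfl fun k hk => ?_
        rcases lt_or_gt_of_ne (Finset.ne_of_mem_erase hk) with h | h
        · rw [if_pos h, mul_comm]
        · rw [if_neg (not_lt.2 h.le), hU j k h, mul_zero, zero_mul]
      have hbd : ∀ t, Y ≤ t → ‖∑ k, (if k < i then U i k else 0) * Z t k j
          + ∑ k, (if k < j then U j k else 0) * Z t i k + f t i j‖
          ≤ ((2 * u * L + 1) * B) * Real.exp (-κ * t) := by
        intro t ht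
        have b1 : ‖∑ k, (if k < i then U i k else 0) * Z t k j‖
            ≤ u * (L * B * Real.exp (-κ * t)) := by
          refine (norm_sum_le _ _).trans (le_trans ?_
            (mul_le_mul_of_nonneg_right (hrow i) (by positivity)))
          rw [Finset.sum_mul]
          refine Finset.sum_le_sum fun k _ => ?_
          rw [norm_mul]
          split_ifs with hk
          · exact mul_le_mul_of_nonneg_left (hlow k j (by
              have : (k : ℕ) < i := hk
              omega) t ht) (norm_nonneg _)
          · rw [norm_zero, zero_mul]
            positivity
        have b2 : ‖∑ k, (if k < j then U j k else 0) * Z t i k‖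
            ≤ u * (L * B * Real.exp (-κ * t)) := by
          refine (norm_sum_le _ _).trans (le_trans ?_
            (mul_le_mul_of_nonneg_right (hrow j) (by positivity)))
          rw [Finset.sum_mul]
          refine Finset.sum_le_sum fun k _ => ?_
          rw [norm_mul]
          split_ifs with hk
          · exact mul_le_mul_of_nonneg_left (hlow i k (by
              have : (k : ℕ) < j := hk
              omega) t ht) (norm_nonneg _)
          · rw [norm_zero, zero_mul]
            positivity
        have b3 := hf i j t ht
        refine (norm_add_le _ _).trans ((add_le_add ((norm_add_le _ _).trans
          (add_le_add b1 b2)) b3).trans_eq ?_)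
        ring
      have h1 := norm_le_of_tendsto_zero (u := fun t => Z t i j) (μ := U i i + U j j - Λ) hκ
        (hre i j hne)
        (fun t ht => (hd i j t ht).congr_deriv (by
          rw [Matrix.add_apply, Matrix.mul_apply, Matrix.mul_apply]
          simp only [Matrix.transpose_apply]
          rw [hs1, hs2]
          ring)) hbd (hlim i j) y hy
      refine h1.trans ?_
      have h2 := le_max_right L ((2 * u * L + 1) / κ)
      calc _ = (2 * u * L + 1) / κ * B * Real.exp (-κ * y) := by ring
        _ ≤ _ := by gcongr
  obtain ⟨L, hL0, hL⟩ := key 10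
  exact ⟨L, hL0, fun Z f Y B hB h1 h2 h3 h4 i j =>
    hL Z f Y B hB h1 h2 h3 h4 i j (by omega)⟩

theorem conj_apply (S V : Matrix (Fin 5) (Fin 5) ℂ) (i j : Fin 5) :
    (S * V * S.transpose) i j = ∑ l, (∑ k, S i k * V k l) * S j l := by
  simp only [Matrix.mul_apply, Matrix.transpose_apply]

theorem hasDerivAt_conj {S V' : Matrix (Fin 5) (Fin 5) ℂ} {V : ℝ → Matrix (Fin 5) (Fin 5) ℂ}
    {y : ℝ} (h : ∀ i j, HasDerivAt (fun t => V t i j) (V' i j) y) (i j : Fin 5) :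
    HasDerivAt (fun t => (S * V t * S.transpose) i j) ((S * V' * S.transpose) i j) y := by
  simp only [conj_apply]
  exact HasDerivAt.fun_sum fun l _ => (HasDerivAt.fun_sum fun k _ =>
    (h k l).const_mul (S i k)).mul_const (S j l)

theorem norm_conj_le {S V : Matrix (Fin 5) (Fin 5) ℂ} {B : ℝ} (hB : 0 ≤ B)
    (h : ∀ i j, ‖V i j‖ ≤ B) (i j : Fin 5) :
    ‖(S * V * S.transpose) i j‖ ≤ (∑ i, ∑ j, ‖S i j‖) ^ 2 * B := by
  have hrow : ∀ i, ∑ k, ‖S i k‖ ≤ ∑ i, ∑ j, ‖S i j‖ := fun i =>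
    Finset.single_le_sum (f := fun i => ∑ j, ‖S i j‖)
      (fun i _ => Finset.sum_nonneg fun j _ => norm_nonneg _) (Finset.mem_univ i)
  rw [conj_apply]
  have h1 : ∀ l, ‖∑ k, S i k * V k l‖ ≤ (∑ i, ∑ j, ‖S i j‖) * B := by
    intro l
    refine (norm_sum_le _ _).trans (le_trans ?_ (mul_le_mul_of_nonneg_right (hrow i) hB))
    rw [Finset.sum_mul]
    refine Finset.sum_le_sum fun k _ => ?_
    rw [norm_mul]
    gcongr
    exact h k l
  refine (norm_sum_le _ _).trans ?_
  calc ∑ l, ‖(∑ k, S i k * V k l) * S j l‖ ≤ ∑ l, (∑ i, ∑ j, ‖S i j‖) * B * ‖S j l‖ := by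
        refine Finset.sum_le_sum fun l _ => ?_
        rw [norm_mul]
        gcongr
        exact h1 l
    _ = (∑ i, ∑ j, ‖S i j‖) * B * ∑ l, ‖S j l‖ := by rw [Finset.mul_sum]
    _ ≤ (∑ i, ∑ j, ‖S i j‖) * B * ∑ i, ∑ j, ‖S i j‖ :=
        mul_le_mul_of_nonneg_left (hrow j) (mul_nonneg (Finset.sum_nonneg fun i _ =>
          Finset.sum_nonneg fun j _ => norm_nonneg _) hB)
    _ = _ := by ring

/-- A solution of the system on bivectors which decays faster than the product of the slow and the
fast mode vanishes. -/
theorem IsModelProfile.bivector_eq_zero {ν y₀ ξ₀ θ : ℝ} {s : ℝ → ℝ}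
    (hs : IsModelProfile ν y₀ ξ₀ θ s) {α β : ℝ} {γ : ℂ} (hα : 0 < α) (hβ : 0 < β)
    (hγ : 0 ≤ γ.re) {d : ℝ → Matrix (Fin 5) (Fin 5) ℂ} (hanti : ∀ y, (d y).transpose = -d y)
    (hd : ∀ y i j, HasDerivAt (fun t => d t i j)
      (-(M0 ν (s y) α β γ * d y + d y * (M0 ν (s y) α β γ).transpose) i j) y)
    (hlim : ∀ i j, Tendsto (fun y : ℝ => (Complex.exp (α * β * y)
      * (fastFactor ν s y₀ (lambdaMinus ν 1 α β γ) y)⁻¹) * d y i j) atTop (𝓝 0)) (y : ℝ) :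
    d y = 0 := by
  have hθ := hs.theta_pos
  have hτ := beta_add_ne (s := 1) one_pos hβ hγ
  have hΔ := lambdaPlus_sub_lambdaMinus_ne (ν := ν) (β := β) (γ := γ) one_pos hα.le hγ
  set lam := lambdaMinus ν 1 α β γ with hlam
  set S := leftForms ν 1 α β γ with hS
  set U := triangularForm ν 1 α β γ with hU
  set A := M0 ν 1 α β γ with hA
  have hSM : S * -A = U * S := leftForms_mul one_pos hβ hτ hΔ
  have hSu : IsUnit S.det := isUnit_det_leftForms one_pos hβ hτ hΔ
  set E : ℝ → ℂ := fun y => Complex.exp (α * β * y) * (fastFactor ν s y₀ lam y)⁻¹ with hE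
  have hEd : ∀ y, HasDerivAt E ((α * β - (1 + lam - ((s y ^ ν : ℝ) : ℂ))) * E y) y := by
    intro y
    have h1 : HasDerivAt (fun y : ℝ => Complex.exp (α * β * y))
        (Complex.exp (α * β * y) * (α * β)) y := by
      have := (((hasDerivAt_id y).ofReal_comp).const_mul ((α : ℂ) * β)).cexp
      simpa using this
    have hne := fastFactor_ne_zero ν s y₀ lam y
    refine (h1.fun_mul ((hs.hasDerivAt_fastFactor lam y).fun_inv hne)).congr_deriv ?_
    simp only [hE]
    field_simp
    ring
  set v : ℝ → Matrix (Fin 5) (Fin 5) ℂ := fun y => E y • d y with hv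
  set rem : ℝ → Matrix (Fin 5) (Fin 5) ℂ := fun y =>
    (A - M0 ν (s y) α β γ) * v y + v y * (A - M0 ν (s y) α β γ).transpose
      + (((s y ^ ν : ℝ) : ℂ) - 1) • v y with hrem
  have hvd : ∀ y i j, HasDerivAt (fun t => v t i j)
      ((-A * v y + v y * (-A).transpose - (lam - α * β) • v y + rem y) i j) y := by
    intro y i j
    refine ((hEd y).fun_mul (hd y i j)).congr_deriv ?_
    have e1 : ∀ B : Matrix (Fin 5) (Fin 5) ℂ, (B * v y) i j = E y * (B * d y) i j := by
      intro B
      rw [hv, Matrix.mul_smul, Matrix.smul_apply, smul_eq_mul]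
    have e2 : ∀ B : Matrix (Fin 5) (Fin 5) ℂ, (v y * B) i j = E y * (d y * B) i j := by
      intro B
      rw [hv, Matrix.smul_mul, Matrix.smul_apply, smul_eq_mul]
    have e3 : v y i j = E y * d y i j := rfl
    simp only [hrem, Matrix.add_apply, Matrix.sub_apply, Matrix.neg_apply, Matrix.smul_apply,
      smul_eq_mul, Matrix.transpose_sub, Matrix.transpose_neg, sub_mul, mul_sub, neg_mul, mul_neg,
      e1, e2, e3]
    ring
  set Z : ℝ → Matrix (Fin 5) (Fin 5) ℂ := fun y => S * v y * S.transpose with hZ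
  have hZd : ∀ i j y, HasDerivAt (fun t => Z t i j)
      ((U * Z y + Z y * U.transpose) i j - (lam - α * β) * Z y i j
        + (S * rem y * S.transpose) i j) y := by
    intro i j y
    refine (hasDerivAt_conj (hvd y) i j).congr_deriv ?_
    have e1 : S * (-A * v y) * S.transpose = U * Z y := by
      rw [← mul_assoc, hSM, hZ]
      simp only [mul_assoc]
    have e2 : S * (v y * (-A).transpose) * S.transpose = Z y * U.transpose := by
      have : (-A).transpose * S.transpose = S.transpose * U.transpose := by
        rw [← Matrix.transpose_mul, hSM, Matrix.transpose_mul]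
      simp only [hZ, mul_assoc, this]
    rw [mul_add, mul_sub, mul_add, add_mul, sub_mul, add_mul, e1, e2, Matrix.mul_smul,
      Matrix.smul_mul]
    simp only [Matrix.add_apply, Matrix.sub_apply, Matrix.smul_apply, smul_eq_mul, hZ]
  have hvanti : ∀ y, (v y).transpose = -v y := by
    intro y
    rw [hv, Matrix.transpose_smul, hanti, smul_neg]
  have hZanti : ∀ y, (Z y).transpose = -Z y := by
    intro y
    rw [hZ, Matrix.transpose_mul, Matrix.transpose_mul, Matrix.transpose_transpose, hvanti]
    simp [mul_assoc]
  have hvlim : ∀ i j, Tendsto (fun y => v y i j) atTop (𝓝 0) := hlim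
  have hZlim : ∀ i j, Tendsto (fun y => Z y i j) atTop (𝓝 0) := by
    intro i j
    have : Tendsto (fun y => ∑ l, (∑ k, S i k * v y k l) * S j l) atTop
        (𝓝 (∑ l, (∑ k, S i k * 0) * S j l)) :=
      tendsto_finsetSum _ fun l _ => (tendsto_finsetSum _ fun k _ =>
        (hvlim k l).const_mul _).mul_const _
    simp only [mul_zero, Finset.sum_const_zero, zero_mul] at this
    exact this.congr fun y => (conj_apply S (v y) i j).symm
  have hUtri : ∀ i j, i < j → U i j = 0 := by
    intro i j hij
    fin_cases i <;> fin_cases j <;> simp [hU, triangularForm] at hij ⊢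
  -- the product of the slow and the fast mode is the fastest rate
  have hre : ∀ i j, i ≠ j → 0 ≤ (U i i + U j j - (lam - α * β)).re := by
    have h0 := (lambdaPlus_re_pos (ν := ν) (β := β) (s := 1) one_pos hα hβ hγ).le
    have h1 := lambdaMinus_re_neg (s := 1) one_pos ν β hα.le hγ
    rw [← hlam] at h1
    have h3 : 0 ≤ α * γ.re := mul_nonneg hα.le hγ
    have h4 := (mul_pos hα hβ).le
    have d0 : (U 0 0).re = (lambdaPlus ν 1 α β γ).re := rfl
    have d1 : (U 1 1).re = lam.re := rfl
    have d2 : (U 2 2).re = -(α * β) := by simp [hU, triangularForm]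
    have d3 : (U 3 3).re = α * γ.re := by simp [hU, triangularForm]
    have d4 : (U 4 4).re = α * β := by simp [hU, triangularForm]
    have dl : (lam - α * β : ℂ).re = lam.re - α * β := by simp
    intro i j hij
    rw [Complex.sub_re, Complex.add_re, dl]
    fin_cases i <;> fin_cases j <;> first | exact absurd rfl hij | skip
    all_goals
      simp only [Fin.zero_eta, Fin.mk_one, Fin.reduceFinMk, d0, d1, d2, d3, d4]
      linarith
  obtain ⟨L, hL0, hL⟩ := exists_norm_le_of_triangular_bivector (Λ := lam - α * β)
    (κ := 2 * θ) (by positivity) hUtri hre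
  obtain ⟨K, hK0, hK⟩ := hs.exists_norm_M0_sub_le α β γ
  have hremb : ∀ t B, 0 ≤ B → (∀ i j, ‖v t i j‖ ≤ B) → ∀ i j,
      ‖rem t i j‖ ≤ 11 * K * Real.exp (2 * θ * y₀) * B * Real.exp (-(2 * θ) * t) := by
    intro t B hB hvB i j
    have hexp : Real.exp (2 * θ * (y₀ - t))
        = Real.exp (2 * θ * y₀) * Real.exp (-(2 * θ) * t) := by
      rw [← Real.exp_add]
      ring_nf
    have hKt := hK t
    rw [hexp] at hKt
    set ε := K * (Real.exp (2 * θ * y₀) * Real.exp (-(2 * θ) * t)) with hε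
    have hε0 : 0 ≤ ε := by positivity
    have b1 : ‖((A - M0 ν (s t) α β γ) * v t) i j‖ ≤ 5 * (ε * B) := by
      rw [Matrix.mul_apply]
      refine (norm_sum_le _ _).trans ((Finset.sum_le_sum (g := fun _ => ε * B)
        fun k _ => ?_).trans_eq (by simp))
      rw [norm_mul]
      exact mul_le_mul (hKt i k) (hvB k j) (norm_nonneg _) hε0
    have b2 : ‖(v t * (A - M0 ν (s t) α β γ).transpose) i j‖ ≤ 5 * (ε * B) := by
      rw [Matrix.mul_apply]
      refine (norm_sum_le _ _).trans ((Finset.sum_le_sum (g := fun _ => ε * B)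
        fun k _ => ?_).trans_eq (by simp))
      rw [norm_mul, mul_comm]
      exact mul_le_mul (hKt j k) (hvB i k) (norm_nonneg _) hε0
    have b3 : ‖(((s t ^ ν : ℝ) : ℂ) - 1) * v t i j‖ ≤ ε * B := by
      rw [norm_mul]
      refine mul_le_mul ?_ (hvB i j) (norm_nonneg _) hε0
      have := hKt 3 3
      rw [norm_sub_rev] at this
      simpa [M0] using this
    have e : rem t i j = ((A - M0 ν (s t) α β γ) * v t) i j
        + (v t * (A - M0 ν (s t) α β γ).transpose) i j + (((s t ^ ν : ℝ) : ℂ) - 1) * v t i j := rfl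
    rw [e]
    refine (norm_add_le _ _).trans ((add_le_add ((norm_add_le _ _).trans
      (add_le_add b1 b2)) b3).trans_eq ?_)
    rw [hε]
    ring
  have hvZ : ∀ t, v t = S⁻¹ * Z t * S⁻¹.transpose := by
    intro t
    have h1 : S⁻¹ * S = 1 := Matrix.nonsing_inv_mul _ hSu
    have h2 : S.transpose * S⁻¹.transpose = 1 := by
      rw [← Matrix.transpose_mul, h1, Matrix.transpose_one]
    calc v t = (S⁻¹ * S) * v t * (S.transpose * S⁻¹.transpose) := by rw [h1, h2]; simp
      _ = _ := by simp only [hZ, mul_assoc]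
  set cS : ℝ := (∑ i, ∑ j, ‖S i j‖) ^ 2 with hcS
  set cT : ℝ := (∑ i, ∑ j, ‖S⁻¹ i j‖) ^ 2 with hcT
  have hcS0 : 0 ≤ cS := sq_nonneg _
  have hcT0 : 0 ≤ cT := sq_nonneg _
  set Q : ℝ := L * (cS * (11 * K * Real.exp (2 * θ * y₀) * cT)) with hQ
  have hQ0 : 0 ≤ Q := by positivity
  -- a half line on which the remainder is small
  obtain ⟨Y, hY⟩ : ∃ Y : ℝ, Q * Real.exp (-(2 * θ) * Y) ≤ 1 / 2 := by
    have h1 : Tendsto (fun y : ℝ => 2 * θ * y) atTop atTop :=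
      tendsto_id.const_mul_atTop (by positivity)
    have h2 := (Real.tendsto_exp_neg_atTop_nhds_zero.comp h1).const_mul Q
    rw [mul_zero] at h2
    obtain ⟨Y, hY⟩ := (h2.eventually (gt_mem_nhds (show (0 : ℝ) < 1 / 2 by norm_num))).exists
    exact ⟨Y, by simpa [neg_mul] using hY.le⟩
  have step : ∀ B, 0 ≤ B → (∀ i j t, Y ≤ t → ‖Z t i j‖ ≤ B) →
      ∀ i j t, Y ≤ t → ‖Z t i j‖ ≤ B / 2 := by
    intro B hB hZB i j t ht
    have h1 := hL Z (fun t => S * rem t * S.transpose) Y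
      (cS * (11 * K * Real.exp (2 * θ * y₀) * (cT * B))) (by positivity) hZanti
      (fun i j y _ => hZd i j y)
      (fun i j τ hτ => by
        have hvB : ∀ i j, ‖v τ i j‖ ≤ cT * B := by
          intro i j
          rw [hvZ τ]
          exact norm_conj_le hB (fun i j => hZB i j τ hτ) i j
        refine (norm_conj_le (by positivity)
          (hremb τ (cT * B) (by positivity) hvB) i j).trans_eq ?_
        ring) hZlim i j t ht
    refine h1.trans ?_
    have h2 : Real.exp (-(2 * θ) * t) ≤ Real.exp (-(2 * θ) * Y) :=
      Real.exp_le_exp.2 (by nlinarith)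
    calc _ = Q * Real.exp (-(2 * θ) * t) * B := by
          rw [hQ]
          ring
      _ ≤ Q * Real.exp (-(2 * θ) * Y) * B := by gcongr
      _ ≤ 1 / 2 * B := by gcongr
      _ = B / 2 := by ring
  obtain ⟨B₀, hB₀, hZB⟩ : ∃ B, 0 ≤ B ∧ ∀ i j t, Y ≤ t → ‖Z t i j‖ ≤ B := by
    have hc : ∀ i j, Continuous fun t => Z t i j := fun i j =>
      continuous_iff_continuousAt.2 fun t => (hZd i j t).continuousAt
    choose B hB using fun i j => exists_norm_le_of_tendsto_zero (hc i j) (hZlim i j) Y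
    have hB0 : ∀ i j, 0 ≤ B i j := fun i j => (norm_nonneg _).trans (hB i j Y le_rfl)
    refine ⟨∑ i, ∑ j, B i j, Finset.sum_nonneg fun i _ => Finset.sum_nonneg fun j _ => hB0 i j,
      fun i j t ht => (hB i j t ht).trans ?_⟩
    exact (Finset.single_le_sum (f := fun j => B i j) (fun j _ => hB0 i j) (Finset.mem_univ j)).trans
      (Finset.single_le_sum (f := fun i => ∑ j, B i j)
        (fun i _ => Finset.sum_nonneg fun j _ => hB0 i j) (Finset.mem_univ i))
  have hall : ∀ n : ℕ, ∀ i j t, Y ≤ t → ‖Z t i j‖ ≤ B₀ * (1 / 2) ^ n := by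
    intro n
    induction n with
    | zero => simpa using hZB
    | succ n ih =>
      intro i j t ht
      refine (step _ (by positivity) ih i j t ht).trans_eq ?_
      ring
  have hZ0 : Z Y = 0 := by
    ext i j
    have h1 := (tendsto_pow_atTop_nhds_zero_of_lt_one (r := (1 / 2 : ℝ)) (by norm_num)
      (by norm_num)).const_mul B₀
    rw [mul_zero] at h1
    exact norm_le_zero_iff.1 (ge_of_tendsto' h1 fun n => hall n i j Y le_rfl)
  have hv0 : v Y = 0 := by
    rw [hvZ Y, hZ0]
    simp
  have hEne : E Y ≠ 0 := mul_ne_zero (Complex.exp_ne_zero _)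
    (inv_ne_zero (fastFactor_ne_zero ν s y₀ lam Y))
  have hd0 : d Y = 0 := (smul_eq_zero.1 hv0).resolve_left hEne
  -- uniqueness for the initial value problem
  obtain ⟨C, hC0, hC⟩ := hs.exists_norm_M0_le α β γ
  have hfin := eq_zero_of_norm_deriv_le (E := Fin 5 → Fin 5 → ℂ) (u := fun y => d y)
    (C := 10 * C) (t₀ := Y)
    (u' := fun y i j => -(M0 ν (s y) α β γ * d y + d y * (M0 ν (s y) α β γ).transpose) i j)
    (fun t => hasDerivAt_pi.2 fun i => hasDerivAt_pi.2 fun j => hd t i j)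
    (fun t => by
      have hent : ∀ i j, ‖d t i j‖ ≤ ‖(fun i j => d t i j : Fin 5 → Fin 5 → ℂ)‖ := fun i j =>
        (norm_le_pi_norm (d t i) j).trans (norm_le_pi_norm (fun i j => d t i j) i)
      set B := ‖(fun i j => d t i j : Fin 5 → Fin 5 → ℂ)‖ with hBdef
      have hB0 : 0 ≤ B := norm_nonneg _
      refine (pi_norm_le_iff_of_nonneg (by positivity)).2 fun i =>
        (pi_norm_le_iff_of_nonneg (by positivity)).2 fun j => ?_
      have b1 : ‖(M0 ν (s t) α β γ * d t) i j‖ ≤ 5 * (C * B) := by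
        rw [Matrix.mul_apply]
        refine (norm_sum_le _ _).trans ((Finset.sum_le_sum (g := fun _ => C * B)
          fun k _ => ?_).trans_eq (by simp))
        rw [norm_mul]
        exact mul_le_mul (hC t i k) (hent k j) (norm_nonneg _) hC0
      have b2 : ‖(d t * (M0 ν (s t) α β γ).transpose) i j‖ ≤ 5 * (C * B) := by
        rw [Matrix.mul_apply]
        refine (norm_sum_le _ _).trans ((Finset.sum_le_sum (g := fun _ => C * B)
          fun k _ => ?_).trans_eq (by simp))
        rw [norm_mul, mul_comm]
        exact mul_le_mul (hC t j k) (hent i k) (norm_nonneg _) hC0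
      rw [norm_neg, Matrix.add_apply]
      refine (norm_add_le _ _).trans ((add_le_add b1 b2).trans_eq ?_)
      ring) hd0 y
  exact hfin

/-! ### The Evans function -/

theorem IsScaledMode.hasDerivAt_wedge {ν : ℝ} {s : ℝ → ℝ} {α β : ℝ} {γ : ℂ}
    {X Y : ℝ → Fin 5 → ℂ} (hX : IsScaledMode ν s α β γ X) (hY : IsScaledMode ν s α β γ Y)
    (y : ℝ) (i j : Fin 5) :
    HasDerivAt (fun t => wedge (X t) (Y t) i j)
      (-(M0 ν (s y) α β γ * wedge (X y) (Y y)
        + wedge (X y) (Y y) * (M0 ν (s y) α β γ).transpose) i j) y := by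
  refine (((hX y i).fun_mul (hY y j)).fun_sub ((hX y j).fun_mul (hY y i))).congr_deriv ?_
  rw [Matrix.add_apply, Matrix.mul_apply, Matrix.mul_apply]
  simp only [wedge, Matrix.of_apply, Matrix.transpose_apply, Fin.sum_univ_five]
  ring

/-- The determinant with two distinguished rows, as a bilinear map. -/
noncomputable def detBilin (c d e : Fin 5 → ℂ) :
    (Fin 5 → ℂ) →ₗ[ℂ] (Fin 5 → ℂ) →ₗ[ℂ] ℂ :=
  have h0 : ∀ x b : Fin 5 → ℂ, Matrix.of ![x, b, c, d, e]
      = (Matrix.of ![0, b, c, d, e]).updateRow 0 x := by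
    intro x b
    ext i j
    fin_cases i <;> simp [Matrix.updateRow_apply]
  have h1 : ∀ a x : Fin 5 → ℂ, Matrix.of ![a, x, c, d, e]
      = (Matrix.of ![a, 0, c, d, e]).updateRow 1 x := by
    intro a x
    ext i j
    fin_cases i <;> simp [Matrix.updateRow_apply]
  LinearMap.mk₂ ℂ (fun a b => (Matrix.of ![a, b, c, d, e]).det)
    (fun a a' b => by rw [h0 (a + a'), h0 a, h0 a', Matrix.det_updateRow_add])
    (fun k a b => by rw [h0 (k • a), h0 a, Matrix.det_updateRow_smul, smul_eq_mul])
    (fun a b b' => by rw [h1 a (b + b'), h1 a b, h1 a b', Matrix.det_updateRow_add])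
    (fun k a b => by rw [h1 a (k • b), h1 a b, Matrix.det_updateRow_smul, smul_eq_mul])

theorem detBilin_apply (a b c d e : Fin 5 → ℂ) :
    detBilin c d e a b = (Matrix.of ![a, b, c, d, e]).det := rfl

theorem detBilin_swap (a b c d e : Fin 5 → ℂ) : detBilin c d e b a = -detBilin c d e a b := by
  have h0 : ∀ x, detBilin c d e x x = 0 := by
    intro x
    rw [detBilin_apply]
    refine Matrix.det_zero_of_row_eq (i := 0) (j := 1) (by decide) ?_
    ext k
    simp
  have h := h0 (a + b)
  rw [map_add, map_add, LinearMap.add_apply, LinearMap.add_apply, h0, h0] at h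
  linear_combination h

/-- Laplace expansion of a determinant along its first two rows. -/
theorem wedgeTop_wedge (a b c d e : Fin 5 → ℂ) :
    wedgeTop (wedge a b) c d e = (Matrix.of ![a, b, c, d, e]).det := by
  have hexp : ∀ a b : Fin 5 → ℂ, detBilin c d e a b
      = ∑ i, ∑ j, a i * b j * detBilin c d e (Pi.single i 1) (Pi.single j 1) := by
    intro a b
    have ha : a = ∑ i, a i • (Pi.single i (1 : ℂ) : Fin 5 → ℂ) := by
      funext k
      simp [Finset.sum_apply, Pi.single_apply]
    have hb : b = ∑ i, b i • (Pi.single i (1 : ℂ) : Fin 5 → ℂ) := by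
      funext k
      simp [Finset.sum_apply, Pi.single_apply]
    conv_lhs => rw [ha, hb]
    simp only [map_sum, map_smul, LinearMap.sum_apply, LinearMap.smul_apply, smul_eq_mul,
      Finset.mul_sum]
    rw [Finset.sum_comm]
    exact Finset.sum_congr rfl fun i _ => Finset.sum_congr rfl fun j _ => by ring
  have h1 : wedgeTop (wedge a b) c d e = (1 / 2) * (detBilin c d e a b - detBilin c d e b a) := by
    rw [hexp a b, hexp b a, ← Finset.sum_sub_distrib]
    unfold wedgeTop wedge
    congr 1
    refine Finset.sum_congr rfl fun i _ => ?_
    rw [← Finset.sum_sub_distrib]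
    refine Finset.sum_congr rfl fun j _ => ?_
    rw [Matrix.of_apply, detBilin_apply]
    ring
  rw [h1, detBilin_swap a b, detBilin_apply]
  ring

theorem det_add_smul_row (a b c d e : Fin 5 → ℂ) (k : ℂ) :
    (Matrix.of ![a, b, c, d, e + k • c]).det = (Matrix.of ![a, b, c, d, e]).det := by
  have h := Matrix.det_updateRow_add_smul_self (Matrix.of ![a, b, c, d, e])
    (show (4 : Fin 5) ≠ 2 by decide) k
  rw [← h]
  congr 1
  ext i j
  fin_cases i <;> simp [Matrix.updateRow_apply]

theorem wedgeTop_smul (k : ℂ) (w : Matrix (Fin 5) (Fin 5) ℂ) (a b c : Fin 5 → ℂ) :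
    wedgeTop (k • w) a b c = k * wedgeTop w a b c := by
  unfold wedgeTop
  simp only [Matrix.smul_apply, smul_eq_mul, Finset.mul_sum]
  exact Finset.sum_congr rfl fun i _ => Finset.sum_congr rfl fun j _ => by ring

/-- The Evans function at `α = 0`, where `q` stands for the limit of the coefficient of `T` in `F₊`. -/
theorem det_limit (s : ℝ) {β : ℝ} (hβ : 0 < β) (γ q : ℂ) :
    (Matrix.of ![![0, 0, 0, 1, 0], EaMinus 1 β γ, E0 s β γ, EaPlus s β γ,
      ![0, 0, 0, 1, 0] + q • T0 s β γ]).det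
      = β * (β - γ * s) ^ 2 * q * (s ^ 2 * (1 - s) - (1 + s) * (β + γ * s) ^ 2) := by
  simp only [EaMinus, E0, EaPlus, T0]
  rw [Matrix.det_succ_row_zero, Fin.sum_univ_five]
  simp [Matrix.det_succ_row_zero, Fin.sum_univ_succ, Fin.succAbove]
  have hβ' : (β : ℂ) ≠ 0 := by exact_mod_cast hβ.ne'
  field_simp
  ring

theorem tendsto_det {l : Filter ℝ} {M : ℝ → Matrix (Fin 5) (Fin 5) ℂ}
    {M₀ : Matrix (Fin 5) (Fin 5) ℂ} (h : Tendsto M l (𝓝 M₀)) :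
    Tendsto (fun x => (M x).det) l (𝓝 M₀.det) := by
  have hc : Continuous fun A : Matrix (Fin 5) (Fin 5) ℂ => A.det := continuous_id.matrix_det
  exact (hc.tendsto M₀).comp h

theorem tendsto_det_of_rows {l : Filter ℝ} {a b c d e : ℝ → Fin 5 → ℂ}
    {a₀ b₀ c₀ d₀ e₀ : Fin 5 → ℂ} (ha : Tendsto a l (𝓝 a₀)) (hb : Tendsto b l (𝓝 b₀))
    (hc : Tendsto c l (𝓝 c₀)) (hd : Tendsto d l (𝓝 d₀)) (he : Tendsto e l (𝓝 e₀)) :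
    Tendsto (fun x => (Matrix.of ![a x, b x, c x, d x, e x]).det) l
      (𝓝 (Matrix.of ![a₀, b₀, c₀, d₀, e₀]).det) := by
  have h : Tendsto (fun x => Matrix.of ![a x, b x, c x, d x, e x]) l
      (𝓝 (Matrix.of ![a₀, b₀, c₀, d₀, e₀])) := by
    refine tendsto_pi_nhds.2 fun i => ?_
    fin_cases i
    · exact ha
    · exact hb
    · exact hc
    · exact hd
    · exact he
  exact tendsto_det h

/-- The factor `(1 - ξ)/ξ` of the thermal modes. -/
theorem IsDensityProfile.exp_neg_integral {ν : ℝ} {ξ : ℝ → ℝ} (h : IsDensityProfile ν ξ)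
    (hν : 1 < ν) {y₀ y : ℝ} (hy : y₀ ≤ y) :
    (1 - ξ y₀) / ξ y₀ * Real.exp (-∫ t in y₀..y, modelProfile ξ y₀ t ^ ν) = (1 - ξ y) / ξ y := by
  have hpos := h.pos hν
  have hc : Continuous fun t => -(ξ t ^ ν) :=
    (h.continuous.rpow_const fun t => Or.inl (hpos t).ne').neg
  have hd : ∀ t, HasDerivAt (fun t => (1 - ξ t) / ξ t) (-(ξ t ^ ν) * ((1 - ξ t) / ξ t)) t := by
    intro t
    have hne := (hpos t).ne'
    refine (((h.ode t).const_sub 1).fun_div (h.ode t) hne).congr_deriv ?_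
    rw [Real.rpow_add_one hne]
    field_simp
    ring
  have e1 := eq_mul_exp_of_hasDerivAt hc hd y
  have e2 := eq_mul_exp_of_hasDerivAt hc hd y₀
  have e3 : ∫ t in y₀..y, modelProfile ξ y₀ t ^ ν = ∫ t in y₀..y, ξ t ^ ν := by
    refine intervalIntegral.integral_congr fun t ht => ?_
    rw [Set.uIcc_of_le hy] at ht
    simp only [modelProfile_eq_of_ge ξ ht.1]
  have e4 := intervalIntegral.integral_add_adjacent_intervals
    (hc.intervalIntegrable (μ := MeasureTheory.volume) 0 y₀) (hc.intervalIntegrable y₀ y)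
  rw [e1, e2, e3, ← e4, Real.exp_add, intervalIntegral.integral_neg (a := y₀)]
  ring

theorem IsDensityProfile.tendsto_one {ν : ℝ} {ξ : ℝ → ℝ} (h : IsDensityProfile ν ξ)
    (hν : 1 < ν) : Tendsto ξ atTop (𝓝 1) := by
  have hs := h.isModelProfile hν 0
  have hθ := hs.theta_pos
  have h1 : Tendsto (fun y : ℝ => 1 - Real.exp (2 * (ξ 0 ^ (ν + 1) / 2) * (0 - y))) atTop
      (𝓝 (1 - 0)) := by
    have h2 : Tendsto (fun y : ℝ => 2 * (ξ 0 ^ (ν + 1) / 2) * y) atTop atTop :=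
      tendsto_id.const_mul_atTop (by linarith)
    refine ((Real.tendsto_exp_neg_atTop_nhds_zero.comp h2).const_sub 1).congr fun y => ?_
    simp
  rw [sub_zero] at h1
  refine tendsto_of_tendsto_of_tendsto_of_le_of_le' h1 tendsto_const_nhds ?_ ?_
  · filter_upwards [eventually_ge_atTop 0] with y hy
    have := hs.decay y
    rw [modelProfile_eq_of_ge ξ hy] at this
    linarith
  · exact Eventually.of_forall fun y => (h.lt_one hν y).le

/-- The normalization of `w₊` in terms of the slow and the fast exponential factors. -/
theorem IsDensityProfile.normalization_eq {ν : ℝ} {ξ : ℝ → ℝ} (h : IsDensityProfile ν ξ)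
    (hν : 1 < ν) {y₀ y : ℝ} (hy : y₀ ≤ y) (α β : ℝ) (lam : ℂ) :
    Complex.exp ((α * β - lam) * y) / ((1 - ξ y) * Real.exp y)
      = Complex.exp (-(1 + lam) * y₀) * ((ξ y₀ / (1 - ξ y₀) : ℝ) : ℂ) * (ξ y : ℂ)⁻¹
        * (Complex.exp (α * β * y) * (fastFactor ν (modelProfile ξ y₀) y₀ lam y)⁻¹) := by
  have hp := h.pos hν
  have hl := h.lt_one hν
  have h1 := h.exp_neg_integral hν hy
  have e1 : (ξ y : ℂ) ≠ 0 := by exact_mod_cast (hp y).ne'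
  have e2 : (ξ y₀ : ℂ) ≠ 0 := by exact_mod_cast (hp y₀).ne'
  have e3 : (1 - ξ y : ℂ) ≠ 0 := by exact_mod_cast (by linarith [hl y] : (1 - ξ y : ℝ) ≠ 0)
  have e4 : (1 - ξ y₀ : ℂ) ≠ 0 := by exact_mod_cast (by linarith [hl y₀] : (1 - ξ y₀ : ℝ) ≠ 0)
  set I : ℝ := ∫ t in y₀..y, modelProfile ξ y₀ t ^ ν with hI
  have h2 : (1 - ξ y₀ : ℂ) / ξ y₀ * Complex.exp (-I) = (1 - ξ y) / ξ y := by exact_mod_cast h1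
  have hN : (fastFactor ν (modelProfile ξ y₀) y₀ lam y)⁻¹
      = Complex.exp (-((1 + lam) * (y - y₀))) * (Complex.exp (-I))⁻¹ := by
    unfold fastFactor
    rw [← Complex.exp_neg, ← Complex.exp_neg, ← Complex.exp_add]
    congr 1
    rw [hI]
    ring
  have h3 : Complex.exp (-I) = (1 - ξ y) / ξ y * (ξ y₀ / (1 - ξ y₀)) := by
    rw [← h2]
    field_simp
  have h4 : Complex.exp ((α * β - lam) * y) / Complex.exp y
      = Complex.exp (-(1 + lam) * y₀) * Complex.exp (α * β * y)
        * Complex.exp (-((1 + lam) * (y - y₀))) := by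
    rw [← Complex.exp_sub, ← Complex.exp_add, ← Complex.exp_add]
    congr 1
    ring
  rw [hN, h3, Complex.ofReal_exp, mul_comm (1 - ξ y : ℂ), ← div_div, h4]
  push_cast
  field_simp

variable {ν : ℝ} {ξ : ℝ → ℝ} {y₀ β : ℝ} {φ ψ : ℝ → ℂ → ℝ → Fin 5 → ℂ} {γ : ℂ}

/-- The constant which normalizes the product of the fast and the slow mode. -/
noncomputable def wConst (ν : ℝ) (ξ : ℝ → ℝ) (y₀ α β : ℝ) (γ : ℂ) : ℂ :=
  (α * β : ℂ)⁻¹ * (((1 - ξ y₀) / ξ y₀ : ℝ) : ℂ)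
    * Complex.exp ((1 + lambdaMinus ν 1 α β γ) * y₀)

theorem tendsto_mk_smallAlpha (γ : ℂ) :
    Tendsto (fun α : ℝ => (α, γ)) (𝓝[>] 0) (smallAlpha γ) :=
  tendsto_id.prodMk tendsto_const_nhds

/-- For small `α` the bivector `w₊` is the normalized product of the fast and the slow mode. -/
theorem IsDecayingBasis.eventually_isWPlus (hξ : IsDensityProfile ν ξ) (hν : 1 < ν) (hβ : 0 < β)
    (hγ : 0 ≤ γ.re) (hb : IsDecayingBasis ν y₀ (modelProfile ξ y₀) β φ ψ γ) :
    ∀ᶠ α in 𝓝[>] (0 : ℝ),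
      IsWPlus ν ξ y₀ α β γ
        (fun y => wConst ν ξ y₀ α β γ • wedge (φ α γ y) (ψ α γ y)) ∧
      ∀ w, IsWPlus ν ξ y₀ α β γ w →
        w = fun y => wConst ν ξ y₀ α β γ • wedge (φ α γ y) (ψ α γ y) := by
  have hs := hξ.isModelProfile hν y₀
  have hp := hξ.pos hν
  have hl := hξ.lt_one hν
  have ht := tendsto_mk_smallAlpha γ
  filter_upwards [ht.eventually hb.fast_mode, ht.eventually hb.slow_mode,
    ht.eventually hb.fast_asymp, ht.eventually hb.slow_asymp,
    (self_mem_nhdsWithin : Set.Ioi (0 : ℝ) ∈ 𝓝[>] 0)] with α hφ hψ hfa hsa hα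
  have hα0 : 0 < α := hα
  have e0 : (α : ℂ) * β ≠ 0 := by exact_mod_cast (mul_pos hα0 hβ).ne'
  have e1 : (ξ y₀ : ℂ) ≠ 0 := by exact_mod_cast (hp y₀).ne'
  have e2 : (1 - ξ y₀ : ℂ) ≠ 0 := by exact_mod_cast (by linarith [hl y₀] : (1 - ξ y₀ : ℝ) ≠ 0)
  set lam := lambdaMinus ν 1 α β γ with hlam
  have hξinv : Tendsto (fun y => (ξ y : ℂ)⁻¹) atTop (𝓝 1) := by
    have := ((Complex.continuous_ofReal.tendsto 1).comp (hξ.tendsto_one hν)).inv₀ (by simp)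
    simpa using this
  set w₀ : ℝ → Matrix (Fin 5) (Fin 5) ℂ :=
    fun y => wConst ν ξ y₀ α β γ • wedge (φ α γ y) (ψ α γ y) with hw₀
  have hw : IsWPlus ν ξ y₀ α β γ w₀ := by
    refine ⟨fun y => ?_, fun y i j => ?_, fun i j => ?_⟩
    · ext i j
      simp only [hw₀, wedge, Matrix.transpose_apply, Matrix.neg_apply, Matrix.smul_apply,
        Matrix.of_apply, smul_eq_mul]
      ring
    · refine ((hφ.hasDerivAt_wedge hψ y i j).const_mul (wConst ν ξ y₀ α β γ)).congr_deriv ?_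
      simp only [hw₀, Matrix.mul_smul, Matrix.smul_mul, ← smul_add, Matrix.smul_apply,
        smul_eq_mul]
      ring
    · have h1 := (((hfa i).mul (hsa j)).sub ((hfa j).mul (hsa i)))
      have h2 := (hξinv.const_mul (α * β : ℂ)⁻¹).mul h1
      rw [mul_one] at h2
      refine (h2.congr' ?_)
      filter_upwards [eventually_ge_atTop y₀] with y hy
      rw [hξ.normalization_eq hν hy]
      have e3 : Complex.exp (-(1 + lam) * y₀) * Complex.exp ((1 + lam) * y₀) = 1 := by
        rw [← Complex.exp_add, neg_mul, neg_add_cancel, Complex.exp_zero]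
      have e4 : ((ξ y₀ / (1 - ξ y₀) : ℝ) : ℂ) * (((1 - ξ y₀) / ξ y₀ : ℝ) : ℂ) = 1 := by
        push_cast
        field_simp
      have e5 : (Real.exp (α * β * y) : ℂ) = Complex.exp (α * β * y) := by
        push_cast
        rfl
      simp only [hw₀, wConst, wedge, Matrix.smul_apply, Matrix.of_apply, smul_eq_mul, ← hlam, e5]
      generalize Complex.exp (-(1 + lam) * y₀) = a1 at e3 ⊢
      generalize Complex.exp ((1 + lam) * y₀) = a2 at e3 ⊢
      generalize ((ξ y₀ / (1 - ξ y₀) : ℝ) : ℂ) = a3 at e4 ⊢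
      generalize (((1 - ξ y₀) / ξ y₀ : ℝ) : ℂ) = a4 at e4 ⊢
      generalize (fastFactor ν (modelProfile ξ y₀) y₀ lam y)⁻¹ = a5
      generalize Complex.exp (α * β * y) = a6
      generalize (ξ y : ℂ)⁻¹ = a7
      generalize ((α : ℂ) * β)⁻¹ = a8
      linear_combination
        -(a8 * a7 * a5 * a6 * (φ α γ y i * ψ α γ y j - φ α γ y j * ψ α γ y i))
          * (a3 * a4 * e3 + e4)
  refine ⟨hw, fun w hw' => ?_⟩
  -- the difference of two solutions decays too fast
  funext y
  have hd0 := hs.bivector_eq_zero hα0 hβ hγ (d := fun y => w y - w₀ y)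
    (fun y => by
      rw [Matrix.transpose_sub, hw'.antisymm, hw.antisymm]
      abel)
    (fun y i j => by
      refine ((hw'.ode y i j).sub (hw.ode y i j)).congr_deriv ?_
      simp only [Matrix.mul_sub, Matrix.sub_mul, Matrix.add_apply, Matrix.sub_apply]
      ring)
    (fun i j => by
      have h1 := (hw'.limit i j).sub (hw.limit i j)
      rw [sub_self] at h1
      have h2 := ((Complex.continuous_ofReal.tendsto 1).comp (hξ.tendsto_one hν)).const_mul
        (Complex.exp ((1 + lam) * y₀) * (((1 - ξ y₀) / ξ y₀ : ℝ) : ℂ))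
      have h3 := h2.mul h1
      rw [mul_zero] at h3
      refine h3.congr' ?_
      filter_upwards [eventually_ge_atTop y₀] with y hy
      rw [← mul_sub, hξ.normalization_eq hν hy]
      have e3 : Complex.exp (-(1 + lam) * y₀) * Complex.exp ((1 + lam) * y₀) = 1 := by
        rw [← Complex.exp_add, neg_mul, neg_add_cancel, Complex.exp_zero]
      have e4 : ((ξ y₀ / (1 - ξ y₀) : ℝ) : ℂ) * (((1 - ξ y₀) / ξ y₀ : ℝ) : ℂ) = 1 := by
        push_cast
        field_simp
      have e5 : (ξ y : ℂ) * (ξ y : ℂ)⁻¹ = 1 := mul_inv_cancel₀ (by exact_mod_cast (hp y).ne')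
      simp only [Function.comp_apply, Matrix.sub_apply, ← hlam]
      generalize Complex.exp (-(1 + lam) * y₀) = a1 at e3 ⊢
      generalize Complex.exp ((1 + lam) * y₀) = a2 at e3 ⊢
      generalize ((ξ y₀ / (1 - ξ y₀) : ℝ) : ℂ) = a3 at e4 ⊢
      generalize (((1 - ξ y₀) / ξ y₀ : ℝ) : ℂ) = a4 at e4 ⊢
      generalize (fastFactor ν (modelProfile ξ y₀) y₀ lam y)⁻¹ = a5
      generalize Complex.exp (α * β * y) = a6
      generalize (ξ y : ℂ)⁻¹ = a7 at e5 ⊢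
      linear_combination (a6 * a5 * (w y i j - w₀ y i j))
        * (a3 * a4 * ξ y * a7 * e3 + ξ y * a7 * e4 + e5)) y
  exact sub_eq_zero.1 hd0

/-- The component of `F₊` along `T` has a finite limit, although its denominator tends to `0`. -/
theorem tendsto_coef_T0 {s : ℝ} (hs : 0 < s) (ν : ℝ) {β : ℝ} {γ : ℂ}
    (hne : (β : ℂ) ^ 2 - γ ^ 2 * s ^ 2 ≠ 0) :
    Tendsto (fun α : ℝ => (α : ℂ) ^ 2 / (lambdaPlus ν s α β γ - α * γ * s)) (𝓝[>] 0)
      (𝓝 (((s ^ ν : ℝ) : ℂ) / (β ^ 2 - γ ^ 2 * s ^ 2))) := by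
  have ht := tendsto_mk_smallAlpha γ
  have h1 : Tendsto (fun α : ℝ => lambdaPlus ν s α β γ) (𝓝[>] 0) (𝓝 0) := by
    have := ((tendsto_lambdaMinus hs ν β γ).comp ht).const_sub (-((s ^ ν : ℝ) : ℂ))
    rw [sub_self] at this
    exact this.congr fun α => (lambdaPlus_eq ν s α β γ).symm
  have h2 : Tendsto (fun α : ℝ => (α : ℂ)) (𝓝[>] 0) (𝓝 0) := by
    have := (tendsto_alpha γ).comp ht
    exact this
  have h3 := ((h1.add ((h2.mul_const γ).mul_const (s : ℂ))).add_const
    ((s ^ ν : ℝ) : ℂ)).div_const ((β : ℂ) ^ 2 - γ ^ 2 * s ^ 2)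
  simp only [zero_mul, zero_add] at h3
  refine h3.congr' ?_
  filter_upwards [(self_mem_nhdsWithin : Set.Ioi (0 : ℝ) ∈ 𝓝[>] 0)] with α hα
  have hα' : (α : ℂ) ≠ 0 := by exact_mod_cast (ne_of_gt hα : α ≠ 0)
  have hm := lambdaMinus_sq hs ν α β γ
  have hp := lambdaPlus_eq ν s α β γ
  have key : (lambdaPlus ν s α β γ - α * γ * s)
      * (lambdaPlus ν s α β γ + α * γ * s + ((s ^ ν : ℝ) : ℂ))
      = α ^ 2 * (β ^ 2 - γ ^ 2 * s ^ 2) := by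
    rw [hp]
    linear_combination hm
  have hne2 : lambdaPlus ν s α β γ - α * γ * s ≠ 0 := by
    intro h0
    rw [h0, zero_mul] at key
    exact (mul_ne_zero (pow_ne_zero 2 hα') hne) key.symm
  rw [div_eq_div_iff hne hne2, ← key]
  ring

/-- The coefficient of `E₀` in `F₊` need not be controlled, since `E₀` is another row of the
determinant. -/
theorem IsDecayingBasis.tendsto_evans (hξ : IsDensityProfile ν ξ) (hν : 1 < ν) (hβ : 0 < β)
    (hγ : 0 ≤ γ.re) (hγβ : γ * ξ y₀ ≠ β)
    (hb : IsDecayingBasis ν y₀ (modelProfile ξ y₀) β φ ψ γ) :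
    Tendsto (fun α : ℝ => evans ν ξ y₀ α β γ) (𝓝[>] 0)
      (𝓝 (β * (β - γ * ξ y₀) ^ 2 * (((ξ y₀ ^ ν : ℝ) : ℂ) / (β ^ 2 - γ ^ 2 * ξ y₀ ^ 2))
          * (ξ y₀ ^ 2 * (1 - ξ y₀) - (1 + ξ y₀) * (β + γ * ξ y₀) ^ 2))) := by
  have hp := hξ.pos hν y₀
  have hl := hξ.lt_one hν y₀
  have ht := tendsto_mk_smallAlpha γ
  have hne : (β : ℂ) ^ 2 - γ ^ 2 * ξ y₀ ^ 2 ≠ 0 := by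
    have h1 : (β : ℂ) ^ 2 - γ ^ 2 * ξ y₀ ^ 2 = (β - γ * ξ y₀) * (β + γ * ξ y₀) := by ring
    rw [h1]
    exact mul_ne_zero (sub_ne_zero.2 (Ne.symm hγβ)) (beta_add_ne hp hβ hγ)
  have e1 : (ξ y₀ : ℂ) ≠ 0 := by exact_mod_cast hp.ne'
  have e2 : (1 - ξ y₀ : ℂ) ≠ 0 := by exact_mod_cast (by linarith : (1 - ξ y₀ : ℝ) ≠ 0)
  set c : ℝ → ℂ := fun α => (α : ℂ) ^ 2 / (lambdaPlus ν (ξ y₀) α β γ - α * γ * ξ y₀) with hc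
  have hclim := tendsto_coef_T0 hp ν hne
  have hα0 : Tendsto (fun α : ℝ => (α : ℂ)) (𝓝[>] 0) (𝓝 0) := (tendsto_alpha γ).comp ht
  have hF : Tendsto (fun α : ℝ => (![0, 0, 0, 1, 0] : Fin 5 → ℂ) + (α : ℂ) • R0 (ξ y₀) β γ
      + c α • T0 (ξ y₀) β γ) (𝓝[>] 0) (𝓝 ((![0, 0, 0, 1, 0] : Fin 5 → ℂ)
        + (((ξ y₀ ^ ν : ℝ) : ℂ) / (β ^ 2 - γ ^ 2 * ξ y₀ ^ 2)) • T0 (ξ y₀) β γ)) := by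
    have := ((hα0.smul_const (R0 (ξ y₀) β γ)).const_add (![0, 0, 0, 1, 0] : Fin 5 → ℂ)).add
      (hclim.smul_const (T0 (ξ y₀) β γ))
    rw [zero_smul, add_zero] at this
    exact this
  have hdet := tendsto_det_of_rows
    (tendsto_pi_nhds.2 fun i => (hb.fast_init i).comp ht)
    (tendsto_pi_nhds.2 fun i => (hb.slow_init i).comp ht)
    (tendsto_const_nhds (x := E0 (ξ y₀) β γ)) (tendsto_const_nhds (x := EaPlus (ξ y₀) β γ)) hF
  rw [det_limit _ hβ] at hdet
  have hexp : Tendsto (fun α : ℝ => Complex.exp ((1 + lambdaMinus ν 1 α β γ) * y₀)) (𝓝[>] 0)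
      (𝓝 1) := by
    have h1 := (((tendsto_lambdaMinus_one ν β γ).comp ht).const_add 1).mul_const (y₀ : ℂ)
    rw [add_neg_cancel, zero_mul] at h1
    have h2 := (Complex.continuous_exp.tendsto 0).comp h1
    rw [Complex.exp_zero] at h2
    exact h2
  have hfin := hexp.mul hdet
  rw [one_mul] at hfin
  refine hfin.congr' ?_
  filter_upwards [hb.eventually_isWPlus hξ hν hβ hγ,
    (self_mem_nhdsWithin : Set.Ioi (0 : ℝ) ∈ 𝓝[>] 0)] with α hw hα
  have hα0 : 0 < α := hα
  have e0 : (α : ℂ) * β ≠ 0 := by exact_mod_cast (mul_pos hα0 hβ).ne'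
  have hW : wPlus ν ξ y₀ α β γ y₀
      = wConst ν ξ y₀ α β γ • wedge (φ α γ y₀) (ψ α γ y₀) := by
    have hex : ∃ w, IsWPlus ν ξ y₀ α β γ w := ⟨_, hw.1⟩
    unfold wPlus
    rw [dif_pos hex]
    exact congrFun (hw.2 _ hex.choose_spec) y₀
  unfold evans
  rw [hW, wedgeTop_smul, wedgeTop_wedge]
  unfold Fvec
  rw [det_add_smul_row]
  unfold wConst
  push_cast
  simp only [hc, Function.comp_apply]
  have hα' : (α : ℂ) ≠ 0 := left_ne_zero_of_mul e0
  have hβ' : (β : ℂ) ≠ 0 := right_ne_zero_of_mul e0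
  field_simp

end KullAnisimov

open KullAnisimov
theorem proposition3p4 (ν : ℝ) (hν : 1 < ν) (ξ : ℝ → ℝ) (hξ : IsDensityProfile ν ξ)
    (y₀ ξ₀ : ℝ) (hξ₀ : ξ₀ = ξ y₀) (β : ℝ) (hβ : 0 < β)
    (γs : ℝ) (hγs : γs = Real.sqrt ((1 - ξ₀) / (1 + ξ₀)) - β / ξ₀) :
    -- leading order of the Evans function
    (∀ γ : ℂ, 0 ≤ γ.re → γ * ξ₀ ≠ β →
      (∀ᶠ α : ℝ in 𝓝[>] 0, ∃! w : ℝ → Matrix (Fin 5) (Fin 5) ℂ, IsWPlus ν ξ y₀ α β γ w) ∧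
      Tendsto (fun α : ℝ => evans ν ξ y₀ α β γ) (𝓝[>] 0)
        (𝓝 (β * (β - γ * ξ₀) ^ 2 * (((ξ₀ ^ ν : ℝ) : ℂ) / (β ^ 2 - γ ^ 2 * ξ₀ ^ 2))
          * (ξ₀ ^ 2 * (1 - ξ₀) - (1 + ξ₀) * (β + γ * ξ₀) ^ 2)))) ∧
    -- as `α → 0` with `β` fixed, every growth rate in a fixed disc is close to `γs`
    (∀ M ε : ℝ, 0 < ε → ∃ α₀ > 0, ∀ P : Params, P.beta = β → P.alpha < α₀ →
      ∀ γ : ℂ, ‖γ‖ ≤ M → IsReducedGrowthRate P ν ξ y₀ γ → ‖γ - (γs : ℂ)‖ < ε) ∧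
    -- and, if `γs > 0`, there is exactly one growth rate in the disc; it is real
    (0 < γs → ∀ M ε : ℝ, γs < M → 0 < ε → ∃ α₀ > 0, ∀ P : Params, P.beta = β → P.alpha < α₀ →
      ∃ γ : ℝ, |γ| ≤ M ∧ |γ - γs| < ε ∧ IsReducedGrowthRate P ν ξ y₀ (γ : ℂ) ∧
        ∀ γ' : ℂ, ‖γ'‖ ≤ M → IsReducedGrowthRate P ν ξ y₀ γ' → γ' = (γ : ℂ)) ∧
    -- in physical variables, with the ablated density `ρ₀ = ρ_a ξ₀` and velocity `V_a / ξ₀`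
    (∀ P : Params, P.beta = β →
      Real.sqrt (P.g * P.k) * γs =
        Real.sqrt (P.g * P.k * ((P.rhoA - P.rhoA * ξ₀) / (P.rhoA + P.rhoA * ξ₀)))
          - P.k * (P.Va / ξ₀)) := by
  subst hξ₀
  have hs := hξ.isModelProfile hν y₀
  have hp := hξ.pos hν y₀
  have hl := hξ.lt_one hν y₀
  obtain ⟨φ, ψ, hb⟩ := hs.exists_isDecayingBasis hβ
  refine ⟨fun γ hγ hγβ => ⟨?_, (hb γ).tendsto_evans hξ hν hβ hγ hγβ⟩, fun M ε hε => ?_,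
    fun hγs0 M ε hM hε => ?_, fun P hP => ?_⟩
  · filter_upwards [(hb γ).eventually_isWPlus hξ hν hβ hγ] with α hw
    exact ⟨_, hw.1, hw.2⟩
  · have h := hs.eventually_growing_mode_close hl hβ M hε
    rw [← hγs] at h
    obtain ⟨α₀, hα₀, hα⟩ := mem_nhdsGT_iff_exists_Ioo_subset.1 h
    refine ⟨α₀, hα₀, fun P hP hPα γ hγ hg => ?_⟩
    rw [isReducedGrowthRate_iff hν hs.pos, hP] at hg
    exact hα ⟨P.alpha_pos, hPα⟩ γ hγ hg
  · have h := hs.eventually_exists_unique_growing_mode hl hβ hγs hγs0 hM hε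
    obtain ⟨α₀, hα₀, hα⟩ := mem_nhdsGT_iff_exists_Ioo_subset.1 h
    refine ⟨α₀, hα₀, fun P hP hPα => ?_⟩
    obtain ⟨γ, h1, h2, h3, h4⟩ := hα ⟨P.alpha_pos, hPα⟩
    refine ⟨γ, h1, h2, ?_, fun γ' h5 h6 => h4 γ' h5 ?_⟩
    · rw [isReducedGrowthRate_iff hν hs.pos, hP]
      exact h3
    · rwa [isReducedGrowthRate_iff hν hs.pos, hP] at h6
  · have hgk : 0 ≤ P.g * P.k := (mul_pos P.g_pos P.k_pos).le
    have h1 : (P.rhoA - P.rhoA * ξ y₀) / (P.rhoA + P.rhoA * ξ y₀) = (1 - ξ y₀) / (1 + ξ y₀) := by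
      rw [← mul_one_sub, ← mul_one_add, mul_div_mul_left _ _ P.rhoA_pos.ne']
    have h2 := P.beta_mul_sqrt
    rw [hP] at h2
    rw [hγs, h1, Real.sqrt_mul hgk, mul_sub, ← mul_div_assoc, ← mul_div_assoc, ← h2,
      mul_comm β]
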